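/- Let $p$ be a prime and let $E/\mathbb{Q}_p$ and $F/\mathbb{Q}_p$ be finite extensions; let $\mathcal{O}$ be the ring of integers of $E$ and $k$ its residue field. Let $A$ be a complete Noetherian local $\mathcal{O}$-algebra with maximal ideal $\mathfrak{m}_A$ such that $\mathcal{O}\to A$ is local and induces $k \cong A/\mathfrak{m}_A$; give $A$ its $\mathfrak{m}_A$-adic topology. Let $\mathbf{G}$ be a connected reductive group over $F$, let $\mathbf{P},\mathbf{P}^-$ be opposite parabolic $F$-subgroups with common Levi subgroup $\mathbf{L}=\mathbf{P}\cap\mathbf{P}^-$, and write $G,P^-,L$ for the groups of $F$-points with their $p$-adic topology. Let $K\subset G$ be a compact open subgroup with $G=P^-K$. For a profinite group $H$ put $A[[H]]=\varprojlim_{N} A[H/N]$ ($N$ open normal in $H$) with the inverse limit topology. For an $A$-module $U$ let $U^\vee=\mathrm{Hom}_A(U,A)$ with the topology of pointwise convergence, and with the contragredient action if a group acts on $U$. For $M$ a topological $A[[P^-\cap K]]$-module let $$A[[K]]\mathbin{\widehat\otimes}_{A[[P^-\cap K]]}M=\varprojlim_{J,M'}\; A[[K]]/J\otimes_{A[[P^-\cap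 K]]}M/M',$$ where $J$ runs over the open two-sided ideals of $A[[K]]$ and $M'$ over the open $A[[P^-\cap K]]$-submodules of $M$ (inverse limit topology of the discrete topologies). Let $\sigma$ be an orthonormalizable $\mathfrak{m}_A$-adically continuous representation of $L$ over $A$: an $A$-module which is $\mathfrak{m}_A$-adically complete and separated, with $\sigma/\mathfrak{m}_A^n\sigma$ free over $A/\mathfrak{m}_A^n$ for all $n$, and with an $A$-linear action of $L$ such that $L\times\sigma\to\sigma$ is continuous for the $\mathfrak{m}_A$-adic topology. Inflate $\sigma$ to $P^-$ along $P^-\twoheadrightarrow L$ and let $G$ act by right translation on $$\mathrm{Ind}_{P^-}^G\sigma=\{f:G\to\sigma \text{ continuous} : f(qg)=q f(g)\ \text{for all } q\in P^-,\ g\in G\}.$$ Then the contragredient actions of $P^-\cap K$ on $\sigma^\vee$ and of $K$ on $(\mathrm{Ind}_{P^-}^G\sigma)^\vee$ extend to structures of topological modules over $A[[P^-\cap K]]$ and $A[[K]]$ respectively, and there is an isomorphism of topological $A[[K]]$-modules $$A[[K]]\mathbin{\widehat\otimes}_{A[[P^-\cap K]]}\sigma^\vee \;\overset{\sim}{\longrightarrow}\;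 (\mathrm{Ind}_{P^-}^G\sigma)^\vee,$$ natural in $\sigma$, which sends $k\otimes\ell$ to $f\mapsto \ell(f(k^{-1}))$ for all $k\in K$ and $\ell\in\sigma^\vee$. Moreover, the natural map $A[K]\otimes_{A[P^-\cap K]}\sigma^\vee\to A[[K]]\mathbin{\widehat\otimes}_{A[[P^-\cap K]]}\sigma^\vee$ is injective with dense image, the natural map $A[K]\otimes_{A[P^-\cap K]}\sigma^\vee\to A[G]\otimes_{A[P^-]}\sigma^\vee$ is an isomorphism, and, under these maps, the action of $G$ on $A[G]\otimes_{A[P^-]}\sigma^\vee$ by left multiplication corresponds to the contragredient action of $G$ on $(\mathrm{Ind}_{P^-}^G\sigma)^\vee$. -/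

import Mathlib

open scoped TensorProduct
open IsLocalRing

universe v

noncomputable section

/-! ### Linear algebraic groups over a field `F` of characteristic zero

A linear algebraic group is identified with its group of points over an algebraic closure `Ω` of
`F`, as a Zariski closed subgroup of some `GL_n(Ω)`. It is an `F`-group if it is cut out by
polynomials with coefficients in `F`. -/

namespace AlgGrp

variable {n : ℕ} {Ω : Type*} [Field Ω]

/-- `H ⊆ GL_n(Ω)` is the zero locus of a set of polynomials in the matrix entries with
coefficients in the subfield `k` of `Ω`. -/
def IsClosedOver (k : Type*) [Field k] [Algebra k Ω] (H : Subgroup (GL (Fin n) Ω)) : Prop :=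
  ∃ S : Set (MvPolynomial (Fin n × Fin n) k), ∀ g : GL (Fin n) Ω,
    g ∈ H ↔ ∀ f ∈ S, MvPolynomial.aeval (fun ij : Fin n × Fin n => (g : Matrix (Fin n) (Fin n) Ω) ij.1 ij.2) f = 0

/-- A Zariski closed subgroup is connected iff it has no proper Zariski closed subgroup of finite
index. -/
def IsClosedConnected (H : Subgroup (GL (Fin n) Ω)) : Prop :=
  IsClosedOver Ω H ∧
    ∀ H' : Subgroup (GL (Fin n) Ω), H' ≤ H → IsClosedOver Ω H' → H'.relIndex H ≠ 0 → H' = H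

/-- `U` is a closed connected unipotent normal subgroup of `H`. -/
structure IsUnipotentNormal (H U : Subgroup (GL (Fin n) Ω)) : Prop where
  le : U ≤ H
  closedConnected : IsClosedConnected U
  unipotent : ∀ u ∈ U, IsNilpotent ((u : Matrix (Fin n) (Fin n) Ω) - 1)
  normal : ∀ h ∈ H, ∀ u ∈ U, h * u * h⁻¹ ∈ U

/-- `U` is the unipotent radical of `H`: the largest closed connected unipotent normal
subgroup. -/
def IsUnipotentRadical (H U : Subgroup (GL (Fin n) Ω)) : Prop :=
  IsUnipotentNormal H U ∧ ∀ U', IsUnipotentNormal H U' → U' ≤ U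

/-- Borel subgroups: maximal closed connected solvable subgroups. -/
def IsBorelSubgroup (G B : Subgroup (GL (Fin n) Ω)) : Prop :=
  Maximal (fun B' : Subgroup (GL (Fin n) Ω) => B' ≤ G ∧ IsClosedConnected B' ∧ Group.IsSolvable B') B

variable (F : Type*) [Field F] [Algebra F Ω]

/-- `G` is a connected reductive `F`-group. -/
structure IsConnectedReductive (G : Subgroup (GL (Fin n) Ω)) : Prop where
  overBase : IsClosedOver F G
  connected : IsClosedConnected G
  reductive : IsUnipotentRadical G ⊥

/-- `P` is a parabolic `F`-subgroup of `G`. -/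
structure IsParabolicSubgroup (G P : Subgroup (GL (Fin n) Ω)) : Prop where
  le : P ≤ G
  overBase : IsClosedOver F P
  exists_borel : ∃ B, IsBorelSubgroup G B ∧ B ≤ P

/-- `L` is a Levi `F`-subgroup of `P`: an `F`-subgroup such that `P = L ⋉ R_u(P)`. -/
structure IsLeviSubgroup (P L : Subgroup (GL (Fin n) Ω)) : Prop where
  le : L ≤ P
  overBase : IsClosedOver F L
  exists_radical : ∃ U, IsUnipotentRadical P U ∧ L ⊓ U = ⊥ ∧ ∀ q ∈ P, ∃ l ∈ L, ∃ u ∈ U, q = l * u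

/-- `P` and `Pm` are opposite parabolic `F`-subgroups of `G` with common Levi subgroup
`L = P ∩ Pm`. -/
structure IsOppositePair (G P Pm L : Subgroup (GL (Fin n) Ω)) : Prop where
  parabolic : IsParabolicSubgroup F G P
  parabolic_opp : IsParabolicSubgroup F G Pm
  levi : IsLeviSubgroup F P L
  levi_opp : IsLeviSubgroup F Pm L
  inter : P ⊓ Pm = L

/-- The group `H(F)` of `F`-rational points. -/
def points (H : Subgroup (GL (Fin n) Ω)) : Subgroup (GL (Fin n) F) :=
  H.comap (Matrix.GeneralLinearGroup.map (algebraMap F Ω))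

/-! The projection of a parabolic subgroup to a Levi subgroup, on `F`-rational points. -/

section Galois

variable {F}

/-- The action of a Galois automorphism on `GL_n(Ω)`. -/
abbrev gal (τ : Ω ≃ₐ[F] Ω) : GL (Fin n) Ω →* GL (Fin n) Ω :=
  Matrix.GeneralLinearGroup.map (τ : Ω →+* Ω)

lemma gal_apply (τ : Ω ≃ₐ[F] Ω) (g : GL (Fin n) Ω) (i j : Fin n) :
    (gal τ g).1 i j = τ (g.1 i j) := rfl

lemma gal_symm_gal (τ : Ω ≃ₐ[F] Ω) (g : GL (Fin n) Ω) : gal τ.symm (gal τ g) = g := by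
  ext i j
  change τ.symm (τ (g.1 i j)) = g.1 i j
  simp

lemma gal_gal_symm (τ : Ω ≃ₐ[F] Ω) (g : GL (Fin n) Ω) : gal τ (gal τ.symm g) = g := by
  ext i j
  change τ (τ.symm (g.1 i j)) = g.1 i j
  simp

lemma gal_mem_of_overBase {H : Subgroup (GL (Fin n) Ω)} (hH : IsClosedOver F H) (τ : Ω ≃ₐ[F] Ω)
    {g : GL (Fin n) Ω} (hg : g ∈ H) : gal τ g ∈ H := by
  obtain ⟨S, hS⟩ := hH
  rw [hS] at hg ⊢
  intro f hf
  have h := MvPolynomial.comp_aeval_apply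
    (fun ij : Fin n × Fin n => (g : Matrix (Fin n) (Fin n) Ω) ij.1 ij.2) (τ : Ω →ₐ[F] Ω) f
  rw [hg f hf, map_zero] at h
  exact h.symm

lemma isClosedOver_comap_gal {H : Subgroup (GL (Fin n) Ω)} (hH : IsClosedOver Ω H)
    (τ : Ω ≃ₐ[F] Ω) : IsClosedOver Ω (H.comap (gal τ)) := by
  obtain ⟨S, hS⟩ := hH
  refine ⟨MvPolynomial.map (τ.symm : Ω →+* Ω) '' S, fun g => ?_⟩
  rw [Subgroup.mem_comap, hS, Set.forall_mem_image]
  refine forall₂_congr fun f _ => ?_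
  have key : τ.symm (MvPolynomial.aeval (fun ij : Fin n × Fin n => (gal τ g).1 ij.1 ij.2) f) =
      MvPolynomial.aeval (fun ij : Fin n × Fin n => g.1 ij.1 ij.2)
        (MvPolynomial.map (τ.symm : Ω →+* Ω) f) := by
    rw [MvPolynomial.aeval_def, MvPolynomial.aeval_def, MvPolynomial.eval₂_map]
    change (τ.symm : Ω →+* Ω) _ = _
    rw [MvPolynomial.hom_eval₂]
    congr 1
    funext ij
    exact τ.symm_apply_apply _
  rw [← key]
  simp

lemma isClosedConnected_comap_gal {H : Subgroup (GL (Fin n) Ω)} (hH : IsClosedConnected H)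
    (τ : Ω ≃ₐ[F] Ω) : IsClosedConnected (H.comap (gal τ)) := by
  refine ⟨isClosedOver_comap_gal hH.1 τ, fun H' hle hcl hidx => ?_⟩
  have hsurj : Function.Surjective (gal τ : GL (Fin n) Ω →* GL (Fin n) Ω) :=
    fun g => ⟨gal τ.symm g, gal_gal_symm τ g⟩
  have hback : (H'.comap (gal τ.symm)).comap (gal τ) = H' := by
    ext g
    simp only [Subgroup.mem_comap, gal_symm_gal]
  have h1 : H'.comap (gal τ.symm) = H := by
    refine hH.2 _ (fun g hg => ?_) (isClosedOver_comap_gal hcl τ.symm) ?_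
    · have := hle hg
      rwa [Subgroup.mem_comap, gal_gal_symm] at this
    · rw [← hback, Subgroup.relIndex_comap, Subgroup.map_comap_eq_self_of_surjective hsurj] at hidx
      exact hidx
  rw [← h1, hback]

lemma radical_gal_stable {P U : Subgroup (GL (Fin n) Ω)} (hP : IsClosedOver F P)
    (hU : IsUnipotentRadical P U) (τ : Ω ≃ₐ[F] Ω) {u : GL (Fin n) Ω} (hu : u ∈ U) :
    gal τ u ∈ U := by
  have hN : IsUnipotentNormal P (U.comap (gal τ.symm)) := by
    refine ⟨fun g hg => ?_, isClosedConnected_comap_gal hU.1.closedConnected _, fun g hg => ?_,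
      fun h hh g hg => ?_⟩
    · have := gal_mem_of_overBase hP τ (hU.1.le hg)
      rwa [gal_gal_symm] at this
    · have h1 := (hU.1.unipotent _ hg).map ((τ : Ω →+* Ω).mapMatrix (m := Fin n))
      have h2 : (τ : Ω →+* Ω).mapMatrix (((gal τ.symm g : GL (Fin n) Ω) : Matrix _ _ Ω) - 1)
          = (g : Matrix (Fin n) (Fin n) Ω) - 1 := by
        rw [map_sub, map_one]
        congr 1
        exact congrArg Units.val (gal_gal_symm τ g)
      rwa [h2] at h1
    · rw [Subgroup.mem_comap, map_mul, map_mul, map_inv]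
      exact hU.1.normal _ (gal_mem_of_overBase hP _ hh) _ hg
  refine hU.2 _ hN ?_
  rw [Subgroup.mem_comap, gal_symm_gal]
  exact hu

lemma exists_rational_of_fixed [IsGalois F Ω] (g : GL (Fin n) Ω)
    (hg : ∀ τ : Ω ≃ₐ[F] Ω, gal τ g = g) :
    ∃ g₀ : GL (Fin n) F, Matrix.GeneralLinearGroup.map (algebraMap F Ω) g₀ = g := by
  have h : ∀ i j, ∃ x : F, algebraMap F Ω x = g.1 i j := fun i j => by
    have : g.1 i j ∈ (⊥ : IntermediateField F Ω) :=
      (InfiniteGalois.mem_bot_iff_fixed _).2 fun τ => by rw [← gal_apply, hg]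
    exact IntermediateField.mem_bot.1 this
  choose M hM using h
  have hMg : (algebraMap F Ω).mapMatrix (Matrix.of M) = g.1 := by
    ext i j
    exact hM i j
  have hdet : (Matrix.of M).det ≠ 0 := fun h0 => by
    have h1 := (algebraMap F Ω).map_det (Matrix.of M)
    rw [hMg, h0, map_zero] at h1
    exact (Matrix.isUnits_det_units g).ne_zero h1.symm
  refine ⟨Matrix.GeneralLinearGroup.mkOfDetNeZero (Matrix.of M) hdet, ?_⟩
  ext i j
  exact hM i j

end Galois

/-- For `q ∈ P(F)` the `L`-component of `q` in `P = L ⋉ R_u(P)` is `F`-rational. -/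
lemma exists_levi_component [IsGalois F Ω] {P L U : Subgroup (GL (Fin n) Ω)}
    (hP : IsClosedOver F P) (hL : IsClosedOver F L) (hU : IsUnipotentRadical P U)
    (hLU : L ⊓ U = ⊥) (hdec : ∀ q ∈ P, ∃ l ∈ L, ∃ u ∈ U, q = l * u) (q : points F P) :
    ∃ l : points F L, Matrix.GeneralLinearGroup.map (algebraMap F Ω) (l.1⁻¹ * q.1) ∈ U := by
  obtain ⟨l, hl, u, hu, hq⟩ := hdec _ q.2
  have hfix : ∀ τ : Ω ≃ₐ[F] Ω, gal τ l = l := fun τ => by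
    have hqq : gal τ (Matrix.GeneralLinearGroup.map (algebraMap F Ω) q.1) =
        Matrix.GeneralLinearGroup.map (algebraMap F Ω) q.1 := by
      ext i j
      exact τ.commutes _
    rw [hq, map_mul] at hqq
    have h1 : l⁻¹ * gal τ l = u * (gal τ u)⁻¹ := by
      rw [inv_mul_eq_iff_eq_mul, ← mul_assoc, eq_mul_inv_iff_mul_eq]
      exact hqq
    have h2 : l⁻¹ * gal τ l ∈ L ⊓ U :=
      ⟨L.mul_mem (L.inv_mem hl) (gal_mem_of_overBase hL τ hl),
        h1 ▸ U.mul_mem hu (U.inv_mem (radical_gal_stable hP hU τ hu))⟩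
    rw [hLU, Subgroup.mem_bot, inv_mul_eq_one] at h2
    exact h2.symm
  obtain ⟨l₀, hl₀⟩ := exists_rational_of_fixed l hfix
  refine ⟨⟨l₀, by rw [points, Subgroup.mem_comap, hl₀]; exact hl⟩, ?_⟩
  rw [map_mul, map_inv, hl₀, hq, inv_mul_cancel_left]
  exact hu

lemma levi_component_unique {P L U : Subgroup (GL (Fin n) Ω)} (hLU : L ⊓ U = ⊥)
    (q : points F P) (l l' : points F L)
    (h : Matrix.GeneralLinearGroup.map (algebraMap F Ω) (l.1⁻¹ * q.1) ∈ U)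
    (h' : Matrix.GeneralLinearGroup.map (algebraMap F Ω) (l'.1⁻¹ * q.1) ∈ U) : l = l' := by
  have h2 : Matrix.GeneralLinearGroup.map (algebraMap F Ω) (l.1⁻¹ * l'.1) ∈ L ⊓ U := by
    refine ⟨(points F L).mul_mem ((points F L).inv_mem l.2) l'.2, ?_⟩
    have h3 := U.mul_mem h (U.inv_mem h')
    rw [← map_inv, ← map_mul] at h3
    have h4 : l.1⁻¹ * q.1 * (l'.1⁻¹ * q.1)⁻¹ = l.1⁻¹ * l'.1 := by group
    rwa [h4] at h3
  rw [hLU, Subgroup.mem_bot] at h2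
  have hinj : Function.Injective (Matrix.GeneralLinearGroup.map (n := Fin n)
      (algebraMap F Ω)) := fun a b hab => by
    ext i j
    exact (algebraMap F Ω).injective
      (congrArg (fun g : GL (Fin n) Ω => (g : Matrix (Fin n) (Fin n) Ω) i j) hab)
  exact Subtype.ext (inv_mul_eq_one.1 (hinj (h2.trans (map_one _).symm)))

/-- The projection `P(F) → L(F)` with kernel `R_u(P)(F)`: the element `q` is sent to the unique
`l ∈ L(F)` with `l⁻¹ q ∈ R_u(P)`. -/
def leviProj [IsGalois F Ω] {P L : Subgroup (GL (Fin n) Ω)} (hP : IsClosedOver F P)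
    (hL : IsLeviSubgroup F P L) : points F P →* points F L :=
  have hU := hL.exists_radical.choose_spec
  have ex := exists_levi_component F hP hL.overBase hU.1 hU.2.1 hU.2.2
  { toFun := fun q => (ex q).choose
    map_one' := levi_component_unique F hU.2.1 _ _ _ (ex 1).choose_spec (by
      simp only [OneMemClass.coe_one, inv_one, mul_one]
      rw [MonoidHom.map_one]
      exact Subgroup.one_mem _)
    map_mul' := fun q q' => levi_component_unique F hU.2.1 _ _ _ (ex (q * q')).choose_spec (by
      have h1 := (ex q).choose_spec
      have h2 := (ex q').choose_spec
      generalize (ex q).choose = l at *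
      generalize (ex q').choose = l' at *
      have h3 := hU.1.1.normal _ (hL.le ((points F L).inv_mem l'.2)) _ h1
      have h4 := Subgroup.mul_mem _ h3 h2
      rw [← map_inv, ← map_mul, ← map_mul, ← map_mul] at h4
      have h5 : l'.1⁻¹ * (l.1⁻¹ * q.1) * (l'.1⁻¹)⁻¹ * (l'.1⁻¹ * q'.1) =
          (l * l').1⁻¹ * (q * q').1 := by
        simp only [Subgroup.coe_mul]
        group
      rwa [h5] at h4) }

/-- The restriction of `leviProj` to `P(F)` viewed as a subgroup of `G(F)`. -/
def leviProjIn [IsGalois F Ω] (G : Subgroup (GL (Fin n) Ω)) {P L : Subgroup (GL (Fin n) Ω)}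
    (hP : IsClosedOver F P) (hL : IsLeviSubgroup F P L) :
    (points F P).subgroupOf (points F G) →* points F L :=
  (leviProj F hP hL).comp ((points F G).subtype.subgroupComap (points F P))

end AlgGrp

/-! ### Completed group algebras -/

section CompletedGroupAlgebra

variable (A : Type*) [CommRing A] (H : Type*) [Group H] [TopologicalSpace H]

variable {H} in
/-- The projection `A[H/N] → A[H/N']` for open normal subgroups `N ≤ N'`. -/
def groupAlgebraTransition {N N' : OpenNormalSubgroup H} (h : N.toSubgroup ≤ N'.toSubgroup) :
    MonoidAlgebra A (H ⧸ N.toSubgroup) →ₐ[A] MonoidAlgebra A (H ⧸ N'.toSubgroup) :=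
  MonoidAlgebra.mapDomainAlgHom A A (QuotientGroup.map _ _ (MonoidHom.id H) h)

/-- The compatible families in `∏_N A[H/N]`, where `N` runs over the open normal subgroups. -/
def completedGroupSubalgebra :
    Subalgebra A (∀ N : OpenNormalSubgroup H, MonoidAlgebra A (H ⧸ N.toSubgroup)) where
  carrier := {x | ∀ (N N' : OpenNormalSubgroup H) (h : N.toSubgroup ≤ N'.toSubgroup),
    groupAlgebraTransition A h (x N) = x N'}
  mul_mem' hx hy N N' h := by
    rw [Pi.mul_apply, Pi.mul_apply, map_mul, hx N N' h, hy N N' h]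
  add_mem' hx hy N N' h := by
    rw [Pi.add_apply, Pi.add_apply, map_add, hx N N' h, hy N N' h]
  algebraMap_mem' a N N' h := by
    rw [Pi.algebraMap_apply, Pi.algebraMap_apply, AlgHom.commutes]

/-- The completed group algebra `A[[H]] = lim_N A[H/N]`. -/
def CompletedGroupAlgebra : Type _ := ↥(completedGroupSubalgebra A H)

instance : Ring (CompletedGroupAlgebra A H) :=
  inferInstanceAs (Ring ↥(completedGroupSubalgebra A H))

instance : Algebra A (CompletedGroupAlgebra A H) :=
  inferInstanceAs (Algebra A ↥(completedGroupSubalgebra A H))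

/-- The inverse limit topology on `A[[H]]`, where `A[H/N]` is given the product topology of
`A^(H/N)`. -/
instance [TopologicalSpace A] : TopologicalSpace (CompletedGroupAlgebra A H) :=
  TopologicalSpace.induced
    (fun x (N : OpenNormalSubgroup H) (c : H ⧸ N.toSubgroup) => (x.1 N).coeff c) inferInstance

variable {H}

/-- The canonical map `A[H] → A[[H]]`. -/
def CompletedGroupAlgebra.of : MonoidAlgebra A H →ₐ[A] CompletedGroupAlgebra A H :=
  AlgHom.codRestrict
    (AlgHom.pi fun N : OpenNormalSubgroup H =>
      MonoidAlgebra.mapDomainAlgHom A A (QuotientGroup.mk' N.toSubgroup))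
    (completedGroupSubalgebra A H) (fun x N N' h => by
      change groupAlgebraTransition A h
        (MonoidAlgebra.mapDomainAlgHom A A (QuotientGroup.mk' N.toSubgroup) x) =
        MonoidAlgebra.mapDomainAlgHom A A (QuotientGroup.mk' N'.toSubgroup) x
      rw [groupAlgebraTransition, ← AlgHom.comp_apply]
      congr 1
      ext h
      simp
      rfl)

/-- The preimage of an open normal subgroup under a continuous homomorphism. -/
def openNormalComap {H' : Type*} [Group H'] [TopologicalSpace H'] (φ : H →* H')
    (hφ : Continuous φ) (N : OpenNormalSubgroup H') : OpenNormalSubgroup H where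
  toOpenSubgroup := N.toOpenSubgroup.comap φ hφ
  isNormal' := N.isNormal'.comap φ

/-- The homomorphism `A[[H]] → A[[H']]` induced by a continuous homomorphism `H → H'`. -/
def CompletedGroupAlgebra.map {H' : Type*} [Group H'] [TopologicalSpace H'] (φ : H →* H')
    (hφ : Continuous φ) : CompletedGroupAlgebra A H →ₐ[A] CompletedGroupAlgebra A H' :=
  AlgHom.codRestrict
    (AlgHom.pi fun N : OpenNormalSubgroup H' =>
      (MonoidAlgebra.mapDomainAlgHom A A
        (QuotientGroup.map (openNormalComap φ hφ N).toSubgroup N.toSubgroup φ le_rfl)).comp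
      ((Pi.evalAlgHom A (fun N : OpenNormalSubgroup H => MonoidAlgebra A (H ⧸ N.toSubgroup))
        (openNormalComap φ hφ N)).comp (completedGroupSubalgebra A H).val))
    (completedGroupSubalgebra A H') (fun x N N' h => by
      change groupAlgebraTransition A h (MonoidAlgebra.mapDomainAlgHom A A
        (QuotientGroup.map (openNormalComap φ hφ N).toSubgroup N.toSubgroup φ le_rfl)
        (x.1 (openNormalComap φ hφ N))) = MonoidAlgebra.mapDomainAlgHom A A
        (QuotientGroup.map (openNormalComap φ hφ N').toSubgroup N'.toSubgroup φ le_rfl)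
        (x.1 (openNormalComap φ hφ N'))
      have hle : (openNormalComap φ hφ N).toSubgroup ≤ (openNormalComap φ hφ N').toSubgroup :=
        Subgroup.comap_mono h
      rw [← x.2 _ _ hle, groupAlgebraTransition, groupAlgebraTransition, ← AlgHom.comp_apply,
        ← AlgHom.comp_apply]
      congr 1
      ext c
      induction c using QuotientGroup.induction_on with
      | H c =>
        simp
        rfl)

end CompletedGroupAlgebra

/-! ### Tensor products over noncommutative algebras -/

section BalancedTensor

variable {A : Type*} [CommRing A] {X Y X' Y' : Type*} [AddCommGroup X] [Module A X]
  [AddCommGroup Y] [Module A Y] [AddCommGroup X'] [Module A X'] [AddCommGroup Y'] [Module A Y']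
  {R R' : Type*}

/-- If the `A`-algebra `R` acts on `X` from the right through `a` and on `Y` from the left through
`b`, this is `X ⊗_R Y`, that is, the quotient of `X ⊗_A Y` by all `x r ⊗ y - x ⊗ r y`. -/
def BalancedTensor (a : R → X →ₗ[A] X) (b : R → Y →ₗ[A] Y) : Type _ :=
  (X ⊗[A] Y) ⧸ Submodule.span A
    {t : X ⊗[A] Y | ∃ (r : R) (x : X) (y : Y), t = a r x ⊗ₜ[A] y - x ⊗ₜ[A] b r y}

instance (a : R → X →ₗ[A] X) (b : R → Y →ₗ[A] Y) : AddCommGroup (BalancedTensor a b) :=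
  inferInstanceAs (AddCommGroup ((X ⊗[A] Y) ⧸ Submodule.span A
    {t : X ⊗[A] Y | ∃ (r : R) (x : X) (y : Y), t = a r x ⊗ₜ[A] y - x ⊗ₜ[A] b r y}))

instance (a : R → X →ₗ[A] X) (b : R → Y →ₗ[A] Y) : Module A (BalancedTensor a b) :=
  inferInstanceAs (Module A ((X ⊗[A] Y) ⧸ Submodule.span A
    {t : X ⊗[A] Y | ∃ (r : R) (x : X) (y : Y), t = a r x ⊗ₜ[A] y - x ⊗ₜ[A] b r y}))

/-- The pure tensor `x ⊗ y` in `X ⊗_R Y`. -/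
def BalancedTensor.tmul (a : R → X →ₗ[A] X) (b : R → Y →ₗ[A] Y) (x : X) (y : Y) :
    BalancedTensor a b :=
  Submodule.Quotient.mk (x ⊗ₜ[A] y)

lemma BalancedTensor.induction {a : R → X →ₗ[A] X} {b : R → Y →ₗ[A] Y}
    {p : BalancedTensor a b → Prop} (t : BalancedTensor a b) (h0 : p 0)
    (htmul : ∀ x y, p (BalancedTensor.tmul a b x y)) (hadd : ∀ s t, p s → p t → p (s + t)) :
    p t := by
  obtain ⟨t, rfl⟩ := Submodule.Quotient.mk_surjective _ t
  induction t using TensorProduct.induction_on with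
  | zero => exact h0
  | add x y hx hy => exact hadd _ _ hx hy
  | tmul x y => exact htmul x y

/-- Functoriality of `X ⊗_R Y` in `X`, `Y` and `R`. -/
def BalancedTensor.map {a : R → X →ₗ[A] X} {b : R → Y →ₗ[A] Y} {a' : R' → X' →ₗ[A] X'}
    {b' : R' → Y' →ₗ[A] Y'} (c : R → R') (f : X →ₗ[A] X') (g : Y →ₗ[A] Y')
    (hf : ∀ r x, f (a r x) = a' (c r) (f x)) (hg : ∀ r y, g (b r y) = b' (c r) (g y)) :
    BalancedTensor a b →ₗ[A] BalancedTensor a' b' :=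
  Submodule.mapQ _ _ (TensorProduct.map f g) (by
    rw [Submodule.span_le]
    rintro _ ⟨r, x, y, rfl⟩
    refine Submodule.subset_span ⟨c r, f x, g y, ?_⟩
    rw [map_sub, TensorProduct.map_tmul, TensorProduct.map_tmul, hf, hg])

end BalancedTensor

/-! ### The completed tensor product `S ⊗̂_R M` -/

section CompletedTensor

variable {A : Type*} [CommRing A] {R S : Type*} [Ring R] [Algebra A R] [Ring S] [Algebra A S]
  [TopologicalSpace S] {M : Type*} [AddCommGroup M] [Module A M] [TopologicalSpace M]
  (θ : R →ₐ[A] S) (α : R →ₐ[A] Module.End A M)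

variable (S) in
/-- A pair consisting of an open two-sided ideal of `S` and an open `R`-submodule of `M`. -/
structure CompletedTensorIndex where
  J : Submodule A S
  J_open : IsOpen (J : Set S)
  J_left : ∀ (s : S), ∀ x ∈ J, s * x ∈ J
  J_right : ∀ (s : S), ∀ x ∈ J, x * s ∈ J
  N : Submodule A M
  N_open : IsOpen (N : Set M)
  N_smul : ∀ (r : R), ∀ m ∈ N, α r m ∈ N

namespace CompletedTensorIndex

variable {α}

/-- The right action of `R` on `S / J`. -/
def rightAct (i : CompletedTensorIndex S α) (r : R) : (S ⧸ i.J) →ₗ[A] (S ⧸ i.J) :=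
  i.J.mapQ i.J (LinearMap.mulRight A (θ r)) fun x hx => i.J_right (θ r) x hx

/-- The left action of `S` on `S / J`. -/
def leftAct (i : CompletedTensorIndex S α) (s : S) : (S ⧸ i.J) →ₗ[A] (S ⧸ i.J) :=
  i.J.mapQ i.J (LinearMap.mulLeft A s) fun x hx => i.J_left s x hx

/-- The left action of `R` on `M / N`. -/
def modAct (i : CompletedTensorIndex S α) (r : R) : (M ⧸ i.N) →ₗ[A] (M ⧸ i.N) :=
  i.N.mapQ i.N (α r) fun m hm => i.N_smul r m hm

/-- `S / J ⊗_R M / N`. -/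
def Level (i : CompletedTensorIndex S α) : Type _ :=
  BalancedTensor (i.rightAct θ) i.modAct

instance (i : CompletedTensorIndex S α) : AddCommGroup (i.Level θ) :=
  inferInstanceAs (AddCommGroup (BalancedTensor (i.rightAct θ) i.modAct))

instance (i : CompletedTensorIndex S α) : Module A (i.Level θ) :=
  inferInstanceAs (Module A (BalancedTensor (i.rightAct θ) i.modAct))

/-- The left action of `S` on `S / J ⊗_R M / N`. -/
def levelAct (i : CompletedTensorIndex S α) (s : S) : i.Level θ →ₗ[A] i.Level θ :=
  BalancedTensor.map (a := i.rightAct θ) (b := i.modAct) (a' := i.rightAct θ) (b' := i.modAct)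
    id (i.leftAct s) LinearMap.id
    (fun r x => by
      obtain ⟨x, rfl⟩ := Submodule.Quotient.mk_surjective _ x
      exact congrArg Submodule.Quotient.mk (mul_assoc s x (θ r)).symm)
    (fun _ _ => rfl)

/-- The transition map `S / J ⊗_R M / N → S / J' ⊗_R M / N'` for `J ≤ J'` and `N ≤ N'`. -/
def transition {i j : CompletedTensorIndex S α} (hJ : i.J ≤ j.J) (hN : i.N ≤ j.N) :
    i.Level θ →ₗ[A] j.Level θ :=
  BalancedTensor.map (a := i.rightAct θ) (b := i.modAct) (a' := j.rightAct θ) (b' := j.modAct)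
    id (Submodule.factor hJ) (Submodule.factor hN)
    (fun r x => by
      obtain ⟨x, rfl⟩ := Submodule.Quotient.mk_surjective _ x
      rfl)
    (fun r y => by
      obtain ⟨y, rfl⟩ := Submodule.Quotient.mk_surjective _ y
      rfl)

lemma transition_levelAct {i j : CompletedTensorIndex S α} (hJ : i.J ≤ j.J) (hN : i.N ≤ j.N)
    (s : S) (t : i.Level θ) :
    transition θ hJ hN (i.levelAct θ s t) = j.levelAct θ s (transition θ hJ hN t) := by
  refine BalancedTensor.induction (a := i.rightAct θ) (b := i.modAct)
    (p := fun t : i.Level θ => transition θ hJ hN (i.levelAct θ s t) =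
      j.levelAct θ s (transition θ hJ hN t)) t ?_ (fun x y => ?_) (fun x y hx hy => ?_)
  · change transition θ hJ hN (i.levelAct θ s (0 : i.Level θ)) =
      j.levelAct θ s (transition θ hJ hN (0 : i.Level θ))
    simp only [map_zero]
  · obtain ⟨x, rfl⟩ := Submodule.Quotient.mk_surjective _ x
    obtain ⟨y, rfl⟩ := Submodule.Quotient.mk_surjective _ y
    rfl
  · change i.Level θ at x y
    change transition θ hJ hN (i.levelAct θ s (x + y)) =
      j.levelAct θ s (transition θ hJ hN (x + y))
    simp only [map_add, hx, hy]

end CompletedTensorIndex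

/-- `S ⊗̂_R M = lim S / J ⊗_R M / N`, the limit being over the open two-sided ideals `J` of `S` and
the open `R`-submodules `N` of `M`. -/
def completedTensorSubmodule :
    Submodule A (∀ i : CompletedTensorIndex S α, i.Level θ) where
  carrier := {x | ∀ (i j : CompletedTensorIndex S α) (hJ : i.J ≤ j.J) (hN : i.N ≤ j.N),
    CompletedTensorIndex.transition θ hJ hN (x i) = x j}
  add_mem' hx hy i j hJ hN := by
    rw [Pi.add_apply, Pi.add_apply, map_add, hx i j hJ hN, hy i j hJ hN]
  zero_mem' i j hJ hN := map_zero _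
  smul_mem' a x hx i j hJ hN := by
    rw [Pi.smul_apply, Pi.smul_apply, map_smul, hx i j hJ hN]

/-- The completed tensor product `S ⊗̂_R M`. -/
def CompletedTensor : Type _ := ↥(completedTensorSubmodule θ α)

instance : AddCommGroup (CompletedTensor θ α) :=
  inferInstanceAs (AddCommGroup ↥(completedTensorSubmodule θ α))

instance : Module A (CompletedTensor θ α) :=
  inferInstanceAs (Module A ↥(completedTensorSubmodule θ α))

/-- The inverse limit topology of the discrete topologies on `S / J ⊗_R M / N`. -/
instance : TopologicalSpace (CompletedTensor θ α) :=
  TopologicalSpace.induced Subtype.val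
    (@Pi.topologicalSpace (CompletedTensorIndex S α) (fun i => i.Level θ) fun _ => ⊥)

namespace CompletedTensor

/-- The left action of `S` on `S ⊗̂_R M`. -/
def act (s : S) : CompletedTensor θ α →ₗ[A] CompletedTensor θ α :=
  LinearMap.restrict (p := completedTensorSubmodule θ α) (q := completedTensorSubmodule θ α)
    (LinearMap.pi fun i => i.levelAct θ s ∘ₗ LinearMap.proj i)
    (fun x hx i j hJ hN => by
      change CompletedTensorIndex.transition θ hJ hN (i.levelAct θ s (x i)) =
        j.levelAct θ s (x j)
      rw [CompletedTensorIndex.transition_levelAct, hx i j hJ hN])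

/-- The image of `s ⊗ m` in `S ⊗̂_R M`. -/
def tmul (s : S) (m : M) : CompletedTensor θ α :=
  ⟨fun i => BalancedTensor.tmul (i.rightAct θ) i.modAct
    (Submodule.Quotient.mk s) (Submodule.Quotient.mk m), fun _ _ _ _ => rfl⟩

end CompletedTensor

end CompletedTensor

/-! ### Adically continuous representations, their duals, and continuous induction -/

section Representations

variable (A : Type*) [CommRing A] [IsLocalRing A]

/-- The `𝔪_A`-adic topology on an `A`-module. -/
abbrev adicTop (U : Type*) [AddCommGroup U] [Module A U] : TopologicalSpace U :=
  (maximalIdeal A).adicModuleTopology U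

/-- `U` is complete and separated for the `𝔪_A`-adic topology and `U / 𝔪_A^n U` is free over
`A / 𝔪_A^n` for all `n`. -/
def IsOrthonormalizable (U : Type*) [AddCommGroup U] [Module A U] : Prop :=
  IsAdicComplete (maximalIdeal A) U ∧ ∀ n : ℕ,
    Module.Free (A ⧸ maximalIdeal A ^ n) (U ⧸ (maximalIdeal A ^ n • ⊤ : Submodule A U))

variable {A} in
/-- `U` is complete and separated for the `𝔪_A`-adic topology and the action `Γ × U → U` is
continuous for this topology. -/
def IsAdicallyContinuous {Γ : Type*} [Group Γ] [TopologicalSpace Γ] {U : Type*} [AddCommGroup U]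
    [Module A U] (ρ : Representation A Γ U) : Prop :=
  IsAdicComplete (maximalIdeal A) U ∧
    letI := adicTop A U
    Continuous fun x : Γ × U => ρ x.1 x.2

/-- An orthonormalizable `𝔪_A`-adically continuous representation of `Γ` over `A`. -/
structure OrthContRep (Γ : Type*) [Group Γ] [TopologicalSpace Γ] where
  V : Type v
  [addCommGroup : AddCommGroup V]
  [module : Module A V]
  ρ : Representation A Γ V
  continuous : IsAdicallyContinuous ρ
  orthonormalizable : IsOrthonormalizable A V

attribute [instance] OrthContRep.addCommGroup OrthContRep.module

variable {A} {Γ : Type*} [Group Γ] [TopologicalSpace Γ]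

/-- The continuous induction `Ind_P^Γ ρ`: the continuous functions `f : Γ → U`, for the
`𝔪_A`-adic topology on `U`, with `f (q g) = ρ q (f g)` for all `q ∈ P` and `g ∈ Γ`. -/
def contInd {P : Subgroup Γ} {U : Type*} [AddCommGroup U] [Module A U]
    (ρ : Representation A P U) : Submodule A (Γ → U) where
  carrier := {f | @Continuous Γ U _ (adicTop A U) f ∧
    ∀ (q : P) (g : Γ), f (q * g) = ρ q (f g)}
  add_mem' {f f'} hf hf' := by
    let _ : WithIdeal A := ⟨maximalIdeal A⟩
    let _ : TopologicalSpace U := WithIdeal.topologicalSpaceModule A U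
    have _ : IsTopologicalAddGroup U := inferInstance
    refine ⟨Continuous.add hf.1 hf'.1, fun q g => ?_⟩
    rw [Pi.add_apply, Pi.add_apply, map_add, hf.2, hf'.2]
  zero_mem' := ⟨@continuous_const _ _ _ (adicTop A U) _, fun q g => (map_zero _).symm⟩
  smul_mem' a f hf := by
    let _ : WithIdeal A := ⟨maximalIdeal A⟩
    let _ : TopologicalSpace U := WithIdeal.topologicalSpaceModule A U
    have _ : ContinuousSMul A U := inferInstance
    refine ⟨Continuous.const_smul hf.1 a, fun q g => ?_⟩
    rw [Pi.smul_apply, Pi.smul_apply, map_smul, hf.2]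

/-- The action of `Γ` on `Ind_P^Γ ρ` by right translation. -/
def contIndRep [ContinuousMul Γ] {P : Subgroup Γ} {U : Type*} [AddCommGroup U] [Module A U]
    (ρ : Representation A P U) : Representation A Γ (contInd ρ) where
  toFun g := LinearMap.restrict (LinearMap.funLeft A U fun x => x * g) fun f hf =>
    ⟨@Continuous.comp Γ Γ U _ _ (adicTop A U) (fun x => x * g) f hf.1 (continuous_mul_const g),
      fun q x => by
        rw [LinearMap.funLeft_apply, LinearMap.funLeft_apply, mul_assoc, hf.2]⟩
  map_one' := by
    ext f x
    exact congrArg f.1 (mul_one x)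
  map_mul' g h := by
    ext f x
    exact congrArg f.1 (mul_assoc x g h).symm

lemma continuous_adicTop {U U' : Type*} [AddCommGroup U] [Module A U] [AddCommGroup U']
    [Module A U'] (φ : U →ₗ[A] U') : @Continuous U U' (adicTop A U) (adicTop A U') φ := by
  let _ : WithIdeal A := ⟨maximalIdeal A⟩
  let _ : TopologicalSpace U := WithIdeal.topologicalSpaceModule A U
  let _ : TopologicalSpace U' := WithIdeal.topologicalSpaceModule A U'
  have _ : IsTopologicalAddGroup U := inferInstance
  have _ : IsTopologicalAddGroup U' := inferInstance
  let b := (maximalIdeal A).ringFilterBasis.moduleFilterBasis ((maximalIdeal A).adic_module_basis U)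
  let b' :=
    (maximalIdeal A).ringFilterBasis.moduleFilterBasis ((maximalIdeal A).adic_module_basis U')
  refine continuous_of_continuousAt_zero φ.toAddMonoidHom ?_
  rw [ContinuousAt, map_zero]
  refine (b.toAddGroupFilterBasis.nhds_zero_hasBasis.tendsto_iff
    b'.toAddGroupFilterBasis.nhds_zero_hasBasis).2 ?_
  rintro _ ⟨m, rfl⟩
  refine ⟨_, ⟨m, rfl⟩, fun x hx => ?_⟩
  have h := Submodule.mem_map_of_mem (f := φ) hx
  rw [Submodule.map_smul''] at h
  exact Submodule.smul_mono le_rfl le_top h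

/-- The map `Ind_P^Γ ρ → Ind_P^Γ ρ'` induced by a `P`-equivariant map. -/
def contIndMap {P : Subgroup Γ} {U U' : Type*} [AddCommGroup U] [Module A U] [AddCommGroup U']
    [Module A U'] {ρ : Representation A P U} {ρ' : Representation A P U'} (φ : U →ₗ[A] U')
    (hφ : ∀ (q : P) (u : U), φ (ρ q u) = ρ' q (φ u)) : contInd ρ →ₗ[A] contInd ρ' :=
  LinearMap.restrict (LinearMap.compLeft φ Γ) fun f hf =>
    ⟨@Continuous.comp _ _ _ _ (adicTop A U) (adicTop A U') _ _ (continuous_adicTop φ) hf.1,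
      fun q g => by
        change φ (f (q * g)) = ρ' q (φ (f g))
        rw [hf.2, hφ]⟩

/-- The topology of pointwise convergence on the dual `X^∨ = Hom_A(X, A)`. -/
instance dualTopology {A : Type*} [CommRing A] [TopologicalSpace A] {X : Type*} [AddCommGroup X]
    [Module A X] : TopologicalSpace (Module.Dual A X) :=
  TopologicalSpace.induced (fun ℓ (x : X) => ℓ x) inferInstance

end Representations

section Duality

variable {A : Type*} [CommRing A] [TopologicalSpace A]

/-- `α` makes `M` into a topological `A[[H]]`-module, extending the action `τ` of `H`. -/
structure IsCompletedAction {H : Type*} [Group H] [TopologicalSpace H] {M : Type*} [AddCommGroup M]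
    [Module A M] [TopologicalSpace M] (τ : Representation A H M)
    (α : CompletedGroupAlgebra A H →ₐ[A] Module.End A M) : Prop where
  extends_rep : ∀ h : H, α (CompletedGroupAlgebra.of A (MonoidAlgebra.single h 1)) = τ h
  continuous : Continuous fun x : CompletedGroupAlgebra A H × M => α x.1 x.2

section GroupTensor

variable {Q H : Type*} [Group Q] [Group H] {M : Type*} [AddCommGroup M] [Module A M]

/-- `A[H] ⊗_{A[Q]} M`. -/
abbrev GroupTensor (φ : Q →* H) (τ : Representation A Q M) : Type _ :=
  BalancedTensor (A := A) (X := MonoidAlgebra A H) (Y := M) (R := MonoidAlgebra A Q)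
    (fun r => LinearMap.mulRight A (MonoidAlgebra.mapDomainAlgHom A A φ r))
    (fun r => τ.asAlgebraHom r)

/-- The image of `x ⊗ m` in `A[H] ⊗_{A[Q]} M`. -/
def GroupTensor.tmul (φ : Q →* H) (τ : Representation A Q M) (x : MonoidAlgebra A H) (m : M) :
    GroupTensor φ τ :=
  BalancedTensor.tmul _ _ x m

/-- The action of `H` on `A[H] ⊗_{A[Q]} M` by left multiplication. -/
def GroupTensor.act (φ : Q →* H) (τ : Representation A Q M) (h : H) :
    GroupTensor φ τ →ₗ[A] GroupTensor φ τ :=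
  BalancedTensor.map id (LinearMap.mulLeft A (MonoidAlgebra.single h 1)) LinearMap.id
    (fun _ x => (mul_assoc _ x _).symm) (fun _ _ => rfl)

end GroupTensor

variable [IsLocalRing A] {Γ : Type*} [Group Γ] [TopologicalSpace Γ] [IsTopologicalGroup Γ]
  {P : Subgroup Γ} (K : Subgroup Γ) {U : Type*} [AddCommGroup U] [Module A U]
  (ρ : Representation A P U)

/-- The action of `P ∩ K` on `U^∨`. -/
def dualResRep : Representation A ↥(P ⊓ K) (Module.Dual A U) :=
  ρ.dual.comp (Subgroup.inclusion inf_le_left)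

/-- The map `A[[P ∩ K]] → A[[K]]` induced by the inclusion. -/
def completedInclusion (A : Type*) [CommRing A] (P K : Subgroup Γ) :
    CompletedGroupAlgebra A ↥(P ⊓ K) →ₐ[A] CompletedGroupAlgebra A K :=
  CompletedGroupAlgebra.map A (Subgroup.inclusion (inf_le_right : P ⊓ K ≤ K))
    (continuous_inclusion (inf_le_right : P ⊓ K ≤ K))

/-- An isomorphism of topological `A[[K]]`-modules
`A[[K]] ⊗̂_{A[[P ∩ K]]} U^∨ ≃ (Ind_P^Γ ρ)^∨`, where the module structures over the completed group
algebras are continuous and extend the contragredient group actions. -/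
structure DualIndIso where
  /-- the action of `A[[P ∩ K]]` on `U^∨` -/
  α : CompletedGroupAlgebra A ↥(P ⊓ K) →ₐ[A] Module.End A (Module.Dual A U)
  isCompletedAction : IsCompletedAction (dualResRep K ρ) α
  /-- the action of `A[[K]]` on `(Ind_P^Γ ρ)^∨` -/
  β : CompletedGroupAlgebra A K →ₐ[A] Module.End A (Module.Dual A (contInd ρ))
  isCompletedAction_ind : IsCompletedAction ((contIndRep ρ).dual.comp K.subtype) β
  e : CompletedTensor (completedInclusion A P K) α ≃L[A] Module.Dual A (contInd ρ)
  e_act : ∀ (μ : CompletedGroupAlgebra A K) (x : CompletedTensor (completedInclusion A P K) α),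
    e (CompletedTensor.act _ _ μ x) = β μ (e x)

end Duality

namespace AlgGrp

/-- `P(F)` as a subgroup of `G(F)`. -/
abbrev pointsIn (F : Type*) [Field F] {Ω : Type*} [Field Ω] [Algebra F Ω] {n : ℕ}
    (G P : Subgroup (GL (Fin n) Ω)) : Subgroup (points F G) :=
  (points F P).subgroupOf (points F G)

/-- The inflation to `Pm(F)` of a representation of `L(F)`, along the projection
`Pm(F) → L(F)`. -/
def IsOppositePair.inflate {F : Type*} [Field F] {Ω : Type*} [Field Ω] [Algebra F Ω]
    [IsGalois F Ω] {n : ℕ} {G P Pm L : Subgroup (GL (Fin n) Ω)}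
    (h : IsOppositePair F G P Pm L) {A : Type*} [CommRing A] {U : Type*} [AddCommGroup U]
    [Module A U] (σ : Representation A (points F L) U) : Representation A (pointsIn F G Pm) U :=
  σ.comp (leviProjIn F G h.parabolic_opp.overBase h.levi_opp)

end AlgGrp

end

open Filter Topology

set_option linter.unusedSectionVars false

noncomputable section

section AdicBasics

variable {A : Type*} [CommRing A] [IsLocalRing A]

lemma nhds_adicTop_hasBasis (U : Type*) [AddCommGroup U] [Module A U] (x : U) :
    (@nhds U (adicTop A U) x).HasBasis (fun _ : ℕ => True)
      (fun n => {y | y - x ∈ (maximalIdeal A ^ n • ⊤ : Submodule A U)}) := by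
  let _ : WithIdeal A := ⟨maximalIdeal A⟩
  let _ : TopologicalSpace U := WithIdeal.topologicalSpaceModule A U
  have _ : IsTopologicalAddGroup U := inferInstance
  let b := (maximalIdeal A).ringFilterBasis.moduleFilterBasis ((maximalIdeal A).adic_module_basis U)
  have h0 := b.toAddGroupFilterBasis.nhds_hasBasis x
  refine ⟨fun s => ?_⟩
  rw [show (@nhds U (adicTop A U) x) = 𝓝 x from rfl]
  rw [h0.mem_iff]
  constructor
  · rintro ⟨_, ⟨n, rfl⟩, h⟩
    refine ⟨n, trivial, fun y hy => h ⟨y - x, hy, ?_⟩⟩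
    simp
  · rintro ⟨n, -, h⟩
    refine ⟨_, ⟨n, rfl⟩, ?_⟩
    rintro _ ⟨y, hy, rfl⟩
    refine h ?_
    simpa using hy

lemma continuous_adicTop_iff {X U : Type*} [TopologicalSpace X] [AddCommGroup U] [Module A U]
    {f : X → U} : @Continuous X U _ (adicTop A U) f ↔
      ∀ n x, ∀ᶠ y in 𝓝 x, f y - f x ∈ (maximalIdeal A ^ n • ⊤ : Submodule A U) := by
  let _ := adicTop A U
  rw [continuous_iff_continuousAt, forall_comm]
  refine forall_congr' fun x => ?_
  rw [ContinuousAt, (nhds_adicTop_hasBasis (A := A) U (f x)).tendsto_right_iff]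
  simp

lemma pow_smul_top_self (n : ℕ) : (maximalIdeal A ^ n • ⊤ : Submodule A A) = maximalIdeal A ^ n := by
  simp

lemma pow_smul_top_anti (U : Type*) [AddCommGroup U] [Module A U] {m n : ℕ} (h : m ≤ n) :
    (maximalIdeal A ^ n • ⊤ : Submodule A U) ≤ maximalIdeal A ^ m • ⊤ :=
  Submodule.smul_mono_left (Ideal.pow_le_pow_right h)

lemma LinearMap.map_mem_pow_smul {U U' : Type*} [AddCommGroup U] [Module A U] [AddCommGroup U']
    [Module A U'] (φ : U →ₗ[A] U') {n : ℕ} {u : U}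
    (hu : u ∈ (maximalIdeal A ^ n • ⊤ : Submodule A U)) :
    φ u ∈ (maximalIdeal A ^ n • ⊤ : Submodule A U') := by
  have h := Submodule.mem_map_of_mem (f := φ) hu
  rw [Submodule.map_smul''] at h
  exact Submodule.smul_mono le_rfl le_top h

lemma LinearMap.map_mem_pow {U : Type*} [AddCommGroup U] [Module A U]
    (φ : U →ₗ[A] A) {n : ℕ} {u : U} (hu : u ∈ (maximalIdeal A ^ n • ⊤ : Submodule A U)) :
    φ u ∈ maximalIdeal A ^ n := by
  simpa using φ.map_mem_pow_smul hu

lemma eq_of_forall_sub_mem (U : Type*) [AddCommGroup U] [Module A U]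
    [IsHausdorff (maximalIdeal A) U] {x y : U}
    (h : ∀ n : ℕ, x - y ∈ (maximalIdeal A ^ n • ⊤ : Submodule A U)) : x = y := by
  rw [IsHausdorff.eq_iff_smodEq (I := maximalIdeal A)]
  exact fun n => SModEq.sub_mem.2 (h n)

lemma eq_zero_of_forall_mem_pow [IsHausdorff (maximalIdeal A) A] {x : A}
    (h : ∀ n : ℕ, x ∈ maximalIdeal A ^ n) : x = 0 :=
  eq_of_forall_sub_mem (A := A) A fun n => by simpa using h n

lemma eq_of_forall_sub_mem_pow [IsHausdorff (maximalIdeal A) A] {x y : A}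
    (h : ∀ n : ℕ, x - y ∈ maximalIdeal A ^ n) : x = y :=
  sub_eq_zero.1 (eq_zero_of_forall_mem_pow h)

lemma exists_adic_limit (U : Type*) [AddCommGroup U] [Module A U]
    [IsPrecomplete (maximalIdeal A) U] (s : ℕ → U)
    (hs : ∀ n, s (n + 1) - s n ∈ (maximalIdeal A ^ n • ⊤ : Submodule A U)) :
    ∃ L, ∀ n, s n - L ∈ (maximalIdeal A ^ n • ⊤ : Submodule A U) := by
  have h : ∀ {m n : ℕ}, m ≤ n → s m ≡ s n [SMOD (maximalIdeal A ^ m • ⊤ : Submodule A U)] := by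
    intro m n hmn
    induction n, hmn using Nat.le_induction with
    | base => rfl
    | succ n hmn ih =>
      refine ih.trans ((SModEq.sub_mem.2 ?_).symm)
      exact pow_smul_top_anti U hmn (hs n)
  obtain ⟨L, hL⟩ := IsPrecomplete.prec ‹_› h
  exact ⟨L, fun n => SModEq.sub_mem.1 (hL n)⟩

variable [TopologicalSpace A] [hA : Fact (IsAdic (maximalIdeal A))]

instance isTopologicalRing_of_isAdic : IsTopologicalRing A := by
  have h : ‹TopologicalSpace A› = (maximalIdeal A).adicTopology := hA.out
  subst h
  exact ((maximalIdeal A).adic_basis.toRing_subgroups_basis.toRingFilterBasis).isTopologicalRing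

lemma nhds_hasBasis_adic (x : A) : (𝓝 x).HasBasis (fun _ : ℕ => True)
    (fun n => {y | y - x ∈ maximalIdeal A ^ n}) := by
  have := nhds_adicTop_hasBasis (A := A) A x
  have h : adicTop A A = ‹TopologicalSpace A› := hA.out.symm
  rw [h] at this
  simpa using this

lemma continuous_iff_adic {X : Type*} [TopologicalSpace X] {f : X → A} : Continuous f ↔
      ∀ n x, ∀ᶠ y in 𝓝 x, f y - f x ∈ maximalIdeal A ^ n := by
  rw [continuous_iff_continuousAt, forall_comm]
  refine forall_congr' fun x => ?_
  rw [ContinuousAt, (nhds_hasBasis_adic (f x)).tendsto_right_iff]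
  simp

lemma isOpen_pow_maximalIdeal (n : ℕ) : IsOpen ((maximalIdeal A ^ n : Ideal A) : Set A) := by
  rw [isOpen_iff_mem_nhds]
  intro x hx
  refine (nhds_hasBasis_adic x).mem_iff.2 ⟨n, trivial, fun y hy => ?_⟩
  simpa using (maximalIdeal A ^ n).add_mem hy hx

instance t2Space_of_isAdic [IsHausdorff (maximalIdeal A) A] : T2Space A := by
  refine IsTopologicalAddGroup.t2Space_of_zero_sep fun x hx => ?_
  obtain ⟨n, hn⟩ : ∃ n : ℕ, x ∉ maximalIdeal A ^ n := by
    by_contra! h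
    exact hx (eq_zero_of_forall_mem_pow h)
  exact ⟨_, (isOpen_pow_maximalIdeal n).mem_nhds (zero_mem _), hn⟩

instance compactSpace_of_isAdic [IsNoetherianRing A] [IsAdicComplete (maximalIdeal A) A]
    [Finite (ResidueField A)] : CompactSpace A := by
  refine ⟨isCompact_iff_ultrafilter_le_nhds.2 fun F _ => ?_⟩
  have h : ∀ n : ℕ, ∃ a : A, ∀ᶠ x in (F : Filter A), x - a ∈ maximalIdeal A ^ n := fun n => by
    have : Finite (A ⧸ maximalIdeal A) := ‹Finite (ResidueField A)›
    have : Finite (A ⧸ maximalIdeal A ^ n) :=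
      Ideal.finite_quotient_pow (IsNoetherian.noetherian _) n
    obtain ⟨b, hb⟩ := Ultrafilter.eq_pure_of_finite (F.map (Ideal.Quotient.mk (maximalIdeal A ^ n)))
    obtain ⟨a, rfl⟩ := Ideal.Quotient.mk_surjective b
    refine ⟨a, ?_⟩
    have h1 : {Ideal.Quotient.mk (maximalIdeal A ^ n) a} ∈
        F.map (Ideal.Quotient.mk (maximalIdeal A ^ n)) := by
      rw [hb]; exact rfl
    filter_upwards [Ultrafilter.mem_map.1 h1] with x hx
    exact Ideal.Quotient.eq.1 hx
  choose a ha using h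
  obtain ⟨L, hL⟩ := exists_adic_limit A a fun n => by
    obtain ⟨x, h1, h2⟩ := ((ha n).and (ha (n + 1))).exists
    rw [pow_smul_top_self]
    have := Ideal.sub_mem _ h1 (Ideal.pow_le_pow_right n.le_succ h2)
    simpa using this
  refine ⟨L, trivial, (nhds_hasBasis_adic L).ge_iff.2 fun n _ => ?_⟩
  filter_upwards [ha n] with x hx
  have := Ideal.add_mem _ hx (by simpa using hL n)
  simpa using this

end AdicBasics

section AdicSection

variable {A : Type*} [CommRing A] [IsLocalRing A] {U : Type*} [AddCommGroup U] [Module A U]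

lemma exists_sum_smul_of_mem {n r : ℕ} {a : Fin r → A}
    (ha : Submodule.span A (Set.range a) = maximalIdeal A ^ n) (k : ℕ) {d : U}
    (hd : d ∈ (maximalIdeal A ^ (n + k) • ⊤ : Submodule A U)) :
    ∃ y : Fin r → U, (∀ i, y i ∈ (maximalIdeal A ^ k • ⊤ : Submodule A U)) ∧
      ∑ i, a i • y i = d := by
  let T : (Fin r → U) →ₗ[A] U := ∑ i, a i • LinearMap.proj i
  have hT : ∀ y, T y = ∑ i, a i • y i := fun y => by simp [T]
  have h : (maximalIdeal A ^ (n + k) • ⊤ : Submodule A U) ≤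
      (Submodule.pi Set.univ fun _ => (maximalIdeal A ^ k • ⊤ : Submodule A U)).map T := by
    rw [pow_add, mul_smul, Submodule.smul_le]
    intro b hb x hx
    rw [← ha, Submodule.mem_span_range_iff_exists_fun] at hb
    obtain ⟨w, rfl⟩ := hb
    refine ⟨fun i => w i • x, fun i _ => Submodule.smul_mem _ _ hx, ?_⟩
    rw [hT, Finset.sum_smul]
    exact Finset.sum_congr rfl fun i _ => by rw [smul_smul, smul_eq_mul, mul_comm]
  obtain ⟨y, hy, rfl⟩ := h hd
  exact ⟨y, fun i => hy i trivial, (hT y).symm⟩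

/-- A set-theoretic choice of representatives modulo `𝔪_A^n U`. -/
def adicRep (A : Type*) [CommRing A] [IsLocalRing A] {U : Type*} [AddCommGroup U] [Module A U]
    (n : ℕ) (v : U) : U :=
  Quotient.out (Submodule.Quotient.mk (p := (maximalIdeal A ^ n • ⊤ : Submodule A U)) v)

lemma adicRep_sub_mem (n : ℕ) (v : U) :
    adicRep A n v - v ∈ (maximalIdeal A ^ n • ⊤ : Submodule A U) :=
  (Submodule.Quotient.eq _).1 (Quotient.out_eq _)

lemma adicRep_congr {n : ℕ} {v w : U} (h : v - w ∈ (maximalIdeal A ^ n • ⊤ : Submodule A U)) :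
    adicRep A n v = adicRep A n w := by
  rw [adicRep, (Submodule.Quotient.eq _).2 h, adicRep]

/-- Elements of `𝔪_A^n U` can be written in terms of generators of `𝔪_A^n` with coefficients
which depend continuously on the element. -/
lemma exists_continuous_coefficients [IsNoetherianRing A] [IsAdicComplete (maximalIdeal A) U]
    (n : ℕ) : ∃ (r : ℕ) (a : Fin r → A) (Y : Fin r → U → U), (∀ i, a i ∈ maximalIdeal A ^ n) ∧
      (∀ v ∈ (maximalIdeal A ^ n • ⊤ : Submodule A U), ∑ i, a i • Y i v = v) ∧
      ∀ i k v w, v - w ∈ (maximalIdeal A ^ (n + k) • ⊤ : Submodule A U) →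
        Y i v - Y i w ∈ (maximalIdeal A ^ k • ⊤ : Submodule A U) := by
  obtain ⟨r, a, ha⟩ := Submodule.fg_iff_exists_fin_generating_family.1
    (IsNoetherian.noetherian (maximalIdeal A ^ n))
  have hc : ∀ (k : ℕ) (d : U), ∃ y : Fin r → U,
      (∀ i, y i ∈ (maximalIdeal A ^ k • ⊤ : Submodule A U)) ∧
      (d ∈ (maximalIdeal A ^ (n + k) • ⊤ : Submodule A U) → ∑ i, a i • y i = d) := fun k d => by
    by_cases hd : d ∈ (maximalIdeal A ^ (n + k) • ⊤ : Submodule A U)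
    · obtain ⟨y, hy, h⟩ := exists_sum_smul_of_mem ha k hd
      exact ⟨y, hy, fun _ => h⟩
    · exact ⟨0, fun i => zero_mem _, fun h => absurd h hd⟩
  choose c hc hc' using hc
  let z : ℕ → U → Fin r → U := fun k v => c 0 (adicRep A n v) +
    ∑ j ∈ Finset.range k, c j (adicRep A (n + j + 1) v - adicRep A (n + j) v)
  have hz : ∀ k v i, z (k + 1) v i - z k v i ∈ (maximalIdeal A ^ k • ⊤ : Submodule A U) := by
    intro k v i
    simp only [z, Finset.sum_range_succ, Pi.add_apply]
    convert hc k (adicRep A (n + k + 1) v - adicRep A (n + k) v) i using 1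
    abel
  have hTz : ∀ k, ∀ v ∈ (maximalIdeal A ^ n • ⊤ : Submodule A U),
      ∑ i, a i • z k v i = adicRep A (n + k) v := by
    intro k v hv
    induction k with
    | zero =>
      simp only [z, Finset.range_zero, Finset.sum_empty, add_zero]
      exact hc' 0 _ (by simpa using add_mem (adicRep_sub_mem (A := A) n v) hv)
    | succ k ih =>
      have h1 : ∀ i, z (k + 1) v i =
          z k v i + c k (adicRep A (n + k + 1) v - adicRep A (n + k) v) i := fun i => by
        simp only [z, Finset.sum_range_succ, Pi.add_apply]
        abel
      simp only [h1, smul_add, Finset.sum_add_distrib, ih]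
      rw [hc' k]
      · rw [← add_assoc]; abel
      · have h2 := pow_smul_top_anti (A := A) U (Nat.le_succ (n + k))
          (adicRep_sub_mem (n + k + 1) v)
        simpa using sub_mem h2 (adicRep_sub_mem (n + k) v)
  have hzc : ∀ k v w, v - w ∈ (maximalIdeal A ^ (n + k) • ⊤ : Submodule A U) →
      z k v = z k w := by
    intro k v w h
    simp only [z]
    rw [adicRep_congr (pow_smul_top_anti U (Nat.le_add_right n k) h)]
    congr 1
    refine Finset.sum_congr rfl fun j hj => ?_
    have hj := Finset.mem_range.1 hj
    rw [adicRep_congr (pow_smul_top_anti U (by omega : n + j + 1 ≤ n + k) h),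
      adicRep_congr (pow_smul_top_anti U (by omega : n + j ≤ n + k) h)]
  have hY : ∀ i v, ∃ L, ∀ k, z k v i - L ∈ (maximalIdeal A ^ k • ⊤ : Submodule A U) :=
    fun i v => exists_adic_limit U (fun k => z k v i) fun k => hz k v i
  choose Y hY using hY
  refine ⟨r, a, Y, fun i => ha ▸ Submodule.subset_span ⟨i, rfl⟩, fun v hv => ?_,
    fun i k v w h => ?_⟩
  · refine eq_of_forall_sub_mem (A := A) U fun k => ?_
    have h1 : ∑ i, a i • (z k v i - Y i v) ∈ (maximalIdeal A ^ k • ⊤ : Submodule A U) :=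
      sum_mem fun i _ => Submodule.smul_mem _ _ (hY i v k)
    simp only [smul_sub, Finset.sum_sub_distrib, hTz k v hv] at h1
    have h2 := pow_smul_top_anti U (Nat.le_add_left k n) (adicRep_sub_mem (A := A) (n + k) v)
    simpa using sub_mem h2 h1
  · have h1 := hY i v k
    rw [hzc k v w h] at h1
    simpa using sub_mem (hY i w k) h1

end AdicSection

/-! ### Completed group algebras of profinite groups -/

namespace CompletedGroupAlgebra

variable {A : Type*} [CommRing A] {H : Type*} [Group H] [TopologicalSpace H]

@[ext] lemma ext' {μ ν : CompletedGroupAlgebra A H} (h : ∀ N, μ.1 N = ν.1 N) : μ = ν :=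
  Subtype.ext (funext h)

lemma of_val (x : MonoidAlgebra A H) (N : OpenNormalSubgroup H) :
    (of A x).1 N = MonoidAlgebra.mapDomainAlgHom A A (QuotientGroup.mk' N.toSubgroup) x := rfl

lemma transition_single {N N' : OpenNormalSubgroup H} (h : N.toSubgroup ≤ N'.toSubgroup) (x : H)
    (a : A) : groupAlgebraTransition A h (MonoidAlgebra.single (x : H ⧸ N.toSubgroup) a) =
      MonoidAlgebra.single (x : H ⧸ N'.toSubgroup) a := by
  simp [groupAlgebraTransition]
  rfl

lemma exists_of_val_eq (μ : CompletedGroupAlgebra A H) (N : OpenNormalSubgroup H) :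
    ∃ x : MonoidAlgebra A H, (of A x).1 N = μ.1 N := by
  generalize μ.1 N = y
  induction y using MonoidAlgebra.induction_linear with
  | zero => exact ⟨0, by rw [map_zero]; rfl⟩
  | add y z hy hz =>
    obtain ⟨a, rfl⟩ := hy
    obtain ⟨b, rfl⟩ := hz
    exact ⟨a + b, by rw [map_add]; rfl⟩
  | single c a =>
    obtain ⟨h, rfl⟩ := QuotientGroup.mk_surjective c
    exact ⟨MonoidAlgebra.single h a, by simp [of_val]⟩

/-- The projection `A[[H]] → A[H/N]`. -/
def eval (N : OpenNormalSubgroup H) :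
    CompletedGroupAlgebra A H →ₐ[A] MonoidAlgebra A (H ⧸ N.toSubgroup) :=
  (Pi.evalAlgHom A (fun N : OpenNormalSubgroup H => MonoidAlgebra A (H ⧸ N.toSubgroup)) N).comp
    (completedGroupSubalgebra A H).val

lemma val_sub (μ ν : CompletedGroupAlgebra A H) (N : OpenNormalSubgroup H) :
    (μ - ν).1 N = μ.1 N - ν.1 N := rfl

end CompletedGroupAlgebra

/-- The elements of a group algebra with coefficients in an ideal. -/
def MonoidAlgebra.coeffIdeal {A : Type*} [CommRing A] (C : Type*) [Group C] (I : Ideal A) :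
    Submodule A (MonoidAlgebra A C) where
  carrier := {x | ∀ c, x.coeff c ∈ I}
  add_mem' hx hy c := I.add_mem (hx c) (hy c)
  zero_mem' _ := I.zero_mem
  smul_mem' a _ hx c := I.mul_mem_left a (hx c)

namespace MonoidAlgebra

variable {A : Type*} [CommRing A] {C : Type*} [Group C] {I : Ideal A}

lemma mul_mem_coeffIdeal (x : MonoidAlgebra A C) {y : MonoidAlgebra A C}
    (hy : y ∈ coeffIdeal C I) : x * y ∈ coeffIdeal C I := by
  classical
  intro c
  rw [coeff_mul]
  refine sum_mem fun a _ => sum_mem fun b _ => ?_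
  dsimp only
  split_ifs
  exacts [I.mul_mem_left _ (hy b), I.zero_mem]

lemma mul_mem_coeffIdeal' {x : MonoidAlgebra A C} (y : MonoidAlgebra A C)
    (hx : x ∈ coeffIdeal C I) : x * y ∈ coeffIdeal C I := by
  classical
  intro c
  rw [coeff_mul]
  refine sum_mem fun a _ => sum_mem fun b _ => ?_
  dsimp only
  split_ifs
  exacts [I.mul_mem_right _ (hx a), I.zero_mem]

lemma map_mem_of_mem_coeffIdeal (φ : MonoidAlgebra A C →ₗ[A] A) {x : MonoidAlgebra A C}
    (hx : x ∈ coeffIdeal C I) : φ x ∈ I := by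
  rw [← sum_coeff_single x, Finsupp.sum, map_sum]
  refine sum_mem fun c _ => ?_
  rw [← mul_one (x.coeff c), ← smul_eq_mul, ← smul_single, map_smul]
  exact I.mul_mem_right _ (hx c)

end MonoidAlgebra

namespace CompletedGroupAlgebra

variable {A : Type*} [CommRing A] [IsLocalRing A]  {H : Type*} [Group H] [TopologicalSpace H]

/-- The two-sided ideal of all elements of `A[[H]]` which vanish in `A / 𝔪_A^n [H/N]`. -/
def levelIdeal (A : Type*) [CommRing A] [IsLocalRing A] {H : Type*} [Group H] [TopologicalSpace H]
    (N : OpenNormalSubgroup H) (n : ℕ) : Submodule A (CompletedGroupAlgebra A H) :=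
  (MonoidAlgebra.coeffIdeal (H ⧸ N.toSubgroup) (maximalIdeal A ^ n)).comap (eval N).toLinearMap

lemma mem_levelIdeal {N : OpenNormalSubgroup H} {n : ℕ} {μ : CompletedGroupAlgebra A H} :
    μ ∈ levelIdeal A N n ↔ μ.1 N ∈ MonoidAlgebra.coeffIdeal _ (maximalIdeal A ^ n) := Iff.rfl

lemma mul_mem_levelIdeal {N : OpenNormalSubgroup H} {n : ℕ} (μ : CompletedGroupAlgebra A H)
    {ν : CompletedGroupAlgebra A H} (hν : ν ∈ levelIdeal A N n) : μ * ν ∈ levelIdeal A N n :=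
  MonoidAlgebra.mul_mem_coeffIdeal _ hν

lemma mul_mem_levelIdeal' {N : OpenNormalSubgroup H} {n : ℕ} {μ : CompletedGroupAlgebra A H}
    (ν : CompletedGroupAlgebra A H) (hμ : μ ∈ levelIdeal A N n) : μ * ν ∈ levelIdeal A N n :=
  MonoidAlgebra.mul_mem_coeffIdeal' _ hμ

lemma levelIdeal_mono {N N' : OpenNormalSubgroup H} (hN : N.toSubgroup ≤ N'.toSubgroup) {n n' : ℕ}
    (hn : n' ≤ n) : levelIdeal A N n ≤ levelIdeal A N' n' := by
  intro μ hμ c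
  change (μ.1 N').coeff c ∈ _
  rw [← μ.2 N N' hN]
  refine Ideal.pow_le_pow_right hn ?_
  exact MonoidAlgebra.map_mem_of_mem_coeffIdeal ((Finsupp.lapply c) ∘ₗ
    (MonoidAlgebra.coeffLinearEquiv A).toLinearMap ∘ₗ (groupAlgebraTransition A hN).toLinearMap) hμ

lemma exists_of_sub_mem_levelIdeal (μ : CompletedGroupAlgebra A H) (N : OpenNormalSubgroup H)
    (n : ℕ) : ∃ x : MonoidAlgebra A H, of A x - μ ∈ levelIdeal A N n := by
  obtain ⟨x, hx⟩ := exists_of_val_eq μ N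
  refine ⟨x, ?_⟩
  rw [mem_levelIdeal, val_sub, hx, sub_self]
  exact zero_mem _

lemma of_single_sub_mem_levelIdeal (N : OpenNormalSubgroup H) (n : ℕ) {h u : H} (hu : u ∈ N) :
    of A (MonoidAlgebra.single (h * u) (1 : A)) - of A (MonoidAlgebra.single h 1) ∈
      levelIdeal A N n := by
  rw [mem_levelIdeal, val_sub, of_val, of_val]
  have : ((h * u : H) : H ⧸ N.toSubgroup) = h := by
    rw [QuotientGroup.eq]
    rw [mul_inv_rev, inv_mul_cancel_right]
    exact N.toSubgroup.inv_mem hu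
  simp [this, sub_self]

variable [TopologicalSpace A] [hA : Fact (IsAdic (maximalIdeal A))] [IsTopologicalGroup H]
  [CompactSpace H]

instance : IsTopologicalAddGroup (CompletedGroupAlgebra A H) :=
  topologicalAddGroup_induced (H := CompletedGroupAlgebra A H)
    (G := ∀ (N : OpenNormalSubgroup H), (H ⧸ N.toSubgroup) → A)
    (AddMonoidHom.mk' (fun (x : CompletedGroupAlgebra A H) (N : OpenNormalSubgroup H)
      (c : H ⧸ N.toSubgroup) => (x.1 N).coeff c) fun _ _ => rfl)

lemma continuous_coeff (N : OpenNormalSubgroup H) (c : H ⧸ N.toSubgroup) :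
    Continuous fun x : CompletedGroupAlgebra A H => (x.1 N).coeff c :=
  (continuous_apply (A := fun _ : H ⧸ N.toSubgroup => A) c).comp
    ((continuous_apply (A := fun N : OpenNormalSubgroup H => H ⧸ N.toSubgroup → A) N).comp
      (continuous_induced_dom (f := fun (x : CompletedGroupAlgebra A H)
        (N : OpenNormalSubgroup H) (c : H ⧸ N.toSubgroup) => (x.1 N).coeff c)))

lemma isOpen_levelIdeal (N : OpenNormalSubgroup H) (n : ℕ) :
    IsOpen (levelIdeal A N n : Set (CompletedGroupAlgebra A H)) := by
  have : Finite (H ⧸ N.toSubgroup) := N.toOpenSubgroup.toSubgroup.quotient_finite_of_isOpen N.isOpen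
  have : (levelIdeal A N n : Set (CompletedGroupAlgebra A H)) =
      ⋂ c, {x | (x.1 N).coeff c ∈ maximalIdeal A ^ n} := by
    ext x
    simp only [Set.mem_iInter]
    rfl
  rw [this]
  exact isOpen_iInter_of_finite fun c => (isOpen_pow_maximalIdeal n).preimage (continuous_coeff N c)

lemma exists_levelIdeal_subset {s : Set (CompletedGroupAlgebra A H)} (hs : s ∈ 𝓝 0) :
    ∃ (N : OpenNormalSubgroup H) (n : ℕ), (levelIdeal A N n : Set (CompletedGroupAlgebra A H)) ⊆ s := by
  let B : Filter (CompletedGroupAlgebra A H) :=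
    ⨅ i : OpenNormalSubgroup H × ℕ, 𝓟 (levelIdeal A i.1 i.2)
  have hB : B ≤ 𝓝 0 := by
    have h : Topology.IsInducing (fun (x : CompletedGroupAlgebra A H) (N : OpenNormalSubgroup H)
        (c : H ⧸ N.toSubgroup) => (x.1 N).coeff c) := ⟨rfl⟩
    refine h.tendsto_nhds_iff.2 (tendsto_pi_nhds.2 fun N => tendsto_pi_nhds.2 fun c => ?_)
    refine (nhds_hasBasis_adic _).tendsto_right_iff.2 fun n _ => ?_
    refine mem_of_superset (mem_iInf_of_mem (N, n) (mem_principal_self _)) fun μ hμ => ?_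
    exact mem_levelIdeal.1 (sub_mem hμ (zero_mem _)) c
  have : Nonempty (OpenNormalSubgroup H × ℕ) := ⟨(⟨⊤, inferInstanceAs (⊤ : Subgroup H).Normal⟩, 0)⟩
  have hd : Directed (· ≥ ·) fun i : OpenNormalSubgroup H × ℕ =>
      𝓟 (levelIdeal A i.1 i.2 : Set (CompletedGroupAlgebra A H)) := fun i j =>
    ⟨(i.1 ⊓ j.1, max i.2 j.2),
      principal_mono.2 (levelIdeal_mono (inf_le_left : i.1 ⊓ j.1 ≤ i.1) (le_max_left _ _)),
      principal_mono.2 (levelIdeal_mono (inf_le_right : i.1 ⊓ j.1 ≤ j.1) (le_max_right _ _))⟩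
  obtain ⟨i, hi⟩ := (mem_iInf_of_directed hd s).1 (hB hs)
  exact ⟨i.1, i.2, hi⟩

lemma nhds_hasBasis (μ : CompletedGroupAlgebra A H) : (𝓝 μ).HasBasis
    (fun _ : OpenNormalSubgroup H × ℕ => True) (fun i => {ν | ν - μ ∈ levelIdeal A i.1 i.2}) := by
  refine ⟨fun s => ⟨fun hs => ?_, ?_⟩⟩
  · have h : (fun x => x + μ) ⁻¹' s ∈ 𝓝 (0 : CompletedGroupAlgebra A H) :=
      (continuous_add_const μ).continuousAt.preimage_mem_nhds (by simpa using hs)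
    obtain ⟨N, n, h⟩ := exists_levelIdeal_subset h
    exact ⟨(N, n), trivial, fun ν hν => by simpa using h hν⟩
  · rintro ⟨⟨N, n⟩, -, h⟩
    refine mem_of_superset (((isOpen_levelIdeal N n).preimage
      (continuous_sub_right μ)).mem_nhds ?_) h
    simp

lemma denseRange_of : DenseRange (of A : MonoidAlgebra A H → CompletedGroupAlgebra A H) := by
  intro μ
  rw [mem_closure_iff_nhds_basis (nhds_hasBasis μ)]
  rintro ⟨N, n⟩ -
  obtain ⟨x, hx⟩ := exists_of_sub_mem_levelIdeal μ N n
  exact ⟨_, ⟨x, rfl⟩, hx⟩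

lemma continuous_mul_left' (μ : CompletedGroupAlgebra A H) : Continuous fun ν => μ * ν := by
  refine continuous_iff_continuousAt.2 fun ν =>
    ((nhds_hasBasis ν).tendsto_iff (nhds_hasBasis _)).2 ?_
  rintro i -
  refine ⟨i, trivial, fun x hx => ?_⟩
  rw [Set.mem_ofPred_eq, ← mul_sub]
  exact mul_mem_levelIdeal μ hx

lemma continuous_mul_right' (μ : CompletedGroupAlgebra A H) : Continuous fun ν => ν * μ := by
  refine continuous_iff_continuousAt.2 fun ν =>
    ((nhds_hasBasis ν).tendsto_iff (nhds_hasBasis _)).2 ?_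
  rintro i -
  refine ⟨i, trivial, fun x hx => ?_⟩
  rw [Set.mem_ofPred_eq, ← sub_mul]
  exact mul_mem_levelIdeal' μ hx

/-- Two continuous additive maps on `A[[H]]` which agree on `H` are equal. -/
lemma eq_of_continuous {W : Type*} [AddCommGroup W] [Module A W] [TopologicalSpace W] [T2Space W]
    {f g : CompletedGroupAlgebra A H →ₗ[A] W} (hf : Continuous f) (hg : Continuous g)
    (h : ∀ x : H, f (of A (MonoidAlgebra.single x 1)) = g (of A (MonoidAlgebra.single x 1))) :
    f = g := by
  refine LinearMap.ext fun μ => congrFun (denseRange_of.equalizer hf hg (funext fun x => ?_)) μ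
  change f (of A x) = g (of A x)
  induction x using MonoidAlgebra.induction_linear with
  | zero => simp
  | add x y hx hy => simp [hx, hy]
  | single x a =>
    have : MonoidAlgebra.single x a = a • MonoidAlgebra.single x (1 : A) := by simp
    rw [this]
    simp only [map_smul, h]

instance [IsNoetherianRing A] [IsAdicComplete (maximalIdeal A) A] [Finite (ResidueField A)] :
    CompactSpace (CompletedGroupAlgebra A H) := by
  have hfin : ∀ N : OpenNormalSubgroup H, Finite (H ⧸ N.toSubgroup) := fun N =>
    N.toOpenSubgroup.toSubgroup.quotient_finite_of_isOpen N.isOpen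
  let ι := fun (x : CompletedGroupAlgebra A H) (N : OpenNormalSubgroup H)
    (c : H ⧸ N.toSubgroup) => (x.1 N).coeff c
  have hι : Topology.IsInducing ι := ⟨rfl⟩
  let s : ∀ N : OpenNormalSubgroup H, (H ⧸ N.toSubgroup → A) →ₗ[A]
      MonoidAlgebra A (H ⧸ N.toSubgroup) := fun N =>
    (MonoidAlgebra.coeffLinearEquiv A).symm.toLinearMap ∘ₗ
      (Finsupp.linearEquivFunOnFinite A A (H ⧸ N.toSubgroup)).symm.toLinearMap
  have hs : ∀ N y c, (s N y).coeff c = y c := fun N y c => rfl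
  have hrange : Set.range ι = ⋂ (N : OpenNormalSubgroup H) (N' : OpenNormalSubgroup H)
      (h : N.toSubgroup ≤ N'.toSubgroup) (c : H ⧸ N'.toSubgroup),
      {y | (groupAlgebraTransition A h (s N (y N))).coeff c = y N' c} := by
    ext y
    simp only [Set.mem_iInter, Set.mem_range, Set.mem_ofPred_eq]
    constructor
    · rintro ⟨x, rfl⟩ N N' h c
      have : s N (ι x N) = x.1 N := by ext c; rfl
      rw [this, x.2 N N' h]
    · intro hy
      refine ⟨⟨fun N => s N (y N), fun N N' h => ?_⟩, ?_⟩
      · ext c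
        exact hy N N' h c
      · funext N c
        rfl
  rw [← isCompact_univ_iff, hι.isCompact_iff, Set.image_univ, hrange]
  refine IsClosed.isCompact ?_
  refine isClosed_iInter fun N => isClosed_iInter fun N' => isClosed_iInter fun h =>
    isClosed_iInter fun c => isClosed_eq ?_ ?_
  · have h1 : Continuous fun z : H ⧸ N.toSubgroup → A =>
        (groupAlgebraTransition A h (s N z)).coeff c :=
      LinearMap.continuous_on_pi (Finsupp.lapply c ∘ₗ
        (MonoidAlgebra.coeffLinearEquiv A).toLinearMap ∘ₗ
        (groupAlgebraTransition A h).toLinearMap ∘ₗ s N)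
    exact h1.comp (continuous_apply N)
  · exact (continuous_apply c).comp (continuous_apply N')

end CompletedGroupAlgebra

/-! ### Integration of continuous functions against elements of `A[[H]]` -/

lemma exists_openNormalSubgroup_subset {H : Type*} [Group H] [TopologicalSpace H]
    [IsTopologicalGroup H] [CompactSpace H] [TotallyDisconnectedSpace H] {s : Set H}
    (hs : s ∈ 𝓝 1) : ∃ N : OpenNormalSubgroup H, ∀ u ∈ N, u ∈ s := by
  obtain ⟨t, hts, ht, h1⟩ := mem_nhds_iff.1 hs
  obtain ⟨N, hN⟩ := ProfiniteGrp.exist_openNormalSubgroup_sub_open_nhds_of_one ht h1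
  exact ⟨N, fun u hu => hts (hN hu)⟩

/-- A function on a profinite group which is locally constant modulo `S` is invariant modulo `S`
under right translation by some open normal subgroup. -/
lemma exists_openNormalSubgroup_invariant {A : Type*} [CommRing A] {H : Type*} [Group H]
    [TopologicalSpace H] [IsTopologicalGroup H] [CompactSpace H] [TotallyDisconnectedSpace H]
    {U : Type*} [AddCommGroup U] [Module A U] (S : Submodule A U) (f : H → U)
    (hf : ∀ x, ∀ᶠ y in 𝓝 x, f y - f x ∈ S) :
    ∃ N : OpenNormalSubgroup H, ∀ h, ∀ u ∈ N, f (h * u) - f h ∈ S := by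
  have h1 : ∀ x, ∃ N : OpenNormalSubgroup H, ∀ u ∈ N, f (x * u) - f x ∈ S := fun x => by
    refine exists_openNormalSubgroup_subset (s := {u | f (x * u) - f x ∈ S}) ?_
    have : Tendsto (fun u => x * u) (𝓝 1) (𝓝 x) := by
      simpa using (continuous_const_mul x).tendsto (1 : H)
    exact this.eventually (hf x)
  choose N hN using h1
  obtain ⟨t, ht⟩ := isCompact_univ.elim_finite_subcover
    (fun x : H => {y | x⁻¹ * y ∈ N x}) (fun x =>
      (N x).isOpen.preimage (continuous_const_mul x⁻¹)) fun x _ =>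
        Set.mem_iUnion.2 ⟨x, by simp [one_mem]⟩
  classical
  obtain ⟨M, hM⟩ : ∃ M : OpenNormalSubgroup H, ∀ x ∈ t, M ≤ N x := by
    clear ht
    induction t using Finset.induction_on with
    | empty => exact ⟨N 1, by simp⟩
    | insert x t _ ih =>
      obtain ⟨M, hM⟩ := ih
      refine ⟨M ⊓ N x, fun y hy => ?_⟩
      rcases Finset.mem_insert.1 hy with rfl | hy
      · exact inf_le_right
      · exact inf_le_left.trans (hM y hy)
  refine ⟨M, fun h u hu => ?_⟩
  obtain ⟨x, hx, hxh⟩ := Set.mem_iUnion₂.1 (ht (Set.mem_univ h))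
  have hxh : x⁻¹ * h ∈ N x := hxh
  have h2 := hN x _ hxh
  have h3 := hN x _ (mul_mem hxh (hM x hx hu))
  rw [mul_inv_cancel_left] at h2
  rw [← mul_assoc, mul_inv_cancel_left] at h3
  simpa using sub_mem h3 h2

namespace CompletedGroupAlgebra

variable {A : Type*} [CommRing A] {H : Type*} [Group H] [TopologicalSpace H]

/-- `∑_c x_c φ(ĉ)` for representatives `ĉ` of the cosets `c`. -/
def levelSum (N : OpenNormalSubgroup H) (φ : H → A) :
    MonoidAlgebra A (H ⧸ N.toSubgroup) →ₗ[A] A :=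
  Finsupp.linearCombination A (fun c : H ⧸ N.toSubgroup => φ (Quotient.out c)) ∘ₗ
    (MonoidAlgebra.coeffLinearEquiv A).toLinearMap

lemma levelSum_apply (N : OpenNormalSubgroup H) (φ : H → A)
    (x : MonoidAlgebra A (H ⧸ N.toSubgroup)) :
    levelSum N φ x = x.coeff.sum fun c a => a * φ (Quotient.out c) := by
  simp [levelSum, Finsupp.linearCombination_apply]

lemma levelSum_single (N : OpenNormalSubgroup H) (φ : H → A) (c : H ⧸ N.toSubgroup) (a : A) :
    levelSum N φ (MonoidAlgebra.single c a) = a * φ (Quotient.out c) := by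
  simp [levelSum]

lemma levelSum_mem {I : Ideal A} (N : OpenNormalSubgroup H) {φ : H → A} (hφ : ∀ h, φ h ∈ I)
    (x : MonoidAlgebra A (H ⧸ N.toSubgroup)) : levelSum N φ x ∈ I := by
  rw [levelSum_apply]
  exact sum_mem fun c _ => I.mul_mem_left _ (hφ _)

lemma levelSum_transition_sub_mem {I : Ideal A} {N N' : OpenNormalSubgroup H}
    (hN : N.toSubgroup ≤ N'.toSubgroup) {φ : H → A} (hφ : ∀ h, ∀ u ∈ N', φ (h * u) - φ h ∈ I)
    (x : MonoidAlgebra A (H ⧸ N.toSubgroup)) :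
    levelSum N' φ (groupAlgebraTransition A hN x) - levelSum N φ x ∈ I := by
  induction x using MonoidAlgebra.induction_linear with
  | zero => simp
  | add x y hx hy =>
    rw [map_add, map_add, map_add, add_sub_add_comm]
    exact add_mem hx hy
  | single c a =>
    obtain ⟨h, rfl⟩ := QuotientGroup.mk_surjective c
    rw [transition_single, levelSum_single, levelSum_single, ← mul_sub]
    refine I.mul_mem_left _ ?_
    obtain ⟨u, hu⟩ := QuotientGroup.mk_out_eq_mul N.toSubgroup h
    obtain ⟨u', hu'⟩ := QuotientGroup.mk_out_eq_mul N'.toSubgroup h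
    rw [hu, hu']
    simpa using sub_mem (hφ h u' u'.2) (hφ h u (hN u.2))

/-- Left multiplication on `A[[H]]`. -/
def mulLeftₗ (μ : CompletedGroupAlgebra A H) :
    CompletedGroupAlgebra A H →ₗ[A] CompletedGroupAlgebra A H where
  toFun ν := μ * ν
  map_add' := mul_add μ
  map_smul' a ν := mul_smul_comm a μ ν

lemma mulLeftₗ_apply (μ ν : CompletedGroupAlgebra A H) : mulLeftₗ μ ν = μ * ν := rfl

/-- Right multiplication on `A[[H]]`. -/
def mulRightₗ (μ : CompletedGroupAlgebra A H) :
    CompletedGroupAlgebra A H →ₗ[A] CompletedGroupAlgebra A H where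
  toFun ν := ν * μ
  map_add' ν ν' := add_mul ν ν' μ
  map_smul' a ν := smul_mul_assoc a ν μ

lemma mulRightₗ_apply (μ ν : CompletedGroupAlgebra A H) : mulRightₗ μ ν = ν * μ := rfl

variable [IsLocalRing A] [TopologicalSpace A] [hA : Fact (IsAdic (maximalIdeal A))]
  [IsAdicComplete (maximalIdeal A) A] [IsTopologicalGroup H]
  [CompactSpace H] [TotallyDisconnectedSpace H]

lemma exists_invariant (φ : C(H, A)) (n : ℕ) : ∃ N : OpenNormalSubgroup H,
    ∀ h, ∀ u ∈ N, φ (h * u) - φ h ∈ maximalIdeal A ^ n :=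
  exists_openNormalSubgroup_invariant (A := A) (maximalIdeal A ^ n) φ
    (continuous_iff_adic.1 φ.continuous n)

lemma levelSum_sub_levelSum_mem {n : ℕ} {N N' : OpenNormalSubgroup H} {φ : H → A}
    (hN : ∀ h, ∀ u ∈ N, φ (h * u) - φ h ∈ maximalIdeal A ^ n)
    (hN' : ∀ h, ∀ u ∈ N', φ (h * u) - φ h ∈ maximalIdeal A ^ n) (μ : CompletedGroupAlgebra A H) :
    levelSum N φ (μ.1 N) - levelSum N' φ (μ.1 N') ∈ maximalIdeal A ^ n := by
  have h1 := levelSum_transition_sub_mem (inf_le_left : N ⊓ N' ≤ N) hN (μ.1 (N ⊓ N'))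
  have h2 := levelSum_transition_sub_mem (inf_le_right : N ⊓ N' ≤ N') hN' (μ.1 (N ⊓ N'))
  rw [μ.2] at h1 h2
  simpa using sub_mem h1 h2

lemma integral_compat (φ : C(H, A)) {m n : ℕ} (hmn : m ≤ n) :
    Submodule.factorPow (maximalIdeal A) A hmn ∘ₗ (Submodule.mkQ (maximalIdeal A ^ n • ⊤) ∘ₗ
      levelSum (exists_invariant φ n).choose φ ∘ₗ
        (eval (exists_invariant φ n).choose).toLinearMap) =
      Submodule.mkQ (maximalIdeal A ^ m • ⊤) ∘ₗ levelSum (exists_invariant φ m).choose φ ∘ₗ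
        (eval (exists_invariant φ m).choose).toLinearMap := by
  ext μ
  refine (Submodule.Quotient.eq _).2 ?_
  rw [pow_smul_top_self]
  exact levelSum_sub_levelSum_mem (fun h u hu => Ideal.pow_le_pow_right hmn
    ((exists_invariant φ n).choose_spec h u hu)) ((exists_invariant φ m).choose_spec) μ

/-- The integral of a continuous function against an element of `A[[H]]`. -/
def integral (φ : C(H, A)) : CompletedGroupAlgebra A H →ₗ[A] A :=
  IsAdicComplete.lift (maximalIdeal A) (fun n => Submodule.mkQ _ ∘ₗ
    levelSum (exists_invariant φ n).choose φ ∘ₗ (eval (exists_invariant φ n).choose).toLinearMap)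
    (integral_compat φ)

lemma integral_sub_levelSum_mem (φ : C(H, A)) {n : ℕ} {N : OpenNormalSubgroup H}
    (hN : ∀ h, ∀ u ∈ N, φ (h * u) - φ h ∈ maximalIdeal A ^ n) (μ : CompletedGroupAlgebra A H) :
    integral φ μ - levelSum N φ (μ.1 N) ∈ maximalIdeal A ^ n := by
  have h1 : (Submodule.Quotient.mk (integral φ μ) : A ⧸ (maximalIdeal A ^ n • ⊤ : Submodule A A)) =
      Submodule.Quotient.mk (levelSum (exists_invariant φ n).choose φ
        (μ.1 (exists_invariant φ n).choose)) := by
    exact IsAdicComplete.mk_lift (I := maximalIdeal A) (integral_compat φ) n μ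
  rw [Submodule.Quotient.eq, pow_smul_top_self] at h1
  simpa using add_mem h1 (levelSum_sub_levelSum_mem (exists_invariant φ n).choose_spec hN μ)

lemma integral_of (φ : C(H, A)) (h : H) : integral φ (of A (MonoidAlgebra.single h 1)) = φ h := by
  refine eq_of_forall_sub_mem_pow fun n => ?_
  obtain ⟨N, hN⟩ := exists_invariant φ n
  have h1 := integral_sub_levelSum_mem φ hN (of A (MonoidAlgebra.single h 1))
  have h2 : (of A (MonoidAlgebra.single h 1)).1 N = MonoidAlgebra.single (h : H ⧸ N.toSubgroup) 1 := by
    rw [of_val]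
    simp
  rw [h2, levelSum_single, one_mul] at h1
  obtain ⟨u, hu⟩ := QuotientGroup.mk_out_eq_mul N.toSubgroup h
  rw [hu] at h1
  simpa using add_mem h1 (hN h u u.2)

lemma continuous_integral (φ : C(H, A)) : Continuous (integral φ) := by
  refine continuous_iff_adic.2 fun n μ => ?_
  obtain ⟨N, hN⟩ := exists_invariant φ n
  refine (nhds_hasBasis μ).mem_iff.2 ⟨(N, n), trivial, fun ν hν => ?_⟩
  rw [Set.mem_ofPred_eq, ← map_sub]
  have h1 := integral_sub_levelSum_mem φ hN (ν - μ)
  have h2 := MonoidAlgebra.map_mem_of_mem_coeffIdeal (levelSum N φ) (mem_levelIdeal.1 hν)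
  simpa using add_mem h1 h2

lemma integral_eq_of_continuous (φ : C(H, A)) {f : CompletedGroupAlgebra A H →ₗ[A] A}
    (hf : Continuous f) (h : ∀ x : H, f (of A (MonoidAlgebra.single x 1)) = φ x) :
    f = integral φ :=
  eq_of_continuous hf (continuous_integral φ) fun x => by rw [h, integral_of]

lemma integral_mem {φ : C(H, A)} {n : ℕ} (hφ : ∀ h, φ h ∈ maximalIdeal A ^ n)
    (μ : CompletedGroupAlgebra A H) : integral φ μ ∈ maximalIdeal A ^ n := by
  obtain ⟨N, hN⟩ := exists_invariant φ n
  simpa using add_mem (integral_sub_levelSum_mem φ hN μ) (levelSum_mem N hφ (μ.1 N))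

/-- Integration as a bilinear map. -/
def integralₗ : C(H, A) →ₗ[A] CompletedGroupAlgebra A H →ₗ[A] A where
  toFun := integral
  map_add' φ ψ := (integral_eq_of_continuous (φ + ψ) (f := integral φ + integral ψ)
    ((continuous_integral φ).add (continuous_integral ψ)) fun x => by simp [integral_of]).symm
  map_smul' a φ := (integral_eq_of_continuous (a • φ) (f := a • integral φ)
    ((continuous_integral φ).const_smul a) fun x => by simp [integral_of]).symm

end CompletedGroupAlgebra

/-! ### The action of `A[[H]]` on the dual of a representation of `H` -/

section DualAction

variable {A : Type*} [CommRing A] [IsLocalRing A] {H : Type*} [Group H] [TopologicalSpace H]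

/-- The representation `τ` is smooth modulo every power of `𝔪_A`. -/
def IsAdicallySmooth {X : Type*} [AddCommGroup X] [Module A X] (τ : Representation A H X) : Prop :=
  ∀ (n : ℕ) (x : X), ∃ N : OpenNormalSubgroup H, ∀ u ∈ N,
    τ u x - x ∈ (maximalIdeal A ^ n • ⊤ : Submodule A X)

variable [TopologicalSpace A] [hA : Fact (IsAdic (maximalIdeal A))]
  {X : Type*} [AddCommGroup X] [Module A X] {τ : Representation A H X}

lemma invariant_of_smooth {n : ℕ} {x : X} {N : OpenNormalSubgroup H}
    (hN : ∀ u ∈ N, τ u x - x ∈ (maximalIdeal A ^ n • ⊤ : Submodule A X)) (ℓ : Module.Dual A X)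
    (h : H) {u : H} (hu : u ∈ N) : ℓ (τ (h * u)⁻¹ x) - ℓ (τ h⁻¹ x) ∈ maximalIdeal A ^ n := by
  rw [← map_sub]
  refine LinearMap.map_mem_pow ℓ ?_
  have h1 : τ (h * u)⁻¹ x - τ h⁻¹ x = τ h⁻¹ (τ (h * u⁻¹ * h⁻¹) x - x) := by
    rw [map_sub, ← Module.End.mul_apply, ← map_mul]
    congr 3
    group
  rw [h1]
  exact LinearMap.map_mem_pow_smul (τ h⁻¹)
    (hN _ (N.isNormal'.conj_mem _ (N.toSubgroup.inv_mem hu) h))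

/-- The continuous function `h ↦ ℓ (h⁻¹ x)`, as a linear function of `x`. -/
def orbitFun [IsTopologicalGroup H] (hτ : IsAdicallySmooth τ) (ℓ : Module.Dual A X) :
    X →ₗ[A] C(H, A) where
  toFun x := ⟨fun h => ℓ (τ h⁻¹ x), continuous_iff_adic.2 fun n h => by
    obtain ⟨N, hN⟩ := hτ n x
    have h1 : {y | h⁻¹ * y ∈ N} ∈ 𝓝 h :=
      (N.isOpen.preimage (continuous_const_mul h⁻¹)).mem_nhds (by simp [one_mem])
    filter_upwards [h1] with y hy
    have := invariant_of_smooth hN ℓ h hy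
    rwa [mul_inv_cancel_left] at this⟩
  map_add' x y := by ext; simp
  map_smul' a x := by ext; simp

open CompletedGroupAlgebra

variable [IsAdicComplete (maximalIdeal A) A] [IsTopologicalGroup H]
  [CompactSpace H] [TotallyDisconnectedSpace H]

/-- The linear endomorphism of `X^∨` given by an element of `A[[H]]`. -/
def dualActFun (hτ : IsAdicallySmooth τ) (μ : CompletedGroupAlgebra A H) :
    Module.End A (Module.Dual A X) where
  toFun ℓ := integralₗ.flip μ ∘ₗ orbitFun hτ ℓ
  map_add' ℓ ℓ' := by
    ext x
    have : orbitFun hτ (ℓ + ℓ') x = orbitFun hτ ℓ x + orbitFun hτ ℓ' x := by ext; rfl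
    simp [this]
  map_smul' a ℓ := by
    ext x
    have : orbitFun hτ (a • ℓ) x = a • orbitFun hτ ℓ x := by ext; rfl
    simp [this]

lemma dualActFun_apply (hτ : IsAdicallySmooth τ) (μ : CompletedGroupAlgebra A H)
    (ℓ : Module.Dual A X) (x : X) :
    dualActFun hτ μ ℓ x = integral (orbitFun hτ ℓ x) μ := rfl

lemma dualActFun_of (hτ : IsAdicallySmooth τ) (h : H) :
    dualActFun hτ (of A (MonoidAlgebra.single h 1)) = τ.dual h := by
  ext ℓ x
  rw [dualActFun_apply, integral_of]
  rfl

lemma integral_of_mul (hτ : IsAdicallySmooth τ) (h : H) (ν : CompletedGroupAlgebra A H)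
    (ℓ : Module.Dual A X) (x : X) :
    integral (orbitFun hτ ℓ x) (of A (MonoidAlgebra.single h 1) * ν) =
      integral (orbitFun hτ ℓ (τ h⁻¹ x)) ν := by
  have h1 : integral (orbitFun hτ ℓ x) ∘ₗ
      mulLeftₗ (of A (MonoidAlgebra.single h 1)) =
        integral (orbitFun hτ ℓ (τ h⁻¹ x)) := by
    refine integral_eq_of_continuous _ (f := integral (orbitFun hτ ℓ x) ∘ₗ _)
      ((continuous_integral (orbitFun hτ ℓ x)).comp (continuous_mul_left' _)) fun h' => ?_
    rw [LinearMap.comp_apply, mulLeftₗ_apply, ← map_mul, MonoidAlgebra.single_mul_single,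
      one_mul, integral_of]
    change ℓ (τ (h * h')⁻¹ x) = ℓ (τ h'⁻¹ (τ h⁻¹ x))
    rw [mul_inv_rev, map_mul]
    rfl
  exact LinearMap.congr_fun h1 ν

lemma dualActFun_mul (hτ : IsAdicallySmooth τ) (μ ν : CompletedGroupAlgebra A H) :
    dualActFun hτ (μ * ν) = dualActFun hτ μ * dualActFun hτ ν := by
  ext ℓ x
  have h1 : integral (orbitFun hτ ℓ x) ∘ₗ mulRightₗ ν =
      integral (orbitFun hτ (dualActFun hτ ν ℓ) x) :=
    integral_eq_of_continuous _ (f := integral (orbitFun hτ ℓ x) ∘ₗ _)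
      ((continuous_integral (orbitFun hτ ℓ x)).comp (continuous_mul_right' ν)) fun h => by
      rw [LinearMap.comp_apply, mulRightₗ_apply, integral_of_mul]
      rfl
  exact LinearMap.congr_fun h1 μ

/-- The contragredient action of `A[[H]]` on `X^∨`. -/
def dualAct (hτ : IsAdicallySmooth τ) :
    CompletedGroupAlgebra A H →ₐ[A] Module.End A (Module.Dual A X) :=
  AlgHom.ofLinearMap
    { toFun := dualActFun hτ
      map_add' := fun μ ν => by
        ext ℓ x
        exact map_add (integral (orbitFun hτ ℓ x)) μ ν
      map_smul' := fun a μ => by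
        ext ℓ x
        exact map_smul (integral (orbitFun hτ ℓ x)) a μ }
    (by
      have : (1 : CompletedGroupAlgebra A H) = of A (MonoidAlgebra.single 1 1) := (map_one _).symm
      rw [this]
      exact (dualActFun_of hτ 1).trans (map_one _))
    (dualActFun_mul hτ)

lemma dualAct_of (hτ : IsAdicallySmooth τ) (h : H) :
    dualAct hτ (of A (MonoidAlgebra.single h 1)) = τ.dual h :=
  dualActFun_of hτ h

lemma dualAct_mem (hτ : IsAdicallySmooth τ) {n : ℕ} {ℓ : Module.Dual A X} {x : X}
    (h : ∀ h, ℓ (τ h x) ∈ maximalIdeal A ^ n) (μ : CompletedGroupAlgebra A H) :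
    dualAct hτ μ ℓ x ∈ maximalIdeal A ^ n :=
  integral_mem (fun g => h g⁻¹) μ

lemma continuous_dualAct_left (hτ : IsAdicallySmooth τ) (ℓ : Module.Dual A X) :
    Continuous fun μ => dualAct hτ μ ℓ :=
  continuous_induced_rng.2 (continuous_pi fun x => continuous_integral (orbitFun hτ ℓ x))

lemma continuous_dual_apply (x : X) : Continuous fun ℓ : Module.Dual A X => ℓ x :=
  (continuous_apply (A := fun _ : X => A) x).comp
    (continuous_induced_dom (f := fun (ℓ : Module.Dual A X) (x : X) => ℓ x))

lemma isCompletedAction_dualAct (hτ : IsAdicallySmooth τ) :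
    IsCompletedAction τ.dual (dualAct hτ) where
  extends_rep := dualAct_of hτ
  continuous := by
    refine continuous_induced_rng.2 (continuous_pi fun x => continuous_iff_adic.2 fun n p => ?_)
    obtain ⟨N, hN⟩ := hτ n x
    have hfin : Finite (H ⧸ N.toSubgroup) :=
      N.toOpenSubgroup.toSubgroup.quotient_finite_of_isOpen N.isOpen
    have := Fintype.ofFinite (H ⧸ N.toSubgroup)
    have h1 : Continuous fun q : CompletedGroupAlgebra A H × Module.Dual A X =>
        levelSum N (orbitFun hτ q.2 x) (q.1.1 N) := by
      have : (fun q : CompletedGroupAlgebra A H × Module.Dual A X =>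
          levelSum N (orbitFun hτ q.2 x) (q.1.1 N)) = fun q =>
            ∑ c, (q.1.1 N).coeff c * q.2 (τ (Quotient.out c)⁻¹ x) := by
        funext q
        rw [levelSum_apply, Finsupp.sum_fintype _ _ fun _ => zero_mul _]
        rfl
      rw [this]
      exact continuous_finsetSum _ fun c _ => ((continuous_coeff N c).comp continuous_fst).mul
        ((continuous_dual_apply _).comp continuous_snd)
    filter_upwards [continuous_iff_adic.1 h1 n p] with q hq
    have h2 := fun q : CompletedGroupAlgebra A H × Module.Dual A X =>
      integral_sub_levelSum_mem (orbitFun hτ q.2 x) (fun h u hu => invariant_of_smooth hN q.2 h hu)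
        q.1
    have := add_mem (sub_mem (h2 q) (h2 p)) hq
    change integral (orbitFun hτ q.2 x) q.1 - integral (orbitFun hτ p.2 x) p.1 ∈ _
    convert this using 1
    ring

instance [IsNoetherianRing A] [Finite (ResidueField A)] : CompactSpace (Module.Dual A X) := by
  have h : Topology.IsInducing fun (ℓ : Module.Dual A X) (x : X) => ℓ x := ⟨rfl⟩
  rw [← isCompact_univ_iff, h.isCompact_iff, Set.image_univ]
  exact (LinearMap.isClosed_range_coe X A (RingHom.id A)).isCompact

instance : T2Space (Module.Dual A X) :=
  T2Space.of_injective_continuous (f := fun (ℓ : Module.Dual A X) (x : X) => ℓ x)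
    DFunLike.coe_injective continuous_induced_dom

instance : IsTopologicalAddGroup (Module.Dual A X) :=
  topologicalAddGroup_induced (H := Module.Dual A X) (G := X → A)
    (AddMonoidHom.mk' (fun (ℓ : Module.Dual A X) (x : X) => ℓ x) fun _ _ => rfl)

end DualAction

/-! ### Equivariant retractions -/

section Retraction

open scoped Pointwise

variable {H : Type*} [Group H] [TopologicalSpace H] [IsTopologicalGroup H] [CompactSpace H]

lemma exists_separating_sequence [T2Space H] [TotallyDisconnectedSpace H]
    [FirstCountableTopology H] :
    ∃ r : ℕ → H → ℕ, (∀ n a, IsOpen {h | r n h = a}) ∧ ∀ h h', (∀ n, r n h = r n h') → h = h' := by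
  obtain ⟨B, hB⟩ := (𝓝 (1 : H)).exists_antitone_basis
  have h1 : ∀ n, ∃ N : OpenNormalSubgroup H, ∀ u ∈ N, u ∈ B n := fun n =>
    exists_openNormalSubgroup_subset (hB.1.mem_of_mem trivial)
  choose N hN using h1
  have hfin : ∀ n, Finite (H ⧸ (N n).toSubgroup) := fun n =>
    (N n).toOpenSubgroup.toSubgroup.quotient_finite_of_isOpen (N n).isOpen
  refine ⟨fun n h => Finite.equivFin _ (h : H ⧸ (N n).toSubgroup), fun n a => ?_, fun h h' hh => ?_⟩
  · rw [isOpen_iff_mem_nhds]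
    intro h hh
    have h2 : {y | h⁻¹ * y ∈ N n} ∈ 𝓝 h :=
      ((N n).isOpen.preimage (continuous_const_mul h⁻¹)).mem_nhds (by simp [one_mem])
    filter_upwards [h2] with y hy
    have : (h : H ⧸ (N n).toSubgroup) = y := QuotientGroup.eq.2 hy
    rw [← this]
    exact hh
  · by_contra hne
    have h2 : {h⁻¹ * h'}ᶜ ∈ 𝓝 (1 : H) := isOpen_compl_singleton.mem_nhds (by
      simpa [eq_comm, inv_mul_eq_one] using hne)
    obtain ⟨n, -, hn⟩ := hB.1.mem_iff.1 h2
    have h3 : (h : H ⧸ (N n).toSubgroup) = h' := by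
      have := hh n
      simpa [Fin.val_inj] using this
    exact hn (hN n _ (QuotientGroup.eq.1 h3)) rfl

/-- The elements of `T` whose rank is minimal in the intersection of `T` with their `Q`-orbit. -/
def minimalRank (Q : Subgroup H) (r : H → ℕ) (T : Set H) : Set H :=
  {t | t ∈ T ∧ ∀ q ∈ Q, q * t ∈ T → r t ≤ r (q * t)}

lemma isClopen_minimalRank {Q : Subgroup H} (hQ : IsClosed (Q : Set H)) {r : H → ℕ}
    (hr : ∀ a, IsOpen {h | r h = a}) {T : Set H} (hT : IsClopen T) :
    IsClopen (minimalRank Q r T) := by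
  let S : ℕ → Set H := fun a => T ∩ {h | r h < a}
  have hrc : Continuous r := continuous_discrete_rng.2 hr
  have hS : ∀ a, IsClopen (S a) := fun a => hT.inter
    ((isClopen_discrete {b : ℕ | b < a}).preimage hrc)
  have hQS : ∀ a, IsClopen ((Q : Set H) * S a) := fun a =>
    ⟨(hS a).1.mul_left_of_isCompact hQ.isCompact, (hS a).2.mul_left⟩
  have hmem : ∀ a h, h ∈ (Q : Set H) * S a ↔ ∃ q ∈ Q, q * h ∈ T ∧ r (q * h) < a := by
    intro a h
    rw [Set.mem_mul]
    constructor
    · rintro ⟨q, hq, y, hy, rfl⟩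
      refine ⟨q⁻¹, Q.inv_mem hq, ?_⟩
      rw [inv_mul_cancel_left]
      exact hy
    · rintro ⟨q, hq, h1⟩
      exact ⟨q⁻¹, Q.inv_mem hq, q * h, h1, by simp⟩
  have e1 : minimalRank Q r T = ⋃ a, (T ∩ {h | r h = a}) ∩ ((Q : Set H) * S a)ᶜ := by
    ext h
    simp only [Set.mem_iUnion, Set.mem_inter_iff, Set.mem_compl_iff, hmem, minimalRank,
      Set.mem_ofPred_eq]
    constructor
    · rintro ⟨h1, h2⟩
      refine ⟨r h, ⟨h1, rfl⟩, ?_⟩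
      rintro ⟨q, hq, h3, h4⟩
      exact absurd (h2 q hq h3) (by omega)
    · rintro ⟨a, ⟨h1, rfl⟩, h2⟩
      refine ⟨h1, fun q hq h3 => ?_⟩
      by_contra h4
      exact h2 ⟨q, hq, h3, by omega⟩
  have e2 : (minimalRank Q r T)ᶜ = Tᶜ ∪ ⋃ a, (T ∩ {h | r h = a}) ∩ ((Q : Set H) * S a) := by
    ext h
    simp only [Set.mem_iUnion, Set.mem_inter_iff, Set.mem_compl_iff, hmem, minimalRank,
      Set.mem_ofPred_eq, Set.mem_union]
    constructor
    · intro h1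
      by_cases h2 : h ∈ T
      · right
        simp only [not_and, not_forall, not_le] at h1
        obtain ⟨q, hq, h3, h4⟩ := h1 h2
        exact ⟨r h, ⟨h2, rfl⟩, q, hq, h3, h4⟩
      · exact Or.inl h2
    · rintro (h1 | ⟨a, ⟨h1, rfl⟩, q, hq, h2, h3⟩) ⟨h4, h5⟩
      · exact h1 h4
      · exact absurd (h5 q hq h2) (by omega)
  refine ⟨?_, ?_⟩
  · rw [← isOpen_compl_iff, e2]
    exact hT.compl.2.union (isOpen_iUnion fun a => (hT.2.inter (hr a)).inter (hQS a).2)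
  · rw [e1]
    exact isOpen_iUnion fun a => (hT.2.inter (hr a)).inter (hQS a).compl.2

lemma exists_mem_minimalRank {Q : Subgroup H} (r : H → ℕ) {T : Set H} {h : H}
    (hT : ∃ q ∈ Q, q * h ∈ T) : ∃ q ∈ Q, q * h ∈ minimalRank Q r T := by
  classical
  have hex : ∃ a, ∃ q ∈ Q, q * h ∈ T ∧ r (q * h) = a := by
    obtain ⟨q, hq, hqT⟩ := hT
    exact ⟨_, q, hq, hqT, rfl⟩
  obtain ⟨q, hq, hqT, hqr⟩ := Nat.find_spec hex
  refine ⟨q, hq, hqT, fun q' hq' h' => ?_⟩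
  rw [hqr]
  exact Nat.find_min' hex ⟨q' * q, Q.mul_mem hq' hq, by rwa [mul_assoc], by rw [mul_assoc]⟩

/-- A closed subgroup `Q` of a first countable profinite group has a closed transversal. -/
lemma exists_closed_transversal [T2Space H] [TotallyDisconnectedSpace H]
    [FirstCountableTopology H] {Q : Subgroup H} (hQ : IsClosed (Q : Set H)) :
    ∃ T : Set H, IsClosed T ∧ (∀ h, ∃ q ∈ Q, q * h ∈ T) ∧
      ∀ t ∈ T, ∀ q ∈ Q, q * t ∈ T → q * t = t := by
  obtain ⟨r, hr, hsep⟩ := exists_separating_sequence (H := H)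
  let T : ℕ → Set H := fun n => Nat.rec Set.univ (fun n S => minimalRank Q (r n) S) n
  have hTs : ∀ n, T (n + 1) = minimalRank Q (r n) (T n) := fun n => rfl
  have hT : ∀ n, IsClopen (T n) := fun n => by
    induction n with
    | zero => exact isClopen_univ
    | succ n ih => exact isClopen_minimalRank hQ (hr n) ih
  have hex : ∀ n h, ∃ q ∈ Q, q * h ∈ T n := fun n h => by
    induction n with
    | zero => exact ⟨1, Q.one_mem, trivial⟩
    | succ n ih => exact exists_mem_minimalRank (r n) ih
  refine ⟨⋂ n, T n, isClosed_iInter fun n => (hT n).1, fun h => ?_, fun t ht q hq hqt => ?_⟩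
  · have hc : ∀ n, IsClosed {q : H | q ∈ Q ∧ q * h ∈ T n} := fun n =>
      hQ.inter ((hT n).1.preimage (continuous_mul_const h))
    obtain ⟨q, hq⟩ := IsCompact.nonempty_iInter_of_sequence_nonempty_isCompact_isClosed
      (fun n => {q : H | q ∈ Q ∧ q * h ∈ T n}) (fun n q hq => ⟨hq.1, hq.2.1⟩)
      (fun n => hex n h) (hc 0).isCompact hc
    rw [Set.mem_iInter] at hq
    exact ⟨q, (hq 0).1, Set.mem_iInter.2 fun n => (hq n).2⟩
  · rw [Set.mem_iInter] at ht hqt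
    refine (hsep _ _ fun n => ?_).symm
    have h1 : t ∈ minimalRank Q (r n) (T n) := ht (n + 1)
    have h2 : q * t ∈ minimalRank Q (r n) (T n) := hqt (n + 1)
    have h3 := h2.2 q⁻¹ (Q.inv_mem hq)
    rw [inv_mul_cancel_left] at h3
    exact le_antisymm (h1.2 q hq (hqt n)) (h3 (ht n))

lemma exists_retraction_of_compact [T2Space H] [TotallyDisconnectedSpace H]
    [FirstCountableTopology H] {Q : Subgroup H} (hQ : IsClosed (Q : Set H)) :
    ∃ s : H → H, Continuous s ∧ (∀ h, s h ∈ Q) ∧ ∀ q ∈ Q, ∀ h, s (q * h) = q * s h := by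
  obtain ⟨T, hT, hex, huniq⟩ := exists_closed_transversal hQ
  choose p hp hpT using hex
  have hp_uniq : ∀ h, ∀ q ∈ Q, q * h ∈ T → q * h = p h * h := fun h q hq hqT => by
    have := huniq (p h * h) (hpT h) (q * (p h)⁻¹) (Q.mul_mem hq (Q.inv_mem (hp h)))
      (by rwa [mul_assoc, inv_mul_cancel_left])
    rwa [mul_assoc, inv_mul_cancel_left] at this
  have hcont : Continuous fun h => p h * h := by
    refine continuous_iff_isClosed.2 fun C hC => ?_
    have h1 : IsClosed {x : H × H | x.2 ∈ T ∩ C ∧ x.2 * x.1⁻¹ ∈ Q} :=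
      ((hT.inter hC).preimage continuous_snd).inter
        (hQ.preimage (continuous_snd.mul continuous_fst.inv))
    convert isClosedMap_fst_of_compactSpace _ h1 using 1
    ext h
    simp only [Set.mem_preimage, Set.mem_image, Prod.exists, exists_and_right, exists_eq_right,
      Set.mem_ofPred_eq]
    constructor
    · exact fun h2 => ⟨p h * h, ⟨hpT h, h2⟩, by simpa using hp h⟩
    · rintro ⟨y, ⟨h2, h3⟩, h4⟩
      have := hp_uniq h (y * h⁻¹) h4 (by simpa using h2)
      rw [← this]
      simpa using h3
  refine ⟨fun h => (p h)⁻¹, ?_, fun h => Q.inv_mem (hp h), fun q hq h => ?_⟩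
  · have : (fun h => (p h)⁻¹) = fun h => h * (p h * h)⁻¹ := by
      funext h
      simp
    rw [this]
    exact continuous_id.mul hcont.inv
  · have h1 := hp_uniq h (p (q * h) * q) (Q.mul_mem (hp _) hq) (by
      rw [mul_assoc]; exact hpT _)
    have h2 := mul_right_cancel h1
    simp [← h2]

end Retraction

/-- If `Γ = P K` with `K` compact open and `P` closed, there is a continuous retraction of `Γ` onto
`P` which is equivariant under left translation by `P`. -/
lemma exists_equivariant_retraction {Γ : Type*} [Group Γ] [TopologicalSpace Γ]
    [IsTopologicalGroup Γ] [T2Space Γ] [FirstCountableTopology Γ] {P K : Subgroup Γ}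
    [CompactSpace K] [TotallyDisconnectedSpace K] (hP : IsClosed (P : Set Γ))
    (hK : IsOpen (K : Set Γ)) (hPK : ∀ g : Γ, ∃ q ∈ P, ∃ k ∈ K, g = q * k) :
    ∃ r : Γ → P, Continuous r ∧ ∀ (q : P) (g : Γ), r (q * g) = q * r g := by
  have : FirstCountableTopology K := TopologicalSpace.firstCountableTopology_induced K Γ (↑)
  obtain ⟨s, hs, hsQ, hsq⟩ := exists_retraction_of_compact (H := K) (Q := P.subgroupOf K)
    (hP.preimage continuous_subtype_val)
  choose q hq k hk hqk using hPK
  let r : Γ → P := fun g => ⟨q g * (s ⟨k g, hk g⟩ : Γ), P.mul_mem (hq g) (hsQ _)⟩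
  have hr : ∀ (p : P) (x : K), (r (p * x) : Γ) = p * (s x : Γ) := by
    intro p x
    change q (p * x) * (s ⟨k (p * x), hk _⟩ : Γ) = p * (s x : Γ)
    have h1 := hqk (p * x)
    have h2 : (q (p * x))⁻¹ * p ∈ K := by
      have : (q (p * x))⁻¹ * p = k (p * x) * (x : Γ)⁻¹ := by
        rw [inv_mul_eq_iff_eq_mul, ← mul_assoc, ← h1, mul_inv_cancel_right]
      rw [this]
      exact K.mul_mem (hk _) (K.inv_mem x.2)
    have h3 := hsq ⟨_, h2⟩ (P.mul_mem (P.inv_mem (hq _)) p.2) x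
    have h4 : (⟨k (p * x), hk _⟩ : K) = ⟨_, h2⟩ * x := by
      ext
      change k (p * x) = (q (p * x))⁻¹ * p * x
      rw [mul_assoc, eq_inv_mul_iff_mul_eq]
      exact h1.symm
    rw [h4, h3]
    simp [mul_assoc]
  have hrp : ∀ (p : P) (g : Γ), r (p * g) = p * r g := by
    intro p g
    ext
    have h1 := hr (p * ⟨q g, hq g⟩) ⟨k g, hk g⟩
    have h2 : ((p * ⟨q g, hq g⟩ : P) : Γ) * (⟨k g, hk g⟩ : K) = p * g := by
      change (p : Γ) * q g * k g = p * g
      rw [mul_assoc, ← hqk]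
    rw [h2] at h1
    rw [h1]
    change (p : Γ) * q g * _ = p * (q g * _)
    rw [mul_assoc]
  refine ⟨r, ?_, hrp⟩
  have hrK : ContinuousOn r K := by
    rw [continuousOn_iff_continuous_domRestrict]
    refine Continuous.subtype_mk (f := fun x : K => (r x : Γ)) ?_ _
    have : (fun x : K => (r x : Γ)) = fun x => (s x : Γ) := by
      funext x
      simpa using hr 1 x
    rw [this]
    exact continuous_subtype_val.comp hs
  refine continuous_iff_continuousAt.2 fun g => ?_
  have h1 : r = fun x => ⟨q g, hq g⟩ * r ((q g)⁻¹ * x) := by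
    funext x
    rw [← hrp]
    simp
  rw [h1]
  have h2 : (q g)⁻¹ * g ∈ K := by
    have : (q g)⁻¹ * g = k g := by
      rw [inv_mul_eq_iff_eq_mul]
      exact hqk g
    rw [this]
    exact hk g
  refine continuousAt_const.mul ?_
  exact ContinuousAt.comp (f := fun x => (q g)⁻¹ * x) (g := r) (hrK.continuousAt (hK.mem_nhds h2))
    (continuous_const_mul _).continuousAt

/-! ### Functions in the continuous induction -/

section ContInd

variable (A : Type*) [CommRing A] [IsLocalRing A]

/-- The function `f` is locally constant modulo `𝔪_A^n`. -/
def IsLocallyConstMod (n : ℕ) {X U : Type*} [TopologicalSpace X] [AddCommGroup U] [Module A U]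
    (f : X → U) : Prop :=
  ∀ x, ∀ᶠ y in 𝓝 x, f y - f x ∈ (maximalIdeal A ^ n • ⊤ : Submodule A U)

/-- The orbit maps of the representation `ρ` are continuous for the `𝔪_A`-adic topology. -/
def HasContinuousOrbits {P U : Type*} [Group P] [TopologicalSpace P] [AddCommGroup U] [Module A U]
    (ρ : Representation A P U) : Prop :=
  ∀ n u, IsLocallyConstMod A n fun q => ρ q u

variable {A}

lemma HasContinuousOrbits.comp {P P' U : Type*} [Group P] [TopologicalSpace P] [Group P']
    [TopologicalSpace P'] [AddCommGroup U] [Module A U] {ρ : Representation A P U}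
    (hρ : HasContinuousOrbits A ρ) {φ : P' →* P} (hφ : Continuous φ) :
    HasContinuousOrbits A (ρ.comp φ) :=
  fun n u q => (hφ.tendsto q).eventually (hρ n u (φ q))

lemma HasContinuousOrbits.isAdicallySmooth {H U : Type*} [Group H] [TopologicalSpace H]
    [IsTopologicalGroup H] [CompactSpace H] [TotallyDisconnectedSpace H] [AddCommGroup U]
    [Module A U] {ρ : Representation A H U} (hρ : HasContinuousOrbits A ρ) :
    IsAdicallySmooth ρ := fun n u => by
  obtain ⟨N, hN⟩ := exists_openNormalSubgroup_subset (hρ n u 1)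
  refine ⟨N, fun h hh => ?_⟩
  have := hN h hh
  simpa using this

variable {Γ : Type*} [Group Γ] [TopologicalSpace Γ] [IsTopologicalGroup Γ]
  {P K : Subgroup Γ} {U : Type*} [AddCommGroup U] [Module A U] {ρ : Representation A P U}

lemma HasContinuousOrbits.isLocallyConstMod_smul (hρ : HasContinuousOrbits A ρ) {n : ℕ}
    {X : Type*} [TopologicalSpace X] {F : X → P} (hF : Continuous F) {g : X → U}
    (hg : IsLocallyConstMod A n g) : IsLocallyConstMod A n fun x => ρ (F x) (g x) := by
  intro x
  filter_upwards [hg x, (hF.tendsto x).eventually (hρ n (g x) (F x))] with y h1 h2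
  have := add_mem ((ρ (F y)).map_mem_pow_smul h1) h2
  simpa using this

lemma contInd_isLocallyConstMod (f : contInd ρ) (n : ℕ) : IsLocallyConstMod A n f.1 :=
  continuous_adicTop_iff.1 f.2.1 n

lemma contInd_apply_mul (f : contInd ρ) (q : P) (g : Γ) : f.1 (q * g) = ρ q (f.1 g) := f.2.2 q g

/-- The function `γ ↦ r(γ) g(γ)` in the induction, for a left `P`-invariant function `g` and an
equivariant retraction `r : Γ → P`. -/
def contIndMk (hρ : HasContinuousOrbits A ρ) {r : Γ → P} (hr : Continuous r)
    (hrq : ∀ (q : P) (g : Γ), r (q * g) = q * r g) (g : Γ → U)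
    (hg : ∀ n, IsLocallyConstMod A n g) (hgq : ∀ (q : P) (x : Γ), g (q * x) = g x) : contInd ρ :=
  ⟨fun x => ρ (r x) (g x), continuous_adicTop_iff.2 fun n => hρ.isLocallyConstMod_smul hr (hg n),
    fun q x => by
      change ρ (r (q * x)) (g (q * x)) = ρ q (ρ (r x) (g x))
      rw [hrq, hgq, map_mul]
      rfl⟩

lemma rho_inv_apply (q : P) (u : U) : ρ q⁻¹ (ρ q u) = u := by
  rw [← Module.End.mul_apply, ← map_mul]
  simp

lemma rho_apply_inv (q : P) (u : U) : ρ q (ρ q⁻¹ u) = u := by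
  rw [← Module.End.mul_apply, ← map_mul]
  simp

/-- A function which is equivariant and locally constant modulo `𝔪_A^n` is congruent to an element
of the induction. -/
lemma exists_contInd_congr (hρ : HasContinuousOrbits A ρ) {r : Γ → P} (hr : Continuous r)
    (hrq : ∀ (q : P) (g : Γ), r (q * g) = q * r g) {n : ℕ} {φ : Γ → U}
    (hφ : IsLocallyConstMod A n φ)
    (hφq : ∀ (q : P) (x : Γ), φ (q * x) - ρ q (φ x) ∈ (maximalIdeal A ^ n • ⊤ : Submodule A U)) :
    ∃ f : contInd ρ, ∀ x, f.1 x - φ x ∈ (maximalIdeal A ^ n • ⊤ : Submodule A U) := by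
  have h1 : IsLocallyConstMod A n fun x => ρ (r x)⁻¹ (φ x) :=
    hρ.isLocallyConstMod_smul hr.inv hφ
  refine ⟨contIndMk hρ hr hrq (fun x => adicRep A n (ρ (r x)⁻¹ (φ x))) (fun m x => ?_)
    (fun q x => ?_), fun x => ?_⟩
  · filter_upwards [h1 x] with y hy
    rw [adicRep_congr hy, sub_self]
    exact zero_mem _
  · refine adicRep_congr ?_
    have h2 := (ρ (q * r x)⁻¹).map_mem_pow_smul (hφq q x)
    rw [hrq]
    rw [map_sub] at h2
    convert h2 using 2
    rw [mul_inv_rev, map_mul, Module.End.mul_apply, rho_inv_apply]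
  · change ρ (r x) (adicRep A n (ρ (r x)⁻¹ (φ x))) - φ x ∈ _
    have h2 := (ρ (r x)).map_mem_pow_smul (adicRep_sub_mem n (ρ (r x)⁻¹ (φ x)))
    rw [map_sub, rho_apply_inv] at h2
    exact h2

/-- An element of the induction with values in `𝔪_A^n U` lies in `𝔪_A^n Ind`. -/
lemma contInd_mem_pow_smul [IsNoetherianRing A] [IsAdicComplete (maximalIdeal A) U]
    (hρ : HasContinuousOrbits A ρ) {r : Γ → P} (hr : Continuous r)
    (hrq : ∀ (q : P) (g : Γ), r (q * g) = q * r g) {n : ℕ} {f : contInd ρ}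
    (hf : ∀ x, f.1 x ∈ (maximalIdeal A ^ n • ⊤ : Submodule A U)) :
    f ∈ (maximalIdeal A ^ n • ⊤ : Submodule A (contInd ρ)) := by
  obtain ⟨m, a, Y, ha, hsum, hY⟩ := exists_continuous_coefficients (A := A) (U := U) n
  let g : Γ → U := fun x => ρ (r x)⁻¹ (f.1 x)
  have hg : ∀ k, IsLocallyConstMod A k g := fun k =>
    hρ.isLocallyConstMod_smul hr.inv (contInd_isLocallyConstMod f k)
  have hgq : ∀ (q : P) (x : Γ), g (q * x) = g x := fun q x => by
    simp only [g]
    rw [hrq, contInd_apply_mul, mul_inv_rev, map_mul, Module.End.mul_apply, rho_inv_apply]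
  let F : Fin m → contInd ρ := fun i => contIndMk hρ hr hrq (fun x => Y i (g x)) (fun k x => by
    filter_upwards [(hg (n + k) : IsLocallyConstMod A (n + k) g) x] with y hy
    exact hY i k _ _ hy) (fun q x => by rw [hgq])
  have h1 : f = ∑ i, a i • F i := by
    ext x
    have h2 : (∑ i, a i • F i : contInd ρ).1 x = ∑ i, a i • (F i).1 x := by
      have : (∑ i, a i • F i : contInd ρ).1 = ∑ i, a i • (F i).1 := by
        simp
      rw [this, Finset.sum_apply]
      rfl
    rw [h2]
    have h3 : ∀ i, a i • (F i).1 x = ρ (r x) (a i • Y i (g x)) := fun i =>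
      ((ρ (r x)).map_smul _ _).symm
    simp only [h3, ← map_sum]
    rw [hsum _ ((ρ (r x)⁻¹).map_mem_pow_smul (hf x)), rho_apply_inv]
  rw [h1]
  exact sum_mem fun i _ => Submodule.smul_mem_smul (ha i) trivial

lemma isLocallyConstMod_of_invariant (hK : IsOpen (K : Set Γ)) {n : ℕ} {N : OpenNormalSubgroup K}
    {φ : Γ → U} (hφ : ∀ x, ∀ u ∈ N, φ (x * u) - φ x ∈ (maximalIdeal A ^ n • ⊤ : Submodule A U)) :
    IsLocallyConstMod A n φ := by
  intro x
  have h1 : IsOpen ((↑) '' (N : Set K) : Set Γ) := hK.isOpenMap_subtype_val _ N.isOpen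
  have h2 : {y | x⁻¹ * y ∈ ((↑) '' (N : Set K) : Set Γ)} ∈ 𝓝 x :=
    (h1.preimage (continuous_const_mul x⁻¹)).mem_nhds ⟨1, one_mem N, by simp⟩
  filter_upwards [h2] with y hy
  obtain ⟨u, hu, hy⟩ := hy
  have := hφ x u hu
  rwa [hy, mul_inv_cancel_left] at this

lemma exists_invariant_of_isLocallyConstMod [CompactSpace K] [TotallyDisconnectedSpace K]
    (hPK : ∀ g : Γ, ∃ q ∈ P, ∃ k ∈ K, g = q * k) {n : ℕ} {φ : Γ → U}
    (hφ : IsLocallyConstMod A n φ)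
    (hφq : ∀ (q : P) (x y : Γ), φ x - φ y ∈ (maximalIdeal A ^ n • ⊤ : Submodule A U) →
      φ (q * x) - φ (q * y) ∈ (maximalIdeal A ^ n • ⊤ : Submodule A U)) :
    ∃ N : OpenNormalSubgroup K, ∀ x, ∀ u ∈ N,
      φ (x * u) - φ x ∈ (maximalIdeal A ^ n • ⊤ : Submodule A U) := by
  obtain ⟨N, hN⟩ := exists_openNormalSubgroup_invariant (H := K)
    (maximalIdeal A ^ n • ⊤ : Submodule A U) (fun k => φ k)
    fun x => (continuous_subtype_val.tendsto x).eventually (hφ x)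
  refine ⟨N, fun x u hu => ?_⟩
  obtain ⟨q, hq, k, hk, rfl⟩ := hPK x
  rw [mul_assoc]
  exact hφq ⟨q, hq⟩ _ _ (hN ⟨k, hk⟩ u hu)

lemma contInd_exists_invariant [CompactSpace K] [TotallyDisconnectedSpace K]
    (hPK : ∀ g : Γ, ∃ q ∈ P, ∃ k ∈ K, g = q * k) (f : contInd ρ) (n : ℕ) :
    ∃ N : OpenNormalSubgroup K, ∀ x, ∀ u ∈ N,
      f.1 (x * u) - f.1 x ∈ (maximalIdeal A ^ n • ⊤ : Submodule A U) :=
  exists_invariant_of_isLocallyConstMod hPK (contInd_isLocallyConstMod f n) fun q x y h => by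
    rw [contInd_apply_mul, contInd_apply_mul, ← map_sub]
    exact (ρ q).map_mem_pow_smul h

lemma contIndRep_apply (g : Γ) (f : contInd ρ) (x : Γ) : (contIndRep ρ g f).1 x = f.1 (x * g) := rfl

lemma isAdicallySmooth_contIndRep [IsNoetherianRing A] [IsAdicComplete (maximalIdeal A) U]
    [CompactSpace K] [TotallyDisconnectedSpace K]
    (hPK : ∀ g : Γ, ∃ q ∈ P, ∃ k ∈ K, g = q * k)
    (hρ : HasContinuousOrbits A ρ) {r : Γ → P} (hr : Continuous r)
    (hrq : ∀ (q : P) (g : Γ), r (q * g) = q * r g) :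
    IsAdicallySmooth ((contIndRep ρ).comp K.subtype) := fun n f => by
  obtain ⟨N, hN⟩ := contInd_exists_invariant hPK f n
  exact ⟨N, fun u hu => contInd_mem_pow_smul hρ hr hrq fun x => hN x u hu⟩

/-- The elements of `Γ` in the double coset `P c⁻¹ N`. -/
def doubleCoset (P : Subgroup Γ) (c : K) (N : OpenNormalSubgroup K) : Set Γ :=
  {x | ∃ q : P, ∃ u ∈ N, x = q * (c : Γ)⁻¹ * (u : K)}

lemma mul_mem_doubleCoset_iff {c : K} {N : OpenNormalSubgroup K} {x : Γ} {u : K} (hu : u ∈ N) :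
    x * u ∈ doubleCoset P c N ↔ x ∈ doubleCoset P c N := by
  constructor
  · rintro ⟨q, u', hu', h⟩
    refine ⟨q, u' * u⁻¹, mul_mem hu' (inv_mem hu), ?_⟩
    rw [Subgroup.coe_mul, ← mul_assoc, ← h]
    simp
  · rintro ⟨q, u', hu', rfl⟩
    exact ⟨q, u' * u, mul_mem hu' hu, by simp [mul_assoc]⟩

lemma left_mul_mem_doubleCoset_iff {c : K} {N : OpenNormalSubgroup K} {x : Γ} (q : P) :
    q * x ∈ doubleCoset P c N ↔ x ∈ doubleCoset P c N := by
  constructor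
  · rintro ⟨q', u, hu, h⟩
    refine ⟨q⁻¹ * q', u, hu, ?_⟩
    simp only [Subgroup.coe_mul, mul_assoc] at h ⊢
    rw [← h]
    simp
  · rintro ⟨q', u, hu, rfl⟩
    exact ⟨q * q', u, hu, by simp [mul_assoc]⟩

/-- Functions in the induction which are supported on `P c⁻¹ N` modulo `𝔪_A^n`, with prescribed
value at `c⁻¹`. -/
lemma exists_contInd_supported (hK : IsOpen (K : Set Γ)) (hρ : HasContinuousOrbits A ρ)
    {r : Γ → P} (hr : Continuous r) (hrq : ∀ (q : P) (g : Γ), r (q * g) = q * r g) (c : K) (w : U)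
    {n : ℕ} {N : OpenNormalSubgroup K} (hN : ∀ u ∈ N, ∀ hu : (u : Γ) ∈ P,
      ρ ⟨u, hu⟩ w - w ∈ (maximalIdeal A ^ n • ⊤ : Submodule A U)) :
    ∃ f : contInd ρ, (∀ x, ∀ u ∈ N, f.1 (x * u) - f.1 x ∈
        (maximalIdeal A ^ n • ⊤ : Submodule A U)) ∧
      (f.1 (c : Γ)⁻¹ - w ∈ (maximalIdeal A ^ n • ⊤ : Submodule A U)) ∧
      (∀ x ∉ doubleCoset P c N, f.1 x ∈ (maximalIdeal A ^ n • ⊤ : Submodule A U)) ∧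
      ∀ (q : P), ∀ u ∈ N, f.1 (q * (c : Γ)⁻¹ * (u : K)) - ρ q w ∈
        (maximalIdeal A ^ n • ⊤ : Submodule A U) := by
  classical
  let φ : Γ → U := fun x => if h : x ∈ doubleCoset P c N then ρ h.choose w else 0
  have h0 : ∀ x ∉ doubleCoset P c N, φ x = 0 := fun x hx => dif_neg hx
  have h1 : ∀ (q : P), ∀ u ∈ N, φ (q * (c : Γ)⁻¹ * (u : K)) - ρ q w ∈
      (maximalIdeal A ^ n • ⊤ : Submodule A U) := by
    intro q u hu
    have h : q * (c : Γ)⁻¹ * (u : K) ∈ doubleCoset P c N := ⟨q, u, hu, rfl⟩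
    simp only [φ, dif_pos h]
    obtain ⟨u', hu', h2⟩ := h.choose_spec
    generalize h.choose = q' at *
    have h3 : ((q⁻¹ * q' : P) : Γ) = (c⁻¹ * (u * u'⁻¹) * c : K) := by
      simp only [Subgroup.coe_mul, Subgroup.coe_inv]
      rw [inv_mul_eq_iff_eq_mul]
      simp only [← mul_assoc]
      rw [h2]
      simp
    have h4 : c⁻¹ * (u * u'⁻¹) * c ∈ N := by
      have := N.isNormal'.conj_mem _ (N.toSubgroup.mul_mem hu (N.toSubgroup.inv_mem hu')) c⁻¹
      rwa [inv_inv] at this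
    have h5 := (ρ q).map_mem_pow_smul (hN _ h4 (h3 ▸ (q⁻¹ * q').2))
    have h6 : (⟨_, h3 ▸ (q⁻¹ * q').2⟩ : P) = q⁻¹ * q' := Subtype.ext h3.symm
    rw [h6, map_sub, map_mul, Module.End.mul_apply, rho_apply_inv] at h5
    exact h5
  have h2 : ∀ x, ∀ u ∈ N, φ (x * u) - φ x ∈ (maximalIdeal A ^ n • ⊤ : Submodule A U) := by
    intro x u hu
    by_cases hx : x ∈ doubleCoset P c N
    · obtain ⟨q, u', hu', rfl⟩ := hx
      have := sub_mem (h1 q (u' * u) (mul_mem hu' hu)) (h1 q u' hu')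
      simpa [mul_assoc] using this
    · rw [h0 x hx, h0 _ fun h => hx ((mul_mem_doubleCoset_iff hu).1 h), sub_self]
      exact zero_mem _
  obtain ⟨f, hf⟩ := exists_contInd_congr hρ hr hrq (isLocallyConstMod_of_invariant hK h2)
    fun q x => by
      by_cases hx : x ∈ doubleCoset P c N
      · obtain ⟨q', u', hu', rfl⟩ := hx
        have := sub_mem (h1 (q * q') u' hu') ((ρ q).map_mem_pow_smul (h1 q' u' hu'))
        simpa [mul_assoc] using this
      · rw [h0 x hx, h0 _ fun h => hx ((left_mul_mem_doubleCoset_iff q).1 h), map_zero, sub_self]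
        exact zero_mem _
  have h3 : ∀ (q : P), ∀ u ∈ N, f.1 (q * (c : Γ)⁻¹ * (u : K)) - ρ q w ∈
      (maximalIdeal A ^ n • ⊤ : Submodule A U) := fun q u hu => by
    simpa using add_mem (hf (q * (c : Γ)⁻¹ * (u : K))) (h1 q u hu)
  refine ⟨f, fun x u hu => ?_, ?_, fun x hx => ?_, h3⟩
  · have := sub_mem (add_mem (hf (x * u)) (h2 x u hu)) (hf x)
    simpa using this
  · simpa using h3 1 1 (one_mem N)
  · simpa [h0 x hx] using hf x

/-- The function in the induction with value `r(γ) v` on `P c⁻¹ N` and zero elsewhere, as a linear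
function of `v`. -/
def contIndIndicator (hK : IsOpen (K : Set Γ)) (hρ : HasContinuousOrbits A ρ) {r : Γ → P}
    (hr : Continuous r) (hrq : ∀ (q : P) (g : Γ), r (q * g) = q * r g) (c : K)
    (N : OpenNormalSubgroup K) : U →ₗ[A] contInd ρ where
  toFun v := contIndMk hρ hr hrq (Set.indicator (doubleCoset P c N) fun _ => v)
    (fun n => isLocallyConstMod_of_invariant hK (N := N) fun x u hu => by
      classical
      simp only [Set.indicator_apply, mul_mem_doubleCoset_iff hu, sub_self, zero_mem])
    (fun q x => by
      classical
      simp only [Set.indicator_apply, left_mul_mem_doubleCoset_iff])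
  map_add' v w := by
    classical
    ext x
    change ρ (r x) _ = ρ (r x) _ + ρ (r x) _
    simp only [Set.indicator_apply, ← map_add]
    split_ifs <;> simp
  map_smul' a v := by
    classical
    ext x
    change ρ (r x) _ = a • ρ (r x) _
    simp only [Set.indicator_apply, ← map_smul]
    split_ifs <;> simp

lemma contIndIndicator_apply (hK : IsOpen (K : Set Γ)) (hρ : HasContinuousOrbits A ρ) {r : Γ → P}
    (hr : Continuous r) (hrq : ∀ (q : P) (g : Γ), r (q * g) = q * r g) (c : K)
    (N : OpenNormalSubgroup K) (v : U) (x : Γ) :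
    (contIndIndicator hK hρ hr hrq c N v).1 x =
      ρ (r x) (Set.indicator (doubleCoset P c N) (fun _ => v) x) := rfl

end ContInd

/-! ### Topological properties of completed tensor products -/

section CompletedTensor

lemma TensorProduct.finite_of_finite (A X Y : Type*) [CommRing A] [AddCommGroup X] [Module A X]
    [AddCommGroup Y] [Module A Y] [Finite X] [Finite Y] : Finite (X ⊗[A] Y) := by
  classical
  have := Fintype.ofFinite X
  refine Finite.of_surjective (fun f : X → Y => ∑ x, x ⊗ₜ[A] f x) fun t => ?_
  induction t using TensorProduct.induction_on with
  | zero => exact ⟨0, by simp⟩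
  | tmul x y =>
    refine ⟨Pi.single x y, ?_⟩
    dsimp only
    rw [Finset.sum_eq_single x]
    · simp
    · intro b _ hb
      rw [Pi.single_eq_of_ne hb, TensorProduct.tmul_zero]
    · simp
  | add s t hs ht =>
    obtain ⟨f, rfl⟩ := hs
    obtain ⟨g, rfl⟩ := ht
    exact ⟨f + g, by simp [TensorProduct.tmul_add, Finset.sum_add_distrib]⟩

variable {A : Type*} [CommRing A] {R S : Type*} [Ring R] [Algebra A R] [Ring S] [Algebra A S]
  [TopologicalSpace S] {M : Type*} [AddCommGroup M] [Module A M] [TopologicalSpace M]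
  {θ : R →ₐ[A] S} {α : R →ₐ[A] Module.End A M}

namespace CompletedTensorIndex

/-- The intersection of two indices. -/
def inf (i j : CompletedTensorIndex S α) : CompletedTensorIndex S α where
  J := i.J ⊓ j.J
  J_open := i.J_open.inter j.J_open
  J_left s x hx := ⟨i.J_left s x hx.1, j.J_left s x hx.2⟩
  J_right s x hx := ⟨i.J_right s x hx.1, j.J_right s x hx.2⟩
  N := i.N ⊓ j.N
  N_open := i.N_open.inter j.N_open
  N_smul r m hm := ⟨i.N_smul r m hm.1, j.N_smul r m hm.2⟩

instance : Nonempty (CompletedTensorIndex S α) :=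
  ⟨{ J := ⊤
     J_open := isOpen_univ
     J_left := fun _ _ _ => trivial
     J_right := fun _ _ _ => trivial
     N := ⊤
     N_open := isOpen_univ
     N_smul := fun _ _ _ => trivial }⟩

/-- The class of `s ⊗ m` in `S / J ⊗_R M / N`. -/
def mkTmul (θ : R →ₐ[A] S) (i : CompletedTensorIndex S α) (s : S) (m : M) : i.Level θ :=
  BalancedTensor.tmul (i.rightAct θ) i.modAct (Submodule.Quotient.mk s) (Submodule.Quotient.mk m)

lemma Level.induction (i : CompletedTensorIndex S α) {p : i.Level θ → Prop} (t : i.Level θ)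
    (h0 : p 0) (htmul : ∀ s m, p (i.mkTmul θ s m)) (hadd : ∀ s t, p s → p t → p (s + t)) : p t := by
  refine BalancedTensor.induction (a := i.rightAct θ) (b := i.modAct) (p := p) t h0
    (fun x y => ?_) hadd
  obtain ⟨x, rfl⟩ := Submodule.Quotient.mk_surjective _ x
  obtain ⟨y, rfl⟩ := Submodule.Quotient.mk_surjective _ y
  exact htmul x y

lemma mkTmul_congr (i : CompletedTensorIndex S α) {s s' : S} {m m' : M} (hs : s - s' ∈ i.J)
    (hm : m - m' ∈ i.N) : i.mkTmul θ s m = i.mkTmul θ s' m' := by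
  rw [mkTmul, mkTmul, (Submodule.Quotient.eq _).2 hs, (Submodule.Quotient.eq _).2 hm]

lemma mkTmul_mul (i : CompletedTensorIndex S α) (s : S) (r : R) (m : M) :
    i.mkTmul θ (s * θ r) m = i.mkTmul θ s (α r m) := by
  refine (Submodule.Quotient.eq _).2 (Submodule.subset_span ?_)
  exact ⟨r, Submodule.Quotient.mk s, Submodule.Quotient.mk m, rfl⟩

/-- The class of `s ⊗ m` as a bilinear function. -/
def mkTmulₗ (θ : R →ₐ[A] S) (i : CompletedTensorIndex S α) : S →ₗ[A] M →ₗ[A] i.Level θ :=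
  ((TensorProduct.mk A (S ⧸ i.J) (M ⧸ i.N)).compr₂ (Submodule.mkQ (Submodule.span A
    {t : (S ⧸ i.J) ⊗[A] (M ⧸ i.N) | ∃ (r : R) (x : S ⧸ i.J) (y : M ⧸ i.N),
      t = i.rightAct θ r x ⊗ₜ[A] y - x ⊗ₜ[A] i.modAct r y}))).compl₁₂ i.J.mkQ i.N.mkQ

lemma mkTmul_add_left (i : CompletedTensorIndex S α) (s s' : S) (m : M) :
    i.mkTmul θ (s + s') m = i.mkTmul θ s m + i.mkTmul θ s' m :=
  LinearMap.congr_fun (map_add (mkTmulₗ θ i) s s') m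

lemma mkTmul_add_right (i : CompletedTensorIndex S α) (s : S) (m m' : M) :
    i.mkTmul θ s (m + m') = i.mkTmul θ s m + i.mkTmul θ s m' :=
  map_add (mkTmulₗ θ i s) m m'

instance finite_level [IsTopologicalAddGroup S] [CompactSpace S] [IsTopologicalAddGroup M]
    [CompactSpace M] (i : CompletedTensorIndex S α) : Finite (i.Level θ) := by
  have h1 : Finite (S ⧸ i.J) := i.J.toAddSubgroup.quotient_finite_of_isOpen i.J_open
  have h2 : Finite (M ⧸ i.N) := i.N.toAddSubgroup.quotient_finite_of_isOpen i.N_open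
  have := TensorProduct.finite_of_finite A (S ⧸ i.J) (M ⧸ i.N)
  exact Finite.of_surjective _ (Submodule.Quotient.mk_surjective (Submodule.span A
    {t : (S ⧸ i.J) ⊗[A] (M ⧸ i.N) | ∃ (r : R) (x : S ⧸ i.J) (y : M ⧸ i.N),
      t = i.rightAct θ r x ⊗ₜ[A] y - x ⊗ₜ[A] i.modAct r y}))

end CompletedTensorIndex

namespace CompletedTensor

open CompletedTensorIndex

instance compactSpace [IsTopologicalAddGroup S] [CompactSpace S] [IsTopologicalAddGroup M]
    [CompactSpace M] : CompactSpace (CompletedTensor θ α) := by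
  let _ : ∀ i : CompletedTensorIndex S α, TopologicalSpace (i.Level θ) := fun _ => ⊥
  have hd : ∀ i : CompletedTensorIndex S α, DiscreteTopology (i.Level θ) := fun _ => ⟨rfl⟩
  have hι : Topology.IsInducing (fun x : CompletedTensor θ α => x.1) := ⟨rfl⟩
  rw [← isCompact_univ_iff, hι.isCompact_iff, Set.image_univ]
  have hr : Set.range (fun x : CompletedTensor θ α => x.1) =
      ⋂ (i : CompletedTensorIndex S α) (j : CompletedTensorIndex S α) (hJ : i.J ≤ j.J)
        (hN : i.N ≤ j.N), {x | transition θ hJ hN (x i) = x j} := by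
    ext x
    simp only [Set.mem_iInter, Set.mem_range]
    exact ⟨by rintro ⟨y, rfl⟩; exact y.2, fun h => ⟨⟨x, h⟩, rfl⟩⟩
  rw [hr]
  refine IsClosed.isCompact ?_
  refine isClosed_iInter fun i => isClosed_iInter fun j => isClosed_iInter fun hJ =>
    isClosed_iInter fun hN => isClosed_eq ?_ (continuous_apply j)
  exact (continuous_of_discreteTopology (f := transition θ hJ hN)).comp (continuous_apply i)

lemma nhds_hasBasis (x : CompletedTensor θ α) : (𝓝 x).HasBasis
    (fun _ : CompletedTensorIndex S α => True) fun i => {y | y.1 i = x.1 i} := by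
  let _ : ∀ i : CompletedTensorIndex S α, TopologicalSpace (i.Level θ) := fun _ => ⊥
  have hd : ∀ i : CompletedTensorIndex S α, DiscreteTopology (i.Level θ) := fun _ => ⟨rfl⟩
  have hι : Topology.IsInducing (fun x : CompletedTensor θ α => x.1) := ⟨rfl⟩
  let B : Filter (CompletedTensor θ α) :=
    ⨅ i : CompletedTensorIndex S α, 𝓟 {y | y.1 i = x.1 i}
  have hB : B ≤ 𝓝 x := by
    refine hι.tendsto_nhds_iff.2 (tendsto_pi_nhds.2 fun i => ?_)
    rw [nhds_discrete, tendsto_pure]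
    exact mem_iInf_of_mem i (mem_principal_self _)
  have hdir : Directed (· ≥ ·) fun i : CompletedTensorIndex S α =>
      𝓟 {y : CompletedTensor θ α | y.1 i = x.1 i} := fun i j => by
    refine ⟨inf i j, principal_mono.2 fun y hy => ?_, principal_mono.2 fun y hy => ?_⟩
    · have h1 := y.2 (inf i j) i inf_le_left inf_le_left
      have h2 := x.2 (inf i j) i inf_le_left inf_le_left
      rw [Set.mem_ofPred_eq] at hy ⊢
      rw [← h1, ← h2, hy]
    · have h1 := y.2 (inf i j) j inf_le_right inf_le_right
      have h2 := x.2 (inf i j) j inf_le_right inf_le_right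
      rw [Set.mem_ofPred_eq] at hy ⊢
      rw [← h1, ← h2, hy]
  refine ⟨fun s => ⟨fun hs => ?_, ?_⟩⟩
  · obtain ⟨i, hi⟩ := (mem_iInf_of_directed hdir s).1 (hB hs)
    exact ⟨i, trivial, hi⟩
  · rintro ⟨i, -, hi⟩
    refine mem_of_superset ?_ hi
    have h1 : Tendsto (fun y : CompletedTensor θ α => y.1 i) (𝓝 x) (𝓝 (x.1 i)) :=
      ((continuous_apply i).comp hι.continuous).tendsto x
    rw [show 𝓝 (x.1 i) = pure (x.1 i) from congrFun (nhds_discrete _) _, tendsto_pure] at h1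
    exact h1

lemma exists_mem_closure_tmul (x : CompletedTensor θ α) (i : CompletedTensorIndex S α) :
    ∃ y ∈ AddSubgroup.closure (Set.range fun p : S × M => tmul θ α p.1 p.2), y.1 i = x.1 i := by
  refine Level.induction i (p := fun t => ∃ y ∈ AddSubgroup.closure
    (Set.range fun p : S × M => tmul θ α p.1 p.2), y.1 i = t) (x.1 i) ⟨0, zero_mem _, rfl⟩
    (fun s m => ⟨_, AddSubgroup.subset_closure ⟨(s, m), rfl⟩, rfl⟩) ?_
  rintro _ _ ⟨y, hy, rfl⟩ ⟨z, hz, rfl⟩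
  exact ⟨y + z, add_mem hy hz, rfl⟩

/-- Two continuous additive maps on `S ⊗̂_R M` which agree on pure tensors are equal. -/
lemma eq_of_continuous {W : Type*} [AddCommGroup W] [Module A W] [TopologicalSpace W] [T2Space W]
    {f g : CompletedTensor θ α →ₗ[A] W} (hf : Continuous f) (hg : Continuous g)
    (h : ∀ s m, f (tmul θ α s m) = g (tmul θ α s m)) : f = g := by
  have hd : Dense (AddSubgroup.closure (Set.range fun p : S × M => tmul θ α p.1 p.2) :
      Set (CompletedTensor θ α)) := fun x => by
    rw [mem_closure_iff_nhds_basis (nhds_hasBasis x)]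
    exact fun i _ => exists_mem_closure_tmul x i
  refine LinearMap.ext fun x => congrFun (Continuous.ext_on hd hf hg fun y hy => ?_) x
  induction hy using AddSubgroup.closure_induction with
  | mem y hy =>
    obtain ⟨p, rfl⟩ := hy
    exact h p.1 p.2
  | zero => simp
  | add y z _ _ hy hz => simp [hy, hz]
  | neg y _ hy => simp [hy]

lemma continuous_act (s : S) : Continuous (act θ α s) := by
  refine continuous_iff_continuousAt.2 fun x =>
    ((nhds_hasBasis x).tendsto_iff (nhds_hasBasis _)).2 fun i _ => ⟨i, trivial, fun y hy => ?_⟩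
  exact congrArg (i.levelAct θ s) hy

lemma tmul_val (s : S) (m : M) (i : CompletedTensorIndex S α) :
    (tmul θ α s m).1 i = i.mkTmul θ s m := rfl

end CompletedTensor

end CompletedTensor

/-! ### The comparison map `A[[K]] ⊗̂ U^∨ → (Ind U)^∨` -/

section Comparison

open CompletedGroupAlgebra

variable {A : Type*} [CommRing A] [IsLocalRing A] {Γ : Type*} [Group Γ] [TopologicalSpace Γ]
  [IsTopologicalGroup Γ]

lemma CompletedGroupAlgebra.map_of {H H' : Type*} [Group H] [TopologicalSpace H] [Group H']
    [TopologicalSpace H'] (φ : H →* H') (hφ : Continuous φ) (h : H) :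
    CompletedGroupAlgebra.map A φ hφ (of A (MonoidAlgebra.single h 1)) =
      of A (MonoidAlgebra.single (φ h) 1) := by
  refine ext' fun N => ?_
  change MonoidAlgebra.mapDomainAlgHom A A
    (QuotientGroup.map (openNormalComap φ hφ N).toSubgroup N.toSubgroup φ le_rfl) ((of A (MonoidAlgebra.single h 1)).1
    (openNormalComap φ hφ N)) = _
  rw [of_val, of_val]
  simp
  rfl

lemma CompletedGroupAlgebra.continuous_map [TopologicalSpace A] [Fact (IsAdic (maximalIdeal A))]
    {H H' : Type*} [Group H]
    [TopologicalSpace H] [IsTopologicalGroup H] [CompactSpace H] [Group H'] [TopologicalSpace H']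
    [IsTopologicalGroup H'] [CompactSpace H'] (φ : H →* H') (hφ : Continuous φ) :
    Continuous (CompletedGroupAlgebra.map A φ hφ) := by
  refine continuous_iff_continuousAt.2 fun μ =>
    ((nhds_hasBasis μ).tendsto_iff (nhds_hasBasis _)).2 ?_
  rintro ⟨N, n⟩ -
  refine ⟨(openNormalComap φ hφ N, n), trivial, fun ν hν => ?_⟩
  rw [Set.mem_ofPred_eq, ← map_sub]
  intro c
  exact MonoidAlgebra.map_mem_of_mem_coeffIdeal (Finsupp.lapply c ∘ₗ
    (MonoidAlgebra.coeffLinearEquiv A).toLinearMap ∘ₗ (MonoidAlgebra.mapDomainAlgHom A A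
        (QuotientGroup.map (openNormalComap φ hφ N).toSubgroup N.toSubgroup φ
          le_rfl)).toLinearMap) (mem_levelIdeal.1 hν)

/-- The data from which the comparison map is constructed: `Γ = P K` with `K` open, the orbit maps
of `ρ` are continuous, and `retr` is a continuous `P`-equivariant retraction of `Γ` onto `P`. -/
structure InductionDatum {P : Subgroup Γ} (K : Subgroup Γ) {U : Type*} [AddCommGroup U] [Module A U]
    (ρ : Representation A P U) where
  isOpen : IsOpen (K : Set Γ)
  exists_mul : ∀ g : Γ, ∃ q ∈ P, ∃ k ∈ K, g = q * k
  orbits : HasContinuousOrbits A ρ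
  /-- an equivariant retraction onto `P` -/
  retr : Γ → P
  continuous_retr : Continuous retr
  retr_mul : ∀ (q : P) (g : Γ), retr (q * g) = q * retr g

variable [IsNoetherianRing A] [IsAdicComplete (maximalIdeal A) A]
  [TopologicalSpace A] [hA : Fact (IsAdic (maximalIdeal A))]
  {P K : Subgroup Γ} [CompactSpace K] [TotallyDisconnectedSpace K] [CompactSpace ↥(P ⊓ K)]
  [TotallyDisconnectedSpace ↥(P ⊓ K)]
  {U : Type*} [AddCommGroup U] [Module A U] [IsAdicComplete (maximalIdeal A) U]
  {ρ : Representation A P U}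

/-- Evaluation at `1` as a map `U^∨ → (Ind U)^∨`. -/
def evalOne (ρ : Representation A P U) : Module.Dual A U →ₗ[A] Module.Dual A (contInd ρ) :=
  (LinearMap.proj 1 ∘ₗ (contInd ρ).subtype).dualMap

namespace InductionDatum

variable (D : InductionDatum K ρ)

include D in
lemma smooth : IsAdicallySmooth
    (ρ.comp (Subgroup.inclusion (inf_le_left : P ⊓ K ≤ P)) : Representation A ↥(P ⊓ K) U) :=
  (D.orbits.comp (continuous_inclusion (inf_le_left : P ⊓ K ≤ P))).isAdicallySmooth

include D in
lemma smooth_ind : IsAdicallySmooth ((contIndRep ρ).comp K.subtype) :=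
  isAdicallySmooth_contIndRep D.exists_mul D.orbits D.continuous_retr D.retr_mul

/-- The action of `A[[P ∩ K]]` on `U^∨`. -/
def α : CompletedGroupAlgebra A ↥(P ⊓ K) →ₐ[A] Module.End A (Module.Dual A U) := dualAct D.smooth

/-- The action of `A[[K]]` on `(Ind U)^∨`. -/
def β : CompletedGroupAlgebra A K →ₐ[A] Module.End A (Module.Dual A (contInd ρ)) :=
  dualAct D.smooth_ind

lemma isCompletedAction_α : IsCompletedAction (dualResRep K ρ) D.α := by
  have : dualResRep K ρ = Representation.dual
      (ρ.comp (Subgroup.inclusion (inf_le_left : P ⊓ K ≤ P)) : Representation A ↥(P ⊓ K) U) := by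
    ext h ℓ x
    rfl
  rw [this]
  exact isCompletedAction_dualAct D.smooth

lemma isCompletedAction_β : IsCompletedAction ((contIndRep ρ).dual.comp K.subtype) D.β := by
  have : (contIndRep ρ).dual.comp K.subtype =
      Representation.dual ((contIndRep ρ).comp K.subtype) := by
    ext h ℓ x
    rfl
  rw [this]
  exact isCompletedAction_dualAct D.smooth_ind

/-- The pairing `(μ, ℓ) ↦ μ · ev_ℓ`. -/
def pair : CompletedGroupAlgebra A K →ₗ[A] Module.Dual A U →ₗ[A] Module.Dual A (contInd ρ) :=
  LinearMap.mk₂ A (fun μ ℓ => D.β μ (evalOne ρ ℓ)) (fun μ ν ℓ => by rw [map_add]; rfl)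
    (fun a μ ℓ => by rw [map_smul]; rfl) (fun μ ℓ ℓ' => by rw [map_add, map_add])
    (fun a μ ℓ => by rw [map_smul, map_smul])

lemma pair_apply (μ : CompletedGroupAlgebra A K) (ℓ : Module.Dual A U) :
    D.pair μ ℓ = D.β μ (evalOne ρ ℓ) := rfl

lemma pair_mul (μ ν : CompletedGroupAlgebra A K) (ℓ : Module.Dual A U) :
    D.pair (μ * ν) ℓ = D.β μ (D.pair ν ℓ) := by
  rw [pair_apply, map_mul]
  rfl

lemma continuous_pair_left (ℓ : Module.Dual A U) : Continuous fun μ => D.pair μ ℓ :=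
  continuous_dualAct_left D.smooth_ind (evalOne ρ ℓ)

lemma β_single (k : K) : D.β (of A (MonoidAlgebra.single k 1)) = (contIndRep ρ).dual (k : Γ) :=
  D.isCompletedAction_β.extends_rep k

lemma pair_single (k : K) (ℓ : Module.Dual A U) (f : contInd ρ) :
    D.pair (of A (MonoidAlgebra.single k 1)) ℓ f = ℓ (f.1 (k : Γ)⁻¹) := by
  rw [pair_apply, β_single]
  change ℓ ((contIndRep ρ (k : Γ)⁻¹ f).1 1) = _
  rw [contIndRep_apply, one_mul]

lemma completedInclusion_single (h : ↥(P ⊓ K)) :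
    completedInclusion A P K (of A (MonoidAlgebra.single h 1)) =
      of A (MonoidAlgebra.single (Subgroup.inclusion inf_le_right h) 1) :=
  map_of _ _ h

lemma pair_completedInclusion (r : CompletedGroupAlgebra A ↥(P ⊓ K)) (ℓ : Module.Dual A U) :
    D.pair (completedInclusion A P K r) ℓ = evalOne ρ (D.α r ℓ) := by
  let f : CompletedGroupAlgebra A ↥(P ⊓ K) →ₗ[A] Module.Dual A (contInd ρ) :=
    D.pair.flip ℓ ∘ₗ (completedInclusion A P K).toLinearMap
  let g : CompletedGroupAlgebra A ↥(P ⊓ K) →ₗ[A] Module.Dual A (contInd ρ) :=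
    evalOne ρ ∘ₗ LinearMap.applyₗ ℓ ∘ₗ D.α.toLinearMap
  have hf : Continuous f := (D.continuous_pair_left ℓ).comp (continuous_map _ _)
  have hg : Continuous g := by
    refine continuous_induced_rng.2 (continuous_pi fun x => ?_)
    exact (continuous_dual_apply (A := A) (x.1 1)).comp (continuous_dualAct_left D.smooth ℓ)
  refine LinearMap.congr_fun (CompletedGroupAlgebra.eq_of_continuous hf hg fun h => ?_) r
  change D.pair (completedInclusion A P K _) ℓ = evalOne ρ (D.α _ ℓ)
  rw [completedInclusion_single]
  ext x
  rw [pair_single, D.isCompletedAction_α.extends_rep]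
  change ℓ (x.1 (h : Γ)⁻¹) = ℓ (ρ _ (x.1 1))
  rw [← contInd_apply_mul, mul_one]
  rfl

lemma pair_balanced (μ : CompletedGroupAlgebra A K) (r : CompletedGroupAlgebra A ↥(P ⊓ K))
    (ℓ : Module.Dual A U) :
    D.pair (μ * completedInclusion A P K r) ℓ = D.pair μ (D.α r ℓ) := by
  rw [pair_mul, pair_completedInclusion]
  rfl

lemma pair_mem_of_levelIdeal {f : contInd ρ} {n : ℕ} {N : OpenNormalSubgroup K}
    (hN : ∀ x, ∀ u ∈ N, f.1 (x * u) - f.1 x ∈ (maximalIdeal A ^ n • ⊤ : Submodule A U))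
    {μ : CompletedGroupAlgebra A K} (hμ : μ ∈ levelIdeal A N n) (ℓ : Module.Dual A U) :
    D.pair μ ℓ f ∈ maximalIdeal A ^ n := by
  have h1 : ∀ u ∈ N, ((contIndRep ρ).comp K.subtype) u f - f ∈
      (maximalIdeal A ^ n • ⊤ : Submodule A (contInd ρ)) := fun u hu =>
    contInd_mem_pow_smul D.orbits D.continuous_retr D.retr_mul fun x => hN x u hu
  have h2 := integral_sub_levelSum_mem (orbitFun D.smooth_ind (evalOne ρ ℓ) f)
    (fun h u hu => invariant_of_smooth h1 (evalOne ρ ℓ) h hu) μ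
  have h3 := MonoidAlgebra.map_mem_of_mem_coeffIdeal
    (levelSum N (orbitFun D.smooth_ind (evalOne ρ ℓ) f)) (mem_levelIdeal.1 hμ)
  have h4 := add_mem h2 h3
  rw [sub_add_cancel] at h4
  exact h4

lemma pair_mem_of_forall {f : contInd ρ} {n : ℕ} {ℓ : Module.Dual A U}
    (h : ∀ k : K, ℓ (f.1 k) ∈ maximalIdeal A ^ n) (μ : CompletedGroupAlgebra A K) :
    D.pair μ ℓ f ∈ maximalIdeal A ^ n := by
  refine dualAct_mem D.smooth_ind (fun k => ?_) μ
  change ℓ (f.1 (1 * k)) ∈ _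
  rw [one_mul]
  exact h k

/-! #### Evaluation on the finite levels -/

/-- The completed tensor product `A[[K]] ⊗̂ U^∨`. -/
abbrev Tensor : Type _ := CompletedTensor (completedInclusion A P K) D.α

/-- The indices of the finite levels of `A[[K]] ⊗̂ U^∨`. -/
abbrev Index : Type _ := CompletedTensorIndex (CompletedGroupAlgebra A K) D.α

/-- The pairing with `f` modulo `𝔪_A^n` factors through the level `i`. -/
structure IsGood (i : D.Index) (f : contInd ρ) (n : ℕ) : Prop where
  left : ∀ μ ∈ i.J, ∀ ℓ, D.pair μ ℓ f ∈ maximalIdeal A ^ n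
  right : ∀ μ, ∀ ℓ ∈ i.N, D.pair μ ℓ f ∈ maximalIdeal A ^ n

variable {D}

lemma IsGood.mono {i j : D.Index} {f : contInd ρ} {n : ℕ} (h : D.IsGood j f n) (hJ : i.J ≤ j.J)
    (hN : i.N ≤ j.N) : D.IsGood i f n :=
  ⟨fun μ hμ => h.left μ (hJ hμ), fun μ ℓ hℓ => h.right μ ℓ (hN hℓ)⟩

lemma IsGood.anti {i : D.Index} {f : contInd ρ} {m n : ℕ} (h : D.IsGood i f n) (hmn : m ≤ n) :
    D.IsGood i f m :=
  ⟨fun μ hμ ℓ => Ideal.pow_le_pow_right hmn (h.left μ hμ ℓ),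
    fun μ ℓ hℓ => Ideal.pow_le_pow_right hmn (h.right μ ℓ hℓ)⟩

/-- The pairing with `f` modulo `𝔪_A^n` on the level `i`. -/
def levelEval {i : D.Index} {f : contInd ρ} {n : ℕ} (h : D.IsGood i f n) :
    i.Level (completedInclusion A P K) →ₗ[A] A ⧸ (maximalIdeal A ^ n • ⊤ : Submodule A A) :=
  let π : A →ₗ[A] A ⧸ (maximalIdeal A ^ n • ⊤ : Submodule A A) := Submodule.mkQ _
  have hz : ∀ {a : A}, a ∈ maximalIdeal A ^ n → π a = 0 := fun {a} ha =>
    (Submodule.Quotient.mk_eq_zero _).2 (by rwa [pow_smul_top_self])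
  let b : (CompletedGroupAlgebra A K ⧸ i.J) →ₗ[A] (Module.Dual A U ⧸ i.N) →ₗ[A]
      A ⧸ (maximalIdeal A ^ n • ⊤ : Submodule A A) :=
    i.J.liftQ
      { toFun := fun μ => i.N.liftQ
          (π ∘ₗ Module.Dual.eval A (contInd ρ) f ∘ₗ D.pair μ)
          fun ℓ hℓ => hz (h.right μ ℓ hℓ)
        map_add' := fun μ ν => by
          ext ℓ
          change π (D.pair (μ + ν) ℓ f) = π (D.pair μ ℓ f) + π (D.pair ν ℓ f)
          rw [map_add, LinearMap.add_apply, LinearMap.add_apply, map_add]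
        map_smul' := fun a μ => by
          ext ℓ
          change π (D.pair (a • μ) ℓ f) = a • π (D.pair μ ℓ f)
          rw [map_smul, LinearMap.smul_apply, LinearMap.smul_apply, map_smul] }
      (fun μ hμ => by
        ext ℓ
        exact hz (h.left μ hμ ℓ))
  Submodule.liftQ _ (TensorProduct.lift b) (by
    rw [Submodule.span_le]
    rintro _ ⟨r, x, y, rfl⟩
    obtain ⟨μ, rfl⟩ := Submodule.Quotient.mk_surjective _ x
    obtain ⟨ℓ, rfl⟩ := Submodule.Quotient.mk_surjective _ y
    change TensorProduct.lift b _ = 0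
    rw [map_sub, TensorProduct.lift.tmul, TensorProduct.lift.tmul, sub_eq_zero]
    change π (D.pair (μ * completedInclusion A P K r) ℓ f) = π (D.pair μ (D.α r ℓ) f)
    rw [pair_balanced])

lemma levelEval_mkTmul {i : D.Index} {f : contInd ρ} {n : ℕ} (h : D.IsGood i f n)
    (μ : CompletedGroupAlgebra A K) (ℓ : Module.Dual A U) :
    levelEval h (i.mkTmul _ μ ℓ) = Submodule.Quotient.mk (D.pair μ ℓ f) := rfl

lemma levelEval_transition {i j : D.Index} (hJ : i.J ≤ j.J) (hN : i.N ≤ j.N) {f : contInd ρ} {n : ℕ}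
    (hi : D.IsGood i f n) (h : D.IsGood j f n) (t : i.Level (completedInclusion A P K)) :
    levelEval h (CompletedTensorIndex.transition _ hJ hN t) = levelEval hi t := by
  refine CompletedTensorIndex.Level.induction i (p := fun t =>
    levelEval h (CompletedTensorIndex.transition _ hJ hN t) = levelEval hi t) t ?_ ?_ ?_
  · simp
  · exact fun _ _ => rfl
  · intro s t hs ht
    rw [map_add, map_add, map_add, hs, ht]

lemma levelEval_factorPow {i : D.Index} {f : contInd ρ} {m n : ℕ} (hmn : m ≤ n)
    (h : D.IsGood i f n) (t : i.Level (completedInclusion A P K)) :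
    Submodule.factorPow (maximalIdeal A) A hmn (levelEval h t) = levelEval (h.anti hmn) t := by
  refine CompletedTensorIndex.Level.induction i (p := fun t =>
    Submodule.factorPow (maximalIdeal A) A hmn (levelEval h t) = levelEval (h.anti hmn) t) t ?_ ?_ ?_
  · simp
  · exact fun _ _ => rfl
  · intro s t hs ht
    rw [map_add, map_add, map_add, hs, ht]

lemma levelEval_eq {i j : D.Index} {f : contInd ρ} {n : ℕ} (hi : D.IsGood i f n)
    (hj : D.IsGood j f n) (x : D.Tensor) : levelEval hi (x.1 i) = levelEval hj (x.1 j) := by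
  have h1 : (i.inf j).J ≤ i.J := inf_le_left
  have h2 : (i.inf j).N ≤ i.N := inf_le_left
  have h3 : (i.inf j).J ≤ j.J := inf_le_right
  have h4 : (i.inf j).N ≤ j.N := inf_le_right
  have hk : D.IsGood (i.inf j) f n := hi.mono h1 h2
  exact (congrArg (levelEval hi) (x.2 (i.inf j) i h1 h2).symm).trans
    ((levelEval_transition h1 h2 hk hi _).trans ((levelEval_transition h3 h4 hk hj _).symm.trans
      (congrArg (levelEval hj) (x.2 (i.inf j) j h3 h4))))

variable (D)

/-- The index given by an open normal subgroup `N` of `K`, a number `n` and a finite set of vectors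
modulo `𝔪_A^n`. -/
def mkIndex (N : OpenNormalSubgroup K) (n : ℕ) (W : Set U) (hW : W.Finite) : D.Index where
  J := levelIdeal A N n
  J_open := isOpen_levelIdeal N n
  J_left s _ hx := mul_mem_levelIdeal s hx
  J_right s _ hx := mul_mem_levelIdeal' s hx
  N :=
    { carrier := {ℓ | ∀ w ∈ W, ∀ q : ↥(P ⊓ K), ℓ (ρ (Subgroup.inclusion inf_le_left q) w) ∈
        maximalIdeal A ^ n}
      add_mem' := fun h h' w hw q => add_mem (h w hw q) (h' w hw q)
      zero_mem' := fun w hw q => zero_mem _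
      smul_mem' := fun a ℓ h w hw q => Ideal.mul_mem_left _ a (h w hw q) }
  N_open := by
    have h : ∀ w : U, ∃ S : Set U, S.Finite ∧ ∀ ℓ : Module.Dual A U, (∀ q : ↥(P ⊓ K),
        ℓ (ρ (Subgroup.inclusion inf_le_left q) w) ∈ maximalIdeal A ^ n) ↔
          ∀ v ∈ S, ℓ v ∈ maximalIdeal A ^ n := fun w => by
      obtain ⟨N', hN'⟩ := D.smooth n w
      have hfin : Finite (↥(P ⊓ K) ⧸ N'.toSubgroup) :=
        N'.toOpenSubgroup.toSubgroup.quotient_finite_of_isOpen N'.isOpen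
      refine ⟨Set.range fun c : ↥(P ⊓ K) ⧸ N'.toSubgroup =>
        ρ (Subgroup.inclusion inf_le_left c.out) w, Set.finite_range _, fun ℓ =>
          ⟨fun h => Set.forall_mem_range.2 fun c => h _, fun h q => ?_⟩⟩
      obtain ⟨u, hu⟩ := QuotientGroup.mk_out_eq_mul N'.toSubgroup q
      have h1 := h _ ⟨(q : ↥(P ⊓ K) ⧸ N'.toSubgroup), rfl⟩
      have h2 := LinearMap.map_mem_pow (ℓ ∘ₗ ρ (Subgroup.inclusion inf_le_left q)) (hN' u u.2)
      dsimp only at h1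
      rw [hu, map_mul, map_mul, Module.End.mul_apply] at h1
      have h3 := sub_mem h1 h2
      rw [map_sub] at h3
      simpa using h3
    choose S hS hS' using h
    have hopen : ∀ v : U, IsOpen {ℓ : Module.Dual A U | ℓ v ∈ maximalIdeal A ^ n} := fun v =>
      (isOpen_pow_maximalIdeal (A := A) n).preimage (continuous_dual_apply v)
    have := (hW.biUnion fun w _ => hS w).isOpen_biInter fun v _ => hopen v
    convert this using 1
    ext ℓ
    simp only [Set.mem_iInter, Set.mem_iUnion, Set.mem_ofPred_eq]
    exact ⟨fun h v ⟨w, hw, hv⟩ => (hS' w ℓ).1 (h w hw) v hv,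
      fun h w hw => (hS' w ℓ).2 fun v hv => h v ⟨w, hw, hv⟩⟩
  N_smul r ℓ hℓ w hw q := by
    refine dualAct_mem D.smooth (fun h => ?_) r
    have := hℓ w hw (h * q)
    rw [map_mul, map_mul] at this
    exact this

lemma isGood_mkIndex {N : OpenNormalSubgroup K} {n : ℕ} {W : Set U} (hW : W.Finite)
    {f : contInd ρ} (hN : ∀ x, ∀ u ∈ N, f.1 (x * u) - f.1 x ∈
      (maximalIdeal A ^ n • ⊤ : Submodule A U))
    (hfW : ∀ k : K, f.1 k ∈ (maximalIdeal A ^ n • ⊤ : Submodule A U) ∨ ∃ w ∈ W, ∃ q : ↥(P ⊓ K),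
      f.1 k - ρ (Subgroup.inclusion inf_le_left q) w ∈
        (maximalIdeal A ^ n • ⊤ : Submodule A U)) :
    D.IsGood (D.mkIndex N n W hW) f n where
  left μ hμ ℓ := D.pair_mem_of_levelIdeal hN hμ ℓ
  right μ ℓ hℓ := by
    refine D.pair_mem_of_forall (fun k => ?_) μ
    rcases hfW k with h | ⟨w, hw, q, h⟩
    · exact LinearMap.map_mem_pow ℓ h
    · have h1 := add_mem (LinearMap.map_mem_pow ℓ h) (hℓ w hw q)
      rw [map_sub, sub_add_cancel] at h1
      exact h1

lemma exists_isGood (f : contInd ρ) (n : ℕ) : ∃ i, D.IsGood i f n := by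
  obtain ⟨N, hN⟩ := contInd_exists_invariant D.exists_mul f n
  have hfin : Finite (K ⧸ N.toSubgroup) :=
    N.toOpenSubgroup.toSubgroup.quotient_finite_of_isOpen N.isOpen
  refine ⟨_, D.isGood_mkIndex (Set.finite_range fun c : K ⧸ N.toSubgroup =>
    f.1 (Quotient.out c : K)) hN fun k => Or.inr ⟨_, ⟨(k : K ⧸ N.toSubgroup), rfl⟩, 1, ?_⟩⟩
  obtain ⟨u, hu⟩ := QuotientGroup.mk_out_eq_mul N.toSubgroup k
  dsimp only
  rw [hu, map_one, map_one, Module.End.one_apply, ← neg_sub]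
  exact neg_mem (hN k u u.2)

/-- An index at which the pairing with `f` modulo `𝔪_A^n` can be evaluated. -/
def goodIndex (f : contInd ρ) (n : ℕ) : D.Index := (D.exists_isGood f n).choose

lemma isGood_goodIndex (f : contInd ρ) (n : ℕ) : D.IsGood (D.goodIndex f n) f n :=
  (D.exists_isGood f n).choose_spec

/-- The projection to a finite level. -/
def projLevel (i : D.Index) : D.Tensor →ₗ[A] i.Level (completedInclusion A P K) :=
  LinearMap.proj i ∘ₗ (completedTensorSubmodule (completedInclusion A P K) D.α).subtype

lemma evalAt_compat (f : contInd ρ) {m n : ℕ} (hmn : m ≤ n) :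
    Submodule.factorPow (maximalIdeal A) A hmn ∘ₗ
      (levelEval (D.isGood_goodIndex f n) ∘ₗ D.projLevel (D.goodIndex f n)) =
    levelEval (D.isGood_goodIndex f m) ∘ₗ D.projLevel (D.goodIndex f m) := by
  refine LinearMap.ext fun x => ?_
  exact (levelEval_factorPow hmn (D.isGood_goodIndex f n) _).trans
    (levelEval_eq ((D.isGood_goodIndex f n).anti hmn) (D.isGood_goodIndex f m) x)

/-- The pairing of `A[[K]] ⊗̂ U^∨` with a fixed element of the induction. -/
def evalAt (f : contInd ρ) : D.Tensor →ₗ[A] A :=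
  IsAdicComplete.lift (maximalIdeal A) (fun n => levelEval (D.isGood_goodIndex f n) ∘ₗ
    D.projLevel (D.goodIndex f n)) (D.evalAt_compat f)

lemma mk_evalAt {i : D.Index} {f : contInd ρ} {n : ℕ} (hi : D.IsGood i f n) (x : D.Tensor) :
    (Submodule.Quotient.mk (D.evalAt f x) : A ⧸ (maximalIdeal A ^ n • ⊤ : Submodule A A)) =
      levelEval hi (x.1 i) :=
  (IsAdicComplete.mk_lift (I := maximalIdeal A) (D.evalAt_compat f) n x).trans
    (levelEval_eq (D.isGood_goodIndex f n) hi x)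

lemma evalAt_tmul (f : contInd ρ) (μ : CompletedGroupAlgebra A K) (ℓ : Module.Dual A U) :
    D.evalAt f (CompletedTensor.tmul _ _ μ ℓ) = D.pair μ ℓ f := by
  refine eq_of_forall_sub_mem (A := A) A fun n => ?_
  rw [← Submodule.Quotient.eq, D.mk_evalAt (D.isGood_goodIndex f n), CompletedTensor.tmul_val,
    levelEval_mkTmul]

lemma continuous_evalAt (f : contInd ρ) : Continuous (D.evalAt f) := by
  refine continuous_iff_adic.2 fun n x => ?_
  refine (CompletedTensor.nhds_hasBasis x).mem_iff.2 ⟨D.goodIndex f n, trivial, fun y hy => ?_⟩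
  rw [Set.mem_ofPred_eq] at hy ⊢
  rw [← pow_smul_top_self, ← Submodule.Quotient.eq, D.mk_evalAt (D.isGood_goodIndex f n),
    D.mk_evalAt (D.isGood_goodIndex f n), hy]

/-- The comparison map `A[[K]] ⊗̂ U^∨ → (Ind U)^∨`. -/
def comparison : D.Tensor →ₗ[A] Module.Dual A (contInd ρ) where
  toFun x :=
    { toFun := fun f => D.evalAt f x
      map_add' := fun f f' => by
        have h : D.evalAt (f + f') = D.evalAt f + D.evalAt f' :=
          CompletedTensor.eq_of_continuous (D.continuous_evalAt _)
            ((D.continuous_evalAt f).add (D.continuous_evalAt f')) fun μ ℓ => by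
              rw [LinearMap.add_apply, evalAt_tmul, evalAt_tmul, evalAt_tmul, map_add]
        rw [h]
        rfl
      map_smul' := fun a f => by
        have h : D.evalAt (a • f) = a • D.evalAt f :=
          CompletedTensor.eq_of_continuous (D.continuous_evalAt _)
            ((D.continuous_evalAt f).const_smul a) fun μ ℓ => by
              rw [LinearMap.smul_apply, evalAt_tmul, evalAt_tmul, map_smul]
        rw [h]
        rfl }
  map_add' x y := by
    ext f
    exact map_add (D.evalAt f) x y
  map_smul' a x := by
    ext f
    exact map_smul (D.evalAt f) a x

lemma comparison_tmul (μ : CompletedGroupAlgebra A K) (ℓ : Module.Dual A U) :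
    D.comparison (CompletedTensor.tmul _ _ μ ℓ) = D.pair μ ℓ :=
  LinearMap.ext fun f => D.evalAt_tmul f μ ℓ

lemma continuous_comparison : Continuous D.comparison :=
  continuous_induced_rng.2 (continuous_pi fun f => D.continuous_evalAt f)

lemma continuous_β (μ : CompletedGroupAlgebra A K) :
    Continuous fun ℓ : Module.Dual A (contInd ρ) => D.β μ ℓ :=
  Continuous.comp (g := fun x : CompletedGroupAlgebra A K × Module.Dual A (contInd ρ) =>
    D.β x.1 x.2) (f := fun ℓ => (μ, ℓ)) D.isCompletedAction_β.continuous (by fun_prop)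

lemma comparison_act (μ : CompletedGroupAlgebra A K) (x : D.Tensor) :
    D.comparison (CompletedTensor.act _ _ μ x) = D.β μ (D.comparison x) := by
  let T : D.Tensor →ₗ[A] D.Tensor := CompletedTensor.act _ _ μ
  have hT : Continuous T := CompletedTensor.continuous_act μ
  let f : D.Tensor →ₗ[A] Module.Dual A (contInd ρ) := D.comparison ∘ₗ T
  let g : D.Tensor →ₗ[A] Module.Dual A (contInd ρ) := D.β μ ∘ₗ D.comparison
  have h1 : Continuous f := D.continuous_comparison.comp hT
  have h2 : Continuous g := (D.continuous_β μ).comp D.continuous_comparison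
  have h3 : f = g := CompletedTensor.eq_of_continuous h1 h2 fun ν ℓ => by
    change D.comparison (CompletedTensor.tmul _ _ (μ * ν) ℓ) = D.β μ (D.comparison _)
    rw [comparison_tmul, comparison_tmul, pair_mul]
  exact LinearMap.congr_fun h3 x

end InductionDatum

end Comparison

/-! ### The comparison map is a topological isomorphism -/

lemma exists_subset_of_mem_nhds_dual {A X : Type*} [CommRing A] [IsLocalRing A] [TopologicalSpace A]
    [hA : Fact (IsAdic (maximalIdeal A))] [AddCommGroup X] [Module A X] {ℓ : Module.Dual A X}
    {s : Set (Module.Dual A X)} (hs : s ∈ 𝓝 ℓ) : ∃ (S : Set X) (n : ℕ), S.Finite ∧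
      ∀ ℓ' : Module.Dual A X, (∀ x ∈ S, ℓ' x - ℓ x ∈ maximalIdeal A ^ n) → ℓ' ∈ s := by
  have h : Topology.IsInducing fun (ℓ : Module.Dual A X) (x : X) => ℓ x := ⟨rfl⟩
  rw [h.nhds_eq_comap, mem_comap] at hs
  obtain ⟨t, ht, hts⟩ := hs
  rw [nhds_pi, Filter.mem_pi] at ht
  obtain ⟨I, hI, T, hT, hIT⟩ := ht
  choose n hn hn' using fun x => (nhds_hasBasis_adic (ℓ x)).mem_iff.1 (hT x)
  refine ⟨I, hI.toFinset.sup n, hI, fun ℓ' h' => hts (hIT fun x hx => hn' x ?_)⟩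
  exact Ideal.pow_le_pow_right (Finset.le_sup (hI.mem_toFinset.2 hx)) (h' x hx)

section Comparison

open CompletedGroupAlgebra

variable {A : Type*} [CommRing A] [IsLocalRing A] {Γ : Type*} [Group Γ] [TopologicalSpace Γ]
  [IsTopologicalGroup Γ]  {P K : Subgroup Γ}

/-- The quotient of `K` by `(P ∩ K) N`. -/
abbrev LevelCoset (P : Subgroup Γ) (N : OpenNormalSubgroup K) : Type _ :=
  K ⧸ (P.subgroupOf K ⊔ N.toSubgroup)

instance [CompactSpace K] (N : OpenNormalSubgroup K) : Finite (LevelCoset P N) :=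
  Subgroup.quotient_finite_of_isOpen _
    (Subgroup.isOpen_mono (le_sup_right : N.toSubgroup ≤ P.subgroupOf K ⊔ N.toSubgroup) N.isOpen)

lemma exists_eq_out_mul (N : OpenNormalSubgroup K) (k : K) : ∃ q : ↥(P ⊓ K), ∃ u ∈ N,
    k = (Quotient.out (k : LevelCoset P N) : K) * Subgroup.inclusion inf_le_right q * u := by
  obtain ⟨⟨h, hh⟩, hk⟩ := QuotientGroup.mk_out_eq_mul (P.subgroupOf K ⊔ N.toSubgroup) k
  have hh' := inv_mem hh
  rw [← SetLike.mem_coe, Subgroup.mul_normal] at hh'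
  obtain ⟨q, hq, u, hu, hqu⟩ := hh'
  refine ⟨⟨q, hq, q.2⟩, u, hu, ?_⟩
  have h1 : (Subgroup.inclusion inf_le_right (⟨q, hq, q.2⟩ : ↥(P ⊓ K)) : K) = q := rfl
  rw [hk, h1, mul_assoc]
  change k = k * h * (q * u)
  rw [show q * u = h⁻¹ from hqu, mul_inv_cancel_right]

lemma exists_mem_doubleCoset (hPK : ∀ g : Γ, ∃ q ∈ P, ∃ k ∈ K, g = q * k)
    (N : OpenNormalSubgroup K) (x : Γ) : ∃ c : LevelCoset P N, x ∈ doubleCoset P c.out N := by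
  obtain ⟨q, hq, k, hk, rfl⟩ := hPK x
  obtain ⟨p, u, hu, h⟩ := exists_eq_out_mul (P := P) N (⟨k, hk⟩⁻¹ : K)
  set c : K := Quotient.out ((⟨k, hk⟩⁻¹ : K) : LevelCoset P N)
  set b : K := c * Subgroup.inclusion inf_le_right p
  refine ⟨((⟨k, hk⟩⁻¹ : K) : LevelCoset P N), ⟨q, hq⟩ * (Subgroup.inclusion inf_le_left p)⁻¹,
    b * u⁻¹ * b⁻¹, N.isNormal'.conj_mem _ (inv_mem hu) _, ?_⟩
  have h' : k = ((b * u : K) : Γ)⁻¹ := by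
    rw [← h]
    simp
  have hb : (b : Γ) = c * p := rfl
  refine (congrArg (q * ·) h').trans ?_
  change q * ((b * u : K) : Γ)⁻¹ = (q * (p : Γ)⁻¹) * (c : Γ)⁻¹ * ((b * u⁻¹ * b⁻¹ : K) : Γ)
  simp only [Subgroup.coe_mul, InvMemClass.coe_inv, hb, mul_inv_rev]
  group

lemma eq_of_mem_doubleCoset {N : OpenNormalSubgroup K} {x : Γ} {c c' : LevelCoset P N}
    (h : x ∈ doubleCoset P c.out N) (h' : x ∈ doubleCoset P c'.out N) : c = c' := by
  obtain ⟨q, u, hu, rfl⟩ := h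
  obtain ⟨q', u', hu', h⟩ := h'
  rw [← QuotientGroup.out_eq' c, ← QuotientGroup.out_eq' c', QuotientGroup.eq]
  generalize c.out = c at *
  generalize c'.out = c' at *
  have h1 : ((c⁻¹ * (u * u'⁻¹) * c * (c⁻¹ * c') : K) : Γ) = (q⁻¹ * q' : P) := by
    simp only [Subgroup.coe_mul, InvMemClass.coe_inv]
    have : (u : Γ) = (c : Γ) * (q : Γ)⁻¹ * (q' * (c' : Γ)⁻¹ * u') := by
      rw [← h]
      group
    rw [this]
    group
  have h2 : c⁻¹ * (u * u'⁻¹) * c * (c⁻¹ * c') ∈ P.subgroupOf K ⊔ N.toSubgroup :=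
    (le_sup_left : P.subgroupOf K ≤ _) (by
      rw [Subgroup.mem_subgroupOf, h1]
      exact SetLike.coe_mem _)
  have h3 : c⁻¹ * (u * u'⁻¹) * c ∈ P.subgroupOf K ⊔ N.toSubgroup :=
    (le_sup_right : N.toSubgroup ≤ _) (by
      have := N.isNormal'.conj_mem _ (N.toSubgroup.mul_mem hu (N.toSubgroup.inv_mem hu')) c⁻¹
      rwa [inv_inv] at this)
  exact (Subgroup.mul_mem_cancel_left _ h3).1 h2

lemma inv_mem_doubleCoset (c : K) (N : OpenNormalSubgroup K) : (c : Γ)⁻¹ ∈ doubleCoset P c N :=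
  ⟨1, 1, one_mem N, by simp⟩

variable {U : Type*} [AddCommGroup U] [Module A U] {ρ : Representation A P U}

/-- There are arbitrarily small open normal subgroups of `K` whose intersection with `P` fixes a
finite set of vectors modulo `𝔪_A^n`. -/
lemma HasContinuousOrbits.exists_fixing [CompactSpace K] [TotallyDisconnectedSpace K]
    (hρ : HasContinuousOrbits A ρ) {W : Set U} (hW : W.Finite) (n : ℕ) :
    ∃ N : OpenNormalSubgroup K, ∀ w ∈ W, ∀ u ∈ N, ∀ hu : (u : Γ) ∈ P,
      ρ ⟨u, hu⟩ w - w ∈ (maximalIdeal A ^ n • ⊤ : Submodule A U) := by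
  have h1 : ∀ w : U, ∀ᶠ u : K in 𝓝 1, ∀ hu : (u : Γ) ∈ P,
      ρ ⟨u, hu⟩ w - w ∈ (maximalIdeal A ^ n • ⊤ : Submodule A U) := fun w => by
    have h2 := hρ n w 1
    rw [nhds_subtype_eq_comap, eventually_comap] at h2
    filter_upwards [(continuous_subtype_val.tendsto (1 : K)).eventually h2] with u hu hu'
    have := hu ⟨u, hu'⟩ rfl
    rwa [map_one, Module.End.one_apply] at this
  obtain ⟨N, hN⟩ := exists_openNormalSubgroup_subset (hW.eventually_all.2 fun w _ => h1 w)
  exact ⟨N, fun w hw u hu => hN u hu w hw⟩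

variable [IsNoetherianRing A] [IsAdicComplete (maximalIdeal A) A]
  [TopologicalSpace A] [hA : Fact (IsAdic (maximalIdeal A))]
  [CompactSpace K] [TotallyDisconnectedSpace K] [CompactSpace ↥(P ⊓ K)]
  [TotallyDisconnectedSpace ↥(P ⊓ K)]
  [IsAdicComplete (maximalIdeal A) U]

namespace InductionDatum

variable (D : InductionDatum K ρ)

lemma exists_level_eq_sum {i : D.Index} {N : OpenNormalSubgroup K} {n : ℕ}
    (hi : levelIdeal A N n ≤ i.J) [Fintype (LevelCoset P N)]
    (t : i.Level (completedInclusion A P K)) : ∃ ℓ : LevelCoset P N → Module.Dual A U,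
      t = ∑ c, i.mkTmul _ (of A (MonoidAlgebra.single c.out 1)) (ℓ c) := by
  classical
  let Λ : (LevelCoset P N → Module.Dual A U) →ₗ[A] i.Level (completedInclusion A P K) :=
    ∑ c, CompletedTensorIndex.mkTmulₗ _ i (of A (MonoidAlgebra.single c.out 1)) ∘ₗ LinearMap.proj c
  have hΛ : ∀ ℓ, Λ ℓ = ∑ c, i.mkTmul _ (of A (MonoidAlgebra.single c.out 1)) (ℓ c) := fun ℓ => by
    rw [LinearMap.sum_apply]
    rfl
  suffices h : t ∈ LinearMap.range Λ by
    obtain ⟨ℓ, hℓ⟩ := h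
    exact ⟨ℓ, by rw [← hℓ, hΛ]⟩
  refine CompletedTensorIndex.Level.induction i (p := fun t => t ∈ LinearMap.range Λ) t
    (zero_mem _) (fun μ m => ?_) fun _ _ => add_mem
  obtain ⟨x, hx⟩ := exists_of_sub_mem_levelIdeal μ N n
  rw [← i.mkTmul_congr (hi hx) (m := m) (m' := m) (by rw [sub_self]; exact zero_mem _)]
  change CompletedTensorIndex.mkTmulₗ (completedInclusion A P K) i (of A x) m ∈ _
  clear hx
  induction x using MonoidAlgebra.induction_linear with
  | zero =>
    rw [map_zero, map_zero, LinearMap.zero_apply]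
    exact zero_mem _
  | add x y hx hy =>
    rw [map_add, map_add, LinearMap.add_apply]
    exact add_mem hx hy
  | single k a =>
    have h1 : (MonoidAlgebra.single k a : MonoidAlgebra A K) = a • MonoidAlgebra.single k 1 := by
      simp
    rw [h1, map_smul, map_smul, LinearMap.smul_apply]
    refine Submodule.smul_mem _ a ?_
    obtain ⟨q, u, hu, hk⟩ := exists_eq_out_mul (P := P) N k
    refine ⟨Pi.single (k : LevelCoset P N)
      (D.α (of A (MonoidAlgebra.single q 1)) m), ?_⟩
    rw [hΛ, Finset.sum_eq_single (k : LevelCoset P N), Pi.single_eq_same, ← i.mkTmul_mul,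
      completedInclusion_single, ← map_mul, MonoidAlgebra.single_mul_single, one_mul]
    · refine (i.mkTmul_congr (hi ?_) (by rw [sub_self]; exact zero_mem _)).symm
      have := of_single_sub_mem_levelIdeal (A := A) N n
        (h := (Quotient.out (k : LevelCoset P N) : K) * Subgroup.inclusion inf_le_right q) hu
      rw [← hk] at this
      exact this
    · intro c _ hc
      rw [Pi.single_eq_of_ne hc]
      exact map_zero (CompletedTensorIndex.mkTmulₗ (completedInclusion A P K) i _)
    · exact fun h => absurd (Finset.mem_univ _) h

lemma exists_mkIndex_le (i : D.Index) : ∃ (N : OpenNormalSubgroup K) (n : ℕ) (W : Set U)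
    (hW : W.Finite), (∀ w ∈ W, ∀ u ∈ N, ∀ hu : (u : Γ) ∈ P,
      ρ ⟨u, hu⟩ w - w ∈ (maximalIdeal A ^ n • ⊤ : Submodule A U)) ∧
      (D.mkIndex N n W hW).J ≤ i.J ∧ (D.mkIndex N n W hW).N ≤ i.N := by
  obtain ⟨N₁, n₁, h₁⟩ := exists_levelIdeal_subset (i.J_open.mem_nhds i.J.zero_mem)
  obtain ⟨W, n₂, hW, h₂⟩ := exists_subset_of_mem_nhds_dual (i.N_open.mem_nhds i.N.zero_mem)
  obtain ⟨N₂, h₃⟩ := D.orbits.exists_fixing (K := K) hW (max n₁ n₂)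
  refine ⟨N₁ ⊓ N₂, max n₁ n₂, W, hW, fun w hw u hu => h₃ w hw u hu.2,
    (levelIdeal_mono (inf_le_left : N₁ ⊓ N₂ ≤ N₁) (le_max_left _ _)).trans h₁, fun ℓ hℓ => h₂ ℓ fun w hw => ?_⟩
  have := hℓ w hw 1
  rw [map_one, map_one] at this
  rw [LinearMap.zero_apply, sub_zero]
  exact Ideal.pow_le_pow_right (le_max_right _ _) this

lemma exists_test_function {N : OpenNormalSubgroup K} {n : ℕ} {W : Set U} (hW : W.Finite)
    (hNW : ∀ w ∈ W, ∀ u ∈ N, ∀ hu : (u : Γ) ∈ P,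
      ρ ⟨u, hu⟩ w - w ∈ (maximalIdeal A ^ n • ⊤ : Submodule A U)) (c : LevelCoset P N) {w : U}
    (hw : w ∈ W) (q : ↥(P ⊓ K)) : ∃ f : contInd ρ, D.IsGood (D.mkIndex N n W hW) f n ∧
      f.1 (c.out : Γ)⁻¹ - ρ (Subgroup.inclusion inf_le_left q) w ∈
        (maximalIdeal A ^ n • ⊤ : Submodule A U) ∧
      ∀ c' ≠ c, f.1 (c'.out : Γ)⁻¹ ∈ (maximalIdeal A ^ n • ⊤ : Submodule A U) := by
  obtain ⟨f, hf1, hf2, hf3, hf4⟩ := exists_contInd_supported D.isOpen D.orbits D.continuous_retr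
    D.retr_mul c.out (ρ (Subgroup.inclusion inf_le_left q) w) (n := n) (N := N) fun u hu huP => by
      have h1 := hNW w hw ((Subgroup.inclusion inf_le_right q)⁻¹ * u *
        (Subgroup.inclusion inf_le_right q)) (by
          have := N.isNormal'.conj_mem u hu (Subgroup.inclusion inf_le_right q)⁻¹
          rwa [inv_inv] at this) (P.mul_mem (P.mul_mem (P.inv_mem q.2.1) huP) q.2.1)
      have h2 := (ρ (Subgroup.inclusion inf_le_left q)).map_mem_pow_smul h1
      rw [map_sub, ← Module.End.mul_apply, ← map_mul] at h2
      rw [← Module.End.mul_apply, ← map_mul]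
      convert h2 using 4
      ext
      simp [mul_assoc]
  refine ⟨f, D.isGood_mkIndex hW hf1 fun k => ?_, hf2, fun c' hc' => hf3 _ fun h =>
    hc' (eq_of_mem_doubleCoset (inv_mem_doubleCoset _ N) h)⟩
  by_cases hk : (k : Γ) ∈ doubleCoset P c.out N
  · obtain ⟨p, u, hu, h⟩ := hk
    have hp : (p : Γ) ∈ K := by
      have : (p : Γ) = (k * u⁻¹ * c.out : K) := by
        simp [h, mul_assoc]
      rw [this]
      exact SetLike.coe_mem _
    refine Or.inr ⟨w, hw, ⟨p, p.2, hp⟩ * q, ?_⟩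
    have := hf4 p u hu
    rw [← h] at this
    rw [map_mul, map_mul]
    exact this
  · exact Or.inl (hf3 _ hk)

lemma comparison_injective : Function.Injective D.comparison := by
  refine (injective_iff_map_eq_zero _).2 fun x hx => Subtype.ext (funext fun i => ?_)
  obtain ⟨N, n, W, hW, hNW, hJ, hN⟩ := D.exists_mkIndex_le i
  have := Fintype.ofFinite (LevelCoset P N)
  refine (x.2 _ i hJ hN).symm.trans ?_
  obtain ⟨ℓ, hℓ⟩ := D.exists_level_eq_sum (i := D.mkIndex N n W hW) (N := N) (n := n) le_rfl
    (x.1 (D.mkIndex N n W hW))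
  have key : ∀ c, ℓ c ∈ (D.mkIndex N n W hW).N := fun c w hw q => by
    obtain ⟨f, hf, hfc, hfc'⟩ := D.exists_test_function hW hNW c hw q
    have h1 := D.mk_evalAt hf x
    have h2 : D.evalAt f x = 0 := LinearMap.congr_fun hx f
    rw [h2, hℓ, map_sum, Finset.sum_eq_single c, levelEval_mkTmul, Submodule.Quotient.eq,
      zero_sub, neg_mem_iff, pow_smul_top_self, pair_single] at h1
    · have h3 := sub_mem h1 ((ℓ c).map_mem_pow hfc)
      rw [map_sub, sub_sub_cancel] at h3
      exact h3
    · intro c' _ hc'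
      rw [levelEval_mkTmul, pair_single, Submodule.Quotient.mk_eq_zero, pow_smul_top_self]
      exact (ℓ c').map_mem_pow (hfc' c' hc')
    · exact fun h => absurd (Finset.mem_univ _) h
  have h0 : x.1 (D.mkIndex N n W hW) = 0 := by
    rw [hℓ]
    refine Finset.sum_eq_zero fun c _ => ?_
    have h1 := (D.mkIndex N n W hW).mkTmul_congr (θ := completedInclusion A P K)
      (s := of A (MonoidAlgebra.single c.out 1)) (s' := of A (MonoidAlgebra.single c.out 1))
      (m := ℓ c) (m' := 0) (by rw [sub_self]; exact zero_mem _) (by rw [sub_zero]; exact key c)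
    exact h1.trans (map_zero (CompletedTensorIndex.mkTmulₗ (completedInclusion A P K) _ _))
  rw [h0]
  exact map_zero _

/-- The functional `v ↦ λ(f_{c,v})`, where `f_{c,v}` is supported on `P c⁻¹ N`, with value `v` at
`c⁻¹`. -/
def localFunctional (N : OpenNormalSubgroup K) (l : Module.Dual A (contInd ρ)) (c : K) :
    Module.Dual A U :=
  l ∘ₗ contIndIndicator D.isOpen D.orbits D.continuous_retr D.retr_mul c N ∘ₗ
    ρ (D.retr (c : Γ)⁻¹)⁻¹

lemma sum_localFunctional_sub_mem {N : OpenNormalSubgroup K} [Fintype (LevelCoset P N)] {n : ℕ}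
    {f : contInd ρ} (hN : ∀ x, ∀ u ∈ N, ρ (D.retr (x * u))⁻¹ (f.1 (x * u)) -
      ρ (D.retr x)⁻¹ (f.1 x) ∈ (maximalIdeal A ^ n • ⊤ : Submodule A U))
    (l : Module.Dual A (contInd ρ)) :
    ∑ c : LevelCoset P N, D.localFunctional N l c.out (f.1 (c.out : Γ)⁻¹) - l f ∈
      maximalIdeal A ^ n := by
  classical
  let F : LevelCoset P N → contInd ρ := fun c =>
    contIndIndicator D.isOpen D.orbits D.continuous_retr D.retr_mul c.out N
      (ρ (D.retr (c.out : Γ)⁻¹)⁻¹ (f.1 (c.out : Γ)⁻¹))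
  have h1 : ∑ c : LevelCoset P N, D.localFunctional N l c.out (f.1 (c.out : Γ)⁻¹) - l f =
      l (∑ c, F c - f) := by
    rw [map_sub, map_sum]
    rfl
  rw [h1]
  refine l.map_mem_pow (contInd_mem_pow_smul D.orbits D.continuous_retr D.retr_mul fun x => ?_)
  have h2 : (∑ c, F c - f).1 x = ∑ c, (F c).1 x - f.1 x := by
    change (∑ c, F c : contInd ρ).1 x - f.1 x = _
    have : (∑ c, F c : contInd ρ).1 = ∑ c, (F c).1 := by
      simp
    rw [this, Finset.sum_apply]
  obtain ⟨c, hc⟩ := exists_mem_doubleCoset D.exists_mul N x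
  rw [h2, Finset.sum_eq_single c]
  · rw [contIndIndicator_apply, Set.indicator_of_mem hc]
    obtain ⟨q, u, hu, rfl⟩ := hc
    have h3 := neg_mem (hN (q * (c.out : Γ)⁻¹) u hu)
    rw [neg_sub] at h3
    have h4 := (ρ (D.retr (q * (c.out : Γ)⁻¹ * u))).map_mem_pow_smul h3
    rw [map_sub, rho_apply_inv, contInd_apply_mul, D.retr_mul q, mul_inv_rev, map_mul ρ,
      Module.End.mul_apply, rho_inv_apply] at h4
    exact h4
  · intro c' _ hc'
    rw [contIndIndicator_apply, Set.indicator_of_notMem fun h => hc' (eq_of_mem_doubleCoset h hc),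
      map_zero]
  · exact fun h => absurd (Finset.mem_univ _) h

lemma exists_invariant_retr (f : contInd ρ) (n : ℕ) : ∃ N : OpenNormalSubgroup K,
    ∀ x, ∀ u ∈ N, ρ (D.retr (x * u))⁻¹ (f.1 (x * u)) - ρ (D.retr x)⁻¹ (f.1 x) ∈
      (maximalIdeal A ^ n • ⊤ : Submodule A U) := by
  refine exists_invariant_of_isLocallyConstMod (φ := fun x => ρ (D.retr x)⁻¹ (f.1 x)) D.exists_mul
    (D.orbits.isLocallyConstMod_smul D.continuous_retr.inv (contInd_isLocallyConstMod f n))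
    fun q x y h => ?_
  have h1 : ∀ x, ρ (D.retr (q * x))⁻¹ (f.1 (q * x)) = ρ (D.retr x)⁻¹ (f.1 x) := fun x => by
    rw [D.retr_mul, contInd_apply_mul, mul_inv_rev, map_mul ρ, Module.End.mul_apply, rho_inv_apply]
  rwa [h1, h1]

end InductionDatum

end Comparison

/-! ### Linear maps out of balanced tensor products -/

section BalancedTensor

variable {A : Type*} [CommRing A]

/-- The linear map on `X ⊗_R Y` induced by a balanced bilinear map. -/
def BalancedTensor.lift {X Y R W : Type*} [AddCommGroup X] [Module A X] [AddCommGroup Y] [Module A Y]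
    [AddCommGroup W] [Module A W] {a : R → X →ₗ[A] X} {b : R → Y →ₗ[A] Y}
    (f : X →ₗ[A] Y →ₗ[A] W) (hf : ∀ r x y, f (a r x) y = f x (b r y)) :
    BalancedTensor a b →ₗ[A] W :=
  Submodule.liftQ _ (TensorProduct.lift f) (by
    rw [Submodule.span_le]
    rintro _ ⟨r, x, y, rfl⟩
    change TensorProduct.lift f _ = 0
    rw [map_sub, TensorProduct.lift.tmul, TensorProduct.lift.tmul, hf, sub_self])

namespace GroupTensor

variable {Q H M W : Type*} [Group Q] [Group H] [AddCommGroup M] [Module A M] [AddCommGroup W]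
  [Module A W] {φ : Q →* H} {τ : Representation A Q M}

/-- The pure tensors in `A[H] ⊗_{A[Q]} M` as a bilinear map. -/
def tmulₗ (φ : Q →* H) (τ : Representation A Q M) :
    MonoidAlgebra A H →ₗ[A] M →ₗ[A] GroupTensor φ τ :=
  (TensorProduct.mk A (MonoidAlgebra A H) M).compr₂ (Submodule.mkQ (Submodule.span A
    {t : MonoidAlgebra A H ⊗[A] M | ∃ (r : MonoidAlgebra A Q) (x : MonoidAlgebra A H) (y : M),
      t = LinearMap.mulRight A (MonoidAlgebra.mapDomainAlgHom A A φ r) x ⊗ₜ[A] y -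
        x ⊗ₜ[A] τ.asAlgebraHom r y}))

lemma tmulₗ_apply (x : MonoidAlgebra A H) (m : M) : tmulₗ φ τ x m = tmul φ τ x m := rfl

lemma tmul_single_mul (h : H) (q : Q) (m : M) :
    tmul φ τ (MonoidAlgebra.single (h * φ q) 1) m = tmul φ τ (MonoidAlgebra.single h 1) (τ q m) := by
  refine (Submodule.Quotient.eq _).2 (Submodule.subset_span
    ⟨MonoidAlgebra.single q 1, MonoidAlgebra.single h 1, m, ?_⟩)
  simp [MonoidAlgebra.single_mul_single]

/-- A submodule containing all tensors `h ⊗ m` is everything. -/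
lemma mem_of_forall_single {S : Submodule A (GroupTensor φ τ)}
    (h : ∀ h m, tmul φ τ (MonoidAlgebra.single h 1) m ∈ S) (t : GroupTensor φ τ) : t ∈ S := by
  refine BalancedTensor.induction (p := fun t : GroupTensor φ τ => t ∈ S) t (zero_mem _)
    (fun x m => ?_) fun _ _ => add_mem
  change tmulₗ φ τ x m ∈ S
  induction x using MonoidAlgebra.induction_linear with
  | zero =>
    rw [map_zero, LinearMap.zero_apply]
    exact zero_mem _
  | add x y hx hy =>
    rw [map_add, LinearMap.add_apply]
    exact add_mem hx hy
  | single k a =>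
    have h1 : (MonoidAlgebra.single k a : MonoidAlgebra A H) = a • MonoidAlgebra.single k 1 := by
      simp
    rw [h1, map_smul, LinearMap.smul_apply]
    exact Submodule.smul_mem _ a (h k m)

lemma hom_ext {f g : GroupTensor φ τ →ₗ[A] W}
    (h : ∀ h m, f (tmul φ τ (MonoidAlgebra.single h 1) m) =
      g (tmul φ τ (MonoidAlgebra.single h 1) m)) : f = g :=
  LinearMap.ext fun t => mem_of_forall_single (S := LinearMap.eqLocus f g) h t

lemma act_tmul (h : H) (x : MonoidAlgebra A H) (m : M) :
    act φ τ h (tmul φ τ x m) = tmul φ τ (MonoidAlgebra.single h 1 * x) m := rfl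

lemma exists_eq_sum (t : GroupTensor φ τ) : ∃ ℓ : (H ⧸ φ.range) →₀ M,
    t = ℓ.sum fun c m => tmul φ τ (MonoidAlgebra.single c.out 1) m := by
  let Λ : ((H ⧸ φ.range) →₀ M) →ₗ[A] GroupTensor φ τ :=
    Finsupp.lsum A fun c => tmulₗ φ τ (MonoidAlgebra.single c.out 1)
  suffices h : t ∈ LinearMap.range Λ by
    obtain ⟨ℓ, hℓ⟩ := h
    exact ⟨ℓ, hℓ.symm⟩
  refine mem_of_forall_single (fun k m => ?_) t
  obtain ⟨⟨_, q, rfl⟩, hq⟩ := QuotientGroup.mk_out_eq_mul φ.range k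
  refine ⟨Finsupp.single (k : H ⧸ φ.range) (τ q⁻¹ m), ?_⟩
  rw [Finsupp.lsum_single, tmulₗ_apply, ← tmul_single_mul, hq, map_inv, mul_inv_cancel_right]

end GroupTensor

/-- The pure tensors in `S ⊗̂_R M` as a bilinear map. -/
def CompletedTensor.tmulₗ {R S M : Type*} [Ring R] [Algebra A R] [Ring S] [Algebra A S]
    [TopologicalSpace S] [AddCommGroup M] [Module A M] [TopologicalSpace M] (θ : R →ₐ[A] S)
    (α : R →ₐ[A] Module.End A M) : S →ₗ[A] M →ₗ[A] CompletedTensor θ α :=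
  LinearMap.mk₂ A (CompletedTensor.tmul θ α)
    (fun s s' m => Subtype.ext (funext fun i => i.mkTmul_add_left s s' m))
    (fun a s m => Subtype.ext (funext fun i =>
      LinearMap.congr_fun (map_smul (CompletedTensorIndex.mkTmulₗ θ i) a s) m))
    (fun s m m' => Subtype.ext (funext fun i => i.mkTmul_add_right s m m'))
    (fun a s m => Subtype.ext (funext fun i =>
      map_smul (CompletedTensorIndex.mkTmulₗ θ i s) a m))

lemma CompletedTensor.tmul_mul {R S M : Type*} [Ring R] [Algebra A R] [Ring S] [Algebra A S]
    [TopologicalSpace S] [AddCommGroup M] [Module A M] [TopologicalSpace M] (θ : R →ₐ[A] S)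
    (α : R →ₐ[A] Module.End A M) (s : S) (r : R) (m : M) :
    CompletedTensor.tmul θ α (s * θ r) m = CompletedTensor.tmul θ α s (α r m) :=
  Subtype.ext (funext fun i => i.mkTmul_mul s r m)

end BalancedTensor

section Comparison

open CompletedGroupAlgebra

variable {A : Type*} [CommRing A] [IsLocalRing A] {Γ : Type*} [Group Γ] [TopologicalSpace Γ]
  [IsTopologicalGroup Γ]  {P K : Subgroup Γ} {U : Type*} [AddCommGroup U] [Module A U]

/-- The map `A[Γ] ⊗_{A[P]} U^∨ → (Ind U)^∨`. -/
def groupEval (ρ : Representation A P U) :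
    GroupTensor P.subtype ρ.dual →ₗ[A] Module.Dual A (contInd ρ) :=
  BalancedTensor.lift (LinearMap.mk₂ A
      (fun x ℓ => (contIndRep ρ).dual.asAlgebraHom x (evalOne ρ ℓ))
      (fun x y ℓ => by rw [map_add]; rfl) (fun a x ℓ => by rw [map_smul]; rfl)
      (fun x ℓ ℓ' => by rw [map_add, map_add]) (fun a x ℓ => by rw [map_smul, map_smul])) (by
    intro r x ℓ
    change (contIndRep ρ).dual.asAlgebraHom (x * MonoidAlgebra.mapDomainAlgHom A A P.subtype r)
      (evalOne ρ ℓ) = (contIndRep ρ).dual.asAlgebraHom x (evalOne ρ (ρ.dual.asAlgebraHom r ℓ))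
    rw [map_mul, Module.End.mul_apply]
    congr 1
    induction r using MonoidAlgebra.induction_linear with
    | zero => simp
    | add r s hr hs =>
      rw [map_add, map_add, map_add, LinearMap.add_apply, LinearMap.add_apply, hr, hs, map_add]
    | single q a =>
      rw [MonoidAlgebra.mapDomainAlgHom_apply, MonoidAlgebra.mapDomain_single,
        Representation.asAlgebraHom_single, Representation.asAlgebraHom_single,
        LinearMap.smul_apply, LinearMap.smul_apply, map_smul]
      congr 1
      ext f
      change ℓ (f.1 (1 * (q : Γ)⁻¹)) = ℓ (ρ q⁻¹ (f.1 1))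
      rw [← contInd_apply_mul, one_mul, mul_one]
      rfl)

lemma groupEval_tmul (ρ : Representation A P U) (x : MonoidAlgebra A Γ) (ℓ : Module.Dual A U) :
    groupEval ρ (GroupTensor.tmul _ _ x ℓ) =
      (contIndRep ρ).dual.asAlgebraHom x (evalOne ρ ℓ) := rfl

lemma groupEval_single (ρ : Representation A P U) (g : Γ) (ℓ : Module.Dual A U) (f : contInd ρ) :
    groupEval ρ (GroupTensor.tmul _ _ (MonoidAlgebra.single g 1) ℓ) f = ℓ (f.1 g⁻¹) := by
  rw [groupEval_tmul, Representation.asAlgebraHom_single_one]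
  change ℓ (f.1 (1 * g⁻¹)) = _
  rw [one_mul]

lemma groupEval_act (ρ : Representation A P U) (g : Γ) (t : GroupTensor P.subtype ρ.dual) :
    groupEval ρ (GroupTensor.act _ _ g t) = (contIndRep ρ).dual g (groupEval ρ t) := by
  have h : groupEval ρ ∘ₗ GroupTensor.act P.subtype ρ.dual g =
      (contIndRep ρ).dual g ∘ₗ groupEval ρ :=
    GroupTensor.hom_ext fun h ℓ => by
      rw [LinearMap.comp_apply, LinearMap.comp_apply, GroupTensor.act_tmul, groupEval_tmul,
        groupEval_tmul, map_mul, Representation.asAlgebraHom_single_one, Module.End.mul_apply]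
  have h' := LinearMap.congr_fun h t
  rwa [LinearMap.comp_apply, LinearMap.comp_apply] at h'

/-- The map `A[K] ⊗_{A[P ∩ K]} U^∨ → A[Γ] ⊗_{A[P]} U^∨`. -/
def groupTensorMap (K : Subgroup Γ) (ρ : Representation A P U) :
    GroupTensor (Subgroup.inclusion inf_le_right) (dualResRep K ρ) →ₗ[A]
      GroupTensor P.subtype ρ.dual :=
  BalancedTensor.map (MonoidAlgebra.mapDomainAlgHom A A (Subgroup.inclusion inf_le_left))
    (MonoidAlgebra.mapDomainAlgHom A A K.subtype).toLinearMap LinearMap.id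
    (fun r x => by
      change MonoidAlgebra.mapDomainAlgHom A A K.subtype (x * _) = _ * _
      rw [map_mul]
      congr 1
      rw [← AlgHom.comp_apply, ← AlgHom.comp_apply]
      congr 1
      ext h
      simp)
    (fun r ℓ => by
      change (dualResRep K ρ).asAlgebraHom r ℓ = ρ.dual.asAlgebraHom _ ℓ
      rw [← AlgHom.comp_apply]
      congr 2
      ext h
      simp [dualResRep])

lemma groupTensorMap_tmul (ρ : Representation A P U) (x : MonoidAlgebra A K) (ℓ : Module.Dual A U) :
    groupTensorMap K ρ (GroupTensor.tmul _ _ x ℓ) =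
      GroupTensor.tmul _ _ (MonoidAlgebra.mapDomainAlgHom A A K.subtype x) ℓ := rfl

lemma groupTensorMap_single (ρ : Representation A P U) (k : K) (ℓ : Module.Dual A U) :
    groupTensorMap K ρ (GroupTensor.tmul _ _ (MonoidAlgebra.single k 1) ℓ) =
      GroupTensor.tmul _ _ (MonoidAlgebra.single (k : Γ) 1) ℓ := by
  rw [groupTensorMap_tmul]
  congr 1
  simp

lemma groupTensorMap_surjective (hPK : ∀ g : Γ, ∃ q ∈ P, ∃ k ∈ K, g = q * k)
    (ρ : Representation A P U) : Function.Surjective (groupTensorMap K ρ) := by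
  refine fun t => GroupTensor.mem_of_forall_single (S := LinearMap.range (groupTensorMap K ρ))
    (fun g ℓ => ?_) t
  obtain ⟨q, hq, k, hk, h⟩ := hPK g⁻¹
  refine ⟨GroupTensor.tmul _ _ (MonoidAlgebra.single (⟨k, hk⟩⁻¹ : K) 1) (ρ.dual ⟨q, hq⟩⁻¹ ℓ), ?_⟩
  rw [groupTensorMap_single, ← GroupTensor.tmul_single_mul]
  congr 2
  rw [← inv_inv g, h]
  simp

variable [IsNoetherianRing A] [IsAdicComplete (maximalIdeal A) A]
  [TopologicalSpace A] [hA : Fact (IsAdic (maximalIdeal A))]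
  [CompactSpace K] [TotallyDisconnectedSpace K] [CompactSpace ↥(P ⊓ K)]
  [TotallyDisconnectedSpace ↥(P ⊓ K)]
  [IsAdicComplete (maximalIdeal A) U] {ρ : Representation A P U}

lemma groupEval_groupTensorMap_injective (hK : IsOpen (K : Set Γ)) (hρ : HasContinuousOrbits A ρ)
    {r : Γ → P} (hr : Continuous r) (hrq : ∀ (q : P) (g : Γ), r (q * g) = q * r g)
    (hP : IsClosed (P : Set Γ)) :
    Function.Injective (groupEval ρ ∘ₗ groupTensorMap K ρ) := by
  refine (injective_iff_map_eq_zero _).2 fun t ht => ?_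
  obtain ⟨ℓ, rfl⟩ := GroupTensor.exists_eq_sum t
  suffices h : ℓ = 0 by rw [h, Finsupp.sum_zero_index]
  ext c v
  refine eq_zero_of_forall_mem_pow fun n => ?_
  obtain ⟨N₁, hN₁⟩ := hρ.exists_fixing (K := K) (Set.finite_singleton v) n
  have hsep : ∀ c' ∈ (ℓ.support : Set _), c' ≠ c → ∀ᶠ u : K in 𝓝 1,
      (c'.out : Γ)⁻¹ * (u : Γ)⁻¹ * c.out ∉ P := fun c' _ hc' => by
    have h1 : Continuous fun u : K => (c'.out : Γ)⁻¹ * (u : Γ)⁻¹ * c.out := by fun_prop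
    refine (hP.isOpen_compl.preimage h1).mem_nhds fun h => hc' ?_
    rw [← QuotientGroup.out_eq' c, ← QuotientGroup.out_eq' c', QuotientGroup.eq]
    simp only [OneMemClass.coe_one, inv_one, mul_one, SetLike.mem_coe] at h
    exact ⟨⟨_, h, SetLike.coe_mem (c'.out⁻¹ * c.out)⟩, rfl⟩
  obtain ⟨N₂, hN₂⟩ := exists_openNormalSubgroup_subset
    ((ℓ.support.finite_toSet.eventually_all).2 fun c' hc' => eventually_imp_distrib_left.2
      (hsep c' hc'))
  obtain ⟨f, -, hf2, hf3, -⟩ := exists_contInd_supported hK hρ hr hrq c.out v (n := n)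
    (N := N₁ ⊓ N₂) fun u hu => hN₁ v rfl u hu.1
  have h1 : ∀ c' ∈ ℓ.support, c' ≠ c → f.1 (c'.out : Γ)⁻¹ ∈
      (maximalIdeal A ^ n • ⊤ : Submodule A U) := fun c' hc' hne => by
    refine hf3 _ ?_
    rintro ⟨q, u, hu, h⟩
    refine hN₂ u hu.2 c' hc' hne ?_
    rw [h]
    simp [mul_assoc]
  have h2 : ∀ c' : K ⧸ (Subgroup.inclusion (inf_le_right : P ⊓ K ≤ K)).range, groupEval ρ
      (groupTensorMap K ρ (GroupTensor.tmul _ _ (MonoidAlgebra.single c'.out 1) (ℓ c'))) f =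
        ℓ c' (f.1 (c'.out : Γ)⁻¹) := fun c' => by
    rw [groupTensorMap_single, groupEval_single]
  have h3 : ∑ c' ∈ ℓ.support, ℓ c' (f.1 (c'.out : Γ)⁻¹) = 0 := by
    have h4 := LinearMap.congr_fun ht f
    rw [LinearMap.comp_apply, Finsupp.sum, map_sum, map_sum, LinearMap.sum_apply] at h4
    exact (Finset.sum_congr rfl fun c' _ => (h2 c').symm).trans h4
  have h5 : ℓ c (f.1 (c.out : Γ)⁻¹) ∈ maximalIdeal A ^ n := by
    classical
    by_cases hc : c ∈ ℓ.support
    · rw [← Finset.add_sum_erase _ _ hc, add_eq_zero_iff_eq_neg] at h3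
      rw [h3]
      exact neg_mem (sum_mem fun c' hc' => (ℓ c').map_mem_pow
        (h1 c' (Finset.mem_of_mem_erase hc') (Finset.ne_of_mem_erase hc')))
    · rw [Finsupp.notMem_support_iff.1 hc]
      exact zero_mem _
  have h6 := sub_mem h5 ((ℓ c).map_mem_pow hf2)
  rw [map_sub, sub_sub_cancel] at h6
  exact h6

namespace InductionDatum

variable (D : InductionDatum K ρ)

/-- The map `A[K] ⊗_{A[P ∩ K]} U^∨ → A[[K]] ⊗̂_{A[[P ∩ K]]} U^∨`. -/
def ofGroupTensor : GroupTensor (Subgroup.inclusion inf_le_right) (dualResRep K ρ) →ₗ[A] D.Tensor :=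
  BalancedTensor.lift (CompletedTensor.tmulₗ (completedInclusion A P K) D.α ∘ₗ
      (of A : MonoidAlgebra A K →ₐ[A] _).toLinearMap) (by
    intro r x ℓ
    have h1 : of A (MonoidAlgebra.mapDomainAlgHom A A (Subgroup.inclusion inf_le_right) r) =
        completedInclusion A P K (of A r) := by
      rw [← AlgHom.comp_apply, ← AlgHom.comp_apply]
      congr 1
      refine MonoidAlgebra.algHom_ext (fun h => ?_) (Subsingleton.elim _ _)
      simpa using (completedInclusion_single (A := A) h).symm
    have h2 : D.α (of A r) = (dualResRep K ρ).asAlgebraHom r := by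
      rw [← AlgHom.comp_apply]
      congr 1
      refine MonoidAlgebra.algHom_ext (fun h => ?_) (Subsingleton.elim _ _)
      simpa using D.isCompletedAction_α.extends_rep h
    have h3 := CompletedTensor.tmul_mul (completedInclusion A P K) D.α (of A x) (of A r) ℓ
    rw [h2, ← h1, ← map_mul] at h3
    exact h3)

lemma ofGroupTensor_tmul (x : MonoidAlgebra A K) (ℓ : Module.Dual A U) :
    D.ofGroupTensor (GroupTensor.tmul _ _ x ℓ) = CompletedTensor.tmul _ _ (of A x) ℓ := rfl

lemma comparison_comp_ofGroupTensor :
    D.comparison ∘ₗ D.ofGroupTensor = groupEval ρ ∘ₗ groupTensorMap K ρ :=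
  GroupTensor.hom_ext fun k ℓ => by
    ext f
    rw [LinearMap.comp_apply, LinearMap.comp_apply, groupTensorMap_single, groupEval_single,
      ofGroupTensor_tmul, comparison_tmul, pair_single]

lemma comparison_ofGroupTensor 
    (t : GroupTensor (Subgroup.inclusion inf_le_right) (dualResRep K ρ)) :
    D.comparison (D.ofGroupTensor t) = groupEval ρ (groupTensorMap K ρ t) := by
  have h := LinearMap.congr_fun D.comparison_comp_ofGroupTensor t
  rwa [LinearMap.comp_apply, LinearMap.comp_apply] at h

lemma denseRange_comparison_ofGroupTensor :
    DenseRange fun t => D.comparison (D.ofGroupTensor t) := by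
  intro l
  refine mem_closure_iff_nhds.2 fun s hs => ?_
  obtain ⟨S, n, hS, hs⟩ := exists_subset_of_mem_nhds_dual hs
  choose N hN using fun f : contInd ρ => D.exists_invariant_retr f n
  obtain ⟨N', hN'⟩ := exists_openNormalSubgroup_subset ((hS.eventually_all).2 fun f _ =>
    (N f).isOpen.mem_nhds (one_mem (N f)))
  have := Fintype.ofFinite (LevelCoset P N')
  refine ⟨_, hs _ fun f hf => ?_, ∑ c : LevelCoset P N', GroupTensor.tmul _ _
    (MonoidAlgebra.single c.out 1) (D.localFunctional N' l c.out), rfl⟩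
  have h := D.sum_localFunctional_sub_mem (N := N') (f := f)
    (fun x u hu => hN f x u (hN' u hu f hf)) l
  convert h using 2
  simp only [map_sum, LinearMap.sum_apply]
  refine Finset.sum_congr rfl fun c _ => ?_
  rw [ofGroupTensor_tmul, comparison_tmul, pair_single]

lemma ofGroupTensor_injective (D : InductionDatum K ρ) (hP : IsClosed (P : Set Γ)) :
    Function.Injective D.ofGroupTensor := by
  have h := groupEval_groupTensorMap_injective D.isOpen D.orbits D.continuous_retr D.retr_mul hP
  rw [← comparison_comp_ofGroupTensor, LinearMap.coe_comp] at h
  exact h.of_comp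

include D in
lemma groupTensorMap_injective (hP : IsClosed (P : Set Γ)) :
    Function.Injective (groupTensorMap K ρ) := by
  have h := groupEval_groupTensorMap_injective D.isOpen D.orbits D.continuous_retr D.retr_mul hP
  rw [LinearMap.coe_comp] at h
  exact h.of_comp

/-- The isomorphism `A[K] ⊗_{A[P ∩ K]} U^∨ ≃ A[Γ] ⊗_{A[P]} U^∨`. -/
def groupTensorEquiv (hP : IsClosed (P : Set Γ)) :
    GroupTensor (Subgroup.inclusion inf_le_right) (dualResRep K ρ) ≃ₗ[A]
      GroupTensor P.subtype ρ.dual :=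
  LinearEquiv.ofBijective (groupTensorMap K ρ)
    ⟨D.groupTensorMap_injective hP, groupTensorMap_surjective D.exists_mul ρ⟩

lemma groupTensorEquiv_apply (hP : IsClosed (P : Set Γ)) 
    (t : GroupTensor (Subgroup.inclusion inf_le_right) (dualResRep K ρ)) :
    D.groupTensorEquiv hP t = groupTensorMap K ρ t := rfl

variable [Finite (ResidueField A)]

lemma comparison_surjective : Function.Surjective D.comparison := by
  have h1 : IsClosed (Set.range D.comparison) :=
    (isCompact_range D.continuous_comparison).isClosed
  have h2 : DenseRange D.comparison :=
    D.denseRange_comparison_ofGroupTensor.mono (Set.range_comp_subset_range D.ofGroupTensor _)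
  rw [← Set.range_eq_univ, ← h1.closure_eq, h2.closure_eq]

/-- The isomorphism `A[[K]] ⊗̂_{A[[P ∩ K]]} U^∨ ≃ (Ind U)^∨` of topological modules. -/
def comparisonEquiv : D.Tensor ≃L[A] Module.Dual A (contInd ρ) where
  toLinearEquiv := LinearEquiv.ofBijective D.comparison
    ⟨D.comparison_injective, D.comparison_surjective⟩
  continuous_toFun := D.continuous_comparison
  continuous_invFun := Continuous.continuous_symm_of_equiv_compact_to_t2
    (f := (LinearEquiv.ofBijective D.comparison
      ⟨D.comparison_injective, D.comparison_surjective⟩).toEquiv) D.continuous_comparison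

lemma denseRange_ofGroupTensor : DenseRange D.ofGroupTensor := by
  have h := D.comparisonEquiv.symm.surjective.denseRange.comp D.denseRange_comparison_ofGroupTensor
    D.comparisonEquiv.symm.continuous
  convert h using 1
  ext t : 1
  exact (D.comparisonEquiv.symm_apply_apply _).symm

/-- The topological isomorphism between `A[[K]] ⊗̂_{A[[P ∩ K]]} U^∨` and `(Ind U)^∨`. -/
def dualIndIso : DualIndIso K ρ where
  α := D.α
  isCompletedAction := D.isCompletedAction_α
  β := D.β
  isCompletedAction_ind := D.isCompletedAction_β
  e := D.comparisonEquiv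
  e_act := D.comparison_act

lemma dualIndIso_tmul_single (k : K) (ℓ : Module.Dual A U) (f : contInd ρ) :
    D.dualIndIso.e (CompletedTensor.tmul _ _ (of A (MonoidAlgebra.single k 1)) ℓ) f =
      ℓ (f.1 (k : Γ)⁻¹) :=
  (LinearMap.congr_fun (D.comparison_tmul (of A (MonoidAlgebra.single k 1)) ℓ) f).trans
    (D.pair_single k ℓ f)

lemma dualIndIso_groupTensor_act (hP : IsClosed (P : Set Γ)) (g : Γ)
    (t : GroupTensor (Subgroup.inclusion inf_le_right) (dualResRep K ρ)) :
    D.dualIndIso.e (D.ofGroupTensor ((D.groupTensorEquiv hP).symm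
      (GroupTensor.act _ _ g (D.groupTensorEquiv hP t)))) =
      (contIndRep ρ).dual g (D.dualIndIso.e (D.ofGroupTensor t)) := by
  change D.comparison _ = (contIndRep ρ).dual g (D.comparison _)
  rw [comparison_ofGroupTensor, comparison_ofGroupTensor, ← groupTensorEquiv_apply D hP,
    LinearEquiv.apply_symm_apply, groupEval_act, groupTensorEquiv_apply]

/-! #### Naturality -/

section Naturality

variable {U' : Type*} [AddCommGroup U'] [Module A U'] [IsAdicComplete (maximalIdeal A) U']
  {ρ' : Representation A P U'} (D' : InductionDatum K ρ') (φ : U →ₗ[A] U')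
  (hφ : ∀ (q : P) (u : U), φ (ρ q u) = ρ' q (φ u))

lemma continuous_dualMap {X Y : Type*} [AddCommGroup X] [Module A X] [AddCommGroup Y] [Module A Y]
    (ψ : X →ₗ[A] Y) : Continuous ψ.dualMap :=
  continuous_induced_rng.2 (continuous_pi fun x => continuous_dual_apply (A := A) (ψ x))

lemma dualMap_β (μ : CompletedGroupAlgebra A K) (l : Module.Dual A (contInd ρ')) :
    (contIndMap φ hφ).dualMap (D'.β μ l) = D.β μ ((contIndMap φ hφ).dualMap l) := by
  let f : CompletedGroupAlgebra A K →ₗ[A] Module.Dual A (contInd ρ) :=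
    (contIndMap φ hφ).dualMap ∘ₗ LinearMap.applyₗ l ∘ₗ D'.β.toLinearMap
  let g : CompletedGroupAlgebra A K →ₗ[A] Module.Dual A (contInd ρ) :=
    LinearMap.applyₗ ((contIndMap φ hφ).dualMap l) ∘ₗ D.β.toLinearMap
  have hf : Continuous f :=
    (continuous_dualMap (contIndMap φ hφ)).comp (continuous_dualAct_left D'.smooth_ind l)
  have hg : Continuous g := continuous_dualAct_left D.smooth_ind _
  have h : f = g := CompletedGroupAlgebra.eq_of_continuous hf hg fun k => by
    change (contIndMap φ hφ).dualMap (D'.β _ l) = D.β _ _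
    rw [β_single, β_single]
    rfl
  exact LinearMap.congr_fun h μ

lemma dualMap_pair (μ : CompletedGroupAlgebra A K) (ℓ : Module.Dual A U') :
    (contIndMap φ hφ).dualMap (D'.pair μ ℓ) = D.pair μ (φ.dualMap ℓ) := by
  rw [pair_apply, dualMap_β D D']
  rfl

/-- The map of completed tensor products induced by an equivariant map. -/
def tensorMap : D'.Tensor →L[A] D.Tensor :=
  (D.comparisonEquiv.symm : Module.Dual A (contInd ρ) →L[A] D.Tensor).comp
    (ContinuousLinearMap.comp ⟨(contIndMap φ hφ).dualMap, continuous_dualMap _⟩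
      (D'.comparisonEquiv : D'.Tensor →L[A] Module.Dual A (contInd ρ')))

lemma comparison_tensorMap (x : D'.Tensor) :
    D.comparison (tensorMap D D' φ hφ x) = (contIndMap φ hφ).dualMap (D'.comparison x) :=
  D.comparisonEquiv.apply_symm_apply _

lemma tensorMap_tmul (μ : CompletedGroupAlgebra A K) (ℓ : Module.Dual A U') :
    tensorMap D D' φ hφ (CompletedTensor.tmul _ _ μ ℓ) =
      CompletedTensor.tmul _ _ μ (φ.dualMap ℓ) := by
  refine D.comparison_injective ?_
  rw [comparison_tensorMap, comparison_tmul, comparison_tmul, dualMap_pair]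

lemma tensorMap_act (μ : CompletedGroupAlgebra A K) (x : D'.Tensor) :
    tensorMap D D' φ hφ (CompletedTensor.act _ _ μ x) =
      CompletedTensor.act _ _ μ (tensorMap D D' φ hφ x) := by
  refine D.comparison_injective ?_
  rw [comparison_tensorMap, comparison_act, comparison_act, comparison_tensorMap, dualMap_β]

end Naturality

end InductionDatum

end Comparison

/-! ### The groups of rational points over a `p`-adic field -/

lemma totallyDisconnectedSpace_of_injective {X Y : Type*} [TopologicalSpace X] [TopologicalSpace Y]
    [TotallyDisconnectedSpace Y] {f : X → Y} (hf : Continuous f) (hi : Function.Injective f) :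
    TotallyDisconnectedSpace X :=
  ⟨isTotallyDisconnected_of_image hf.continuousOn hi (isTotallyDisconnected_of_totallyDisconnectedSpace _)⟩

section LocalField

variable (p : ℕ) [Fact p.Prime] (F : Type*) [NormedField F] [NormedAlgebra ℚ_[p] F]
  [FiniteDimensional ℚ_[p] F]

include p in
lemma properSpace_of_finiteDimensional_padic : ProperSpace F := FiniteDimensional.proper ℚ_[p] F

include p in
lemma totallyDisconnectedSpace_of_finiteDimensional_padic : TotallyDisconnectedSpace F := by
  let e : F ≃L[ℚ_[p]] (Fin (Module.finrank ℚ_[p] F) → ℚ_[p]) :=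
    (Module.finBasis ℚ_[p] F).equivFun.toContinuousLinearEquiv
  exact totallyDisconnectedSpace_of_injective e.continuous e.injective

end LocalField

/-- A projection of a locally compact group along a closed normal subgroup onto a `σ`-compact
complement is continuous. -/
lemma continuous_of_inv_mul_mem {X L : Type*} [Group X] [TopologicalSpace X] [IsTopologicalGroup X]
    [LocallyCompactSpace X] [Group L] [TopologicalSpace L] [IsTopologicalGroup L]
    [SigmaCompactSpace L] {V : Subgroup X} [V.Normal] (hV : IsClosed (V : Set X)) {ι : L →* X}
    (hι : Continuous ι) {π : X → L} (h : ∀ l q, (ι l)⁻¹ * q ∈ V ↔ l = π q) : Continuous π := by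
  let f : L →* X ⧸ V := (QuotientGroup.mk' V).comp ι
  have hf : Continuous f := QuotientGroup.continuous_mk.comp hι
  have hfq : ∀ (l : L) (q : X), f l = (q : X ⧸ V) ↔ l = π q := fun l q =>
    QuotientGroup.eq.trans (h l q)
  have hfs : Function.Surjective f := fun c => by
    obtain ⟨q, rfl⟩ := QuotientGroup.mk_surjective c
    exact ⟨_, (hfq _ q).2 rfl⟩
  have hT : T2Space (X ⧸ V) := by
    have := hV
    infer_instance
  have hfo : IsOpenMap f := f.isOpenMap_of_sigmaCompact hfs hf
  refine continuous_def.2 fun W hW => ?_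
  have h1 : π ⁻¹' W = (QuotientGroup.mk : X → X ⧸ V) ⁻¹' (f '' W) := by
    ext q
    refine ⟨fun h => ⟨_, h, (hfq _ q).2 rfl⟩, ?_⟩
    rintro ⟨l, hl, h⟩
    rw [hfq] at h
    rwa [Set.mem_preimage, ← h]
  rw [h1]
  exact (hfo W hW).preimage QuotientGroup.continuous_mk

namespace AlgGrp

variable {F Ω : Type*} [NormedField F] [Field Ω] [Algebra F Ω] {n : ℕ}

lemma continuous_entry (i j : Fin n) : Continuous fun g : GL (Fin n) F => g.1 i j :=
  (Units.continuous_val.matrix_elem i j)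

instance [TotallyDisconnectedSpace F] : TotallyDisconnectedSpace (GL (Fin n) F) :=
  totallyDisconnectedSpace_of_injective (f := fun (g : GL (Fin n) F) (i j : Fin n) => g.1 i j)
    (continuous_pi fun i => continuous_pi fun j => continuous_entry i j)
    fun _ _ h => Units.ext h

instance [SecondCountableTopology F] : SecondCountableTopology (GL (Fin n) F) := by
  have : SecondCountableTopology (Matrix (Fin n) (Fin n) F) :=
    inferInstanceAs (SecondCountableTopology (Fin n → Fin n → F))
  have : SecondCountableTopology (Matrix (Fin n) (Fin n) F)ᵐᵒᵖ :=
    MulOpposite.opHomeomorph.symm.secondCountableTopology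
  exact Units.isEmbedding_embedProduct.secondCountableTopology

instance [LocallyCompactSpace F] : LocallyCompactSpace (GL (Fin n) F) := by
  have : LocallyCompactSpace (Matrix (Fin n) (Fin n) F) :=
    inferInstanceAs (LocallyCompactSpace (Fin n → Fin n → F))
  infer_instance

lemma IsClosedOver.of_base {H : Subgroup (GL (Fin n) Ω)} (hH : IsClosedOver F H) :
    IsClosedOver Ω H := by
  obtain ⟨S, hS⟩ := hH
  refine ⟨MvPolynomial.map (algebraMap F Ω) '' S, fun g => ?_⟩
  rw [hS, Set.forall_mem_image]
  refine forall₂_congr fun f _ => ?_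
  rw [MvPolynomial.aeval_map_algebraMap]

lemma isClosed_points {H : Subgroup (GL (Fin n) Ω)} (hH : IsClosedOver Ω H) :
    IsClosed (points F H : Set (GL (Fin n) F)) := by
  obtain ⟨S, hS⟩ := hH
  have h : (points F H : Set (GL (Fin n) F)) = ⋂ f ∈ S, ⋂ l : Module.Dual F Ω,
      {g | ∑ d ∈ f.support, l (f.coeff d) * d.prod (fun ij k => g.1 ij.1 ij.2 ^ k) = 0} := by
    ext g
    simp only [Set.mem_iInter]
    change Matrix.GeneralLinearGroup.map (algebraMap F Ω) g ∈ H ↔ _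
    rw [hS]
    refine forall₂_congr fun f _ => ?_
    rw [← Module.forall_dual_apply_eq_zero_iff F]
    refine forall_congr' fun l => ?_
    have h1 : MvPolynomial.aeval (fun ij : Fin n × Fin n =>
        (Matrix.GeneralLinearGroup.map (algebraMap F Ω) g).1 ij.1 ij.2) f =
        ∑ d ∈ f.support, (d.prod fun ij k => g.1 ij.1 ij.2 ^ k) • f.coeff d := by
      rw [MvPolynomial.aeval_def, MvPolynomial.eval₂_eq']
      refine Finset.sum_congr rfl fun d _ => ?_
      rw [Algebra.smul_def, mul_comm, Finsupp.prod_fintype _ _ fun _ => pow_zero _, map_prod]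
      simp
    rw [h1, map_sum]
    simp [mul_comm]
  rw [h]
  refine isClosed_biInter fun f _ => isClosed_iInter fun l => isClosed_eq ?_ continuous_const
  refine continuous_finsetSum _ fun d _ => continuous_const.mul ?_
  exact continuous_finsetProd _ fun ij _ => (continuous_entry ij.1 ij.2).pow _

lemma leviProj_spec [IsGalois F Ω] {P L : Subgroup (GL (Fin n) Ω)} (hP : IsClosedOver F P)
    (hL : IsLeviSubgroup F P L) (q : points F P) :
    Matrix.GeneralLinearGroup.map (algebraMap F Ω) ((leviProj F hP hL q).1⁻¹ * q.1) ∈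
      hL.exists_radical.choose :=
  (exists_levi_component F hP hL.overBase hL.exists_radical.choose_spec.1
    hL.exists_radical.choose_spec.2.1 hL.exists_radical.choose_spec.2.2 q).choose_spec

lemma continuous_leviProj [ProperSpace F] [IsGalois F Ω] {P L : Subgroup (GL (Fin n) Ω)}
    (hP : IsClosedOver F P) (hL : IsLeviSubgroup F P L) : Continuous (leviProj F hP hL) := by
  have hspec := leviProj_spec hP hL
  have hU := hL.exists_radical.choose_spec
  generalize hL.exists_radical.choose = U at hspec hU
  let V : Subgroup (points F P) := (points F U).subgroupOf (points F P)
  have hVn : V.Normal := ⟨fun v hv g => by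
    change Matrix.GeneralLinearGroup.map (algebraMap F Ω) (g.1 * v.1 * g.1⁻¹) ∈ U
    rw [map_mul, map_mul, map_inv]
    exact hU.1.1.normal _ g.2 _ hv⟩
  have hPc : IsClosed (points F P : Set (GL (Fin n) F)) := isClosed_points hP.of_base
  have hLc : IsClosed (points F L : Set (GL (Fin n) F)) := isClosed_points hL.overBase.of_base
  have hVc : IsClosed (V : Set (points F P)) :=
    (isClosed_points hU.1.1.closedConnected.1).preimage continuous_subtype_val
  have : LocallyCompactSpace (points F P) := hPc.isClosedEmbedding_subtypeVal.locallyCompactSpace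
  have : SigmaCompactSpace (points F L) := hLc.isClosedEmbedding_subtypeVal.sigmaCompactSpace
  have hle : points F L ≤ points F P := Subgroup.comap_mono hL.le
  refine continuous_of_inv_mul_mem hVc (ι := Subgroup.inclusion hle) (continuous_inclusion hle)
    fun l q => ⟨fun h => levi_component_unique F hU.2.1 q _ _ h (hspec q), ?_⟩
  rintro rfl
  exact hspec q

lemma continuous_leviProjIn [ProperSpace F] [IsGalois F Ω] (G : Subgroup (GL (Fin n) Ω))
    {P L : Subgroup (GL (Fin n) Ω)} (hP : IsClosedOver F P) (hL : IsLeviSubgroup F P L) :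
    Continuous (leviProjIn F G hP hL) :=
  (continuous_leviProj hP hL).comp
    ((continuous_subtype_val.comp continuous_subtype_val).subtype_mk _)

lemma isClosed_pointsIn (G : Subgroup (GL (Fin n) Ω)) {P : Subgroup (GL (Fin n) Ω)}
    (hP : IsClosedOver F P) : IsClosed (pointsIn F G P : Set (points F G)) :=
  (isClosed_points hP.of_base).preimage continuous_subtype_val

lemma hasContinuousOrbits_inflate [ProperSpace F] [IsGalois F Ω] {G P Pm L : Subgroup (GL (Fin n) Ω)}
    (h : IsOppositePair F G P Pm L) {A : Type*} [CommRing A] [IsLocalRing A] {U : Type*}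
    [AddCommGroup U] [Module A U] {σ : Representation A (points F L) U}
    (hσ : IsAdicallyContinuous σ) : HasContinuousOrbits A (h.inflate σ) := by
  refine HasContinuousOrbits.comp (ρ := σ) (fun n u => ?_) (continuous_leviProjIn G _ _)
  let _ := adicTop A U
  have h1 : Continuous fun l => σ l u := hσ.2.comp (Continuous.prodMk_left u)
  exact continuous_adicTop_iff.1 h1 n

end AlgGrp

/-! ### The coefficient ring -/

lemma finite_residueField_of_surjective (p : ℕ) [Fact p.Prime] (E : Type*) [Field E]
    [Algebra ℚ_[p] E] [FiniteDimensional ℚ_[p] E] [Algebra ℤ_[p] E] [IsScalarTower ℤ_[p] ℚ_[p] E]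
    (A : Type*) [CommRing A] [IsLocalRing A] [Algebra (integralClosure ℤ_[p] E) A]
    [IsLocalHom (algebraMap (integralClosure ℤ_[p] E) A)]
    (hres : Function.Surjective
      ((residue A).comp (algebraMap (integralClosure ℤ_[p] E) A))) : Finite (ResidueField A) := by
  have h1 : Module.Finite ℤ_[p] (integralClosure ℤ_[p] E) :=
    IsIntegralClosure.finite ℤ_[p] ℚ_[p] E (integralClosure ℤ_[p] E)
  have h2 : Function.Injective (algebraMap ℤ_[p] E) := by
    rw [IsScalarTower.algebraMap_eq ℤ_[p] ℚ_[p] E]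
    exact (algebraMap ℚ_[p] E).injective.comp (IsFractionRing.injective ℤ_[p] ℚ_[p])
  have h3 : IsLocalHom (algebraMap ℤ_[p] (integralClosure ℤ_[p] E)) :=
    (algebraMap_isIntegral_iff.2 inferInstance).isLocalHom fun x y h =>
      h2 (congrArg (algebraMap (integralClosure ℤ_[p] E) E) h)
  let f : ℤ_[p] →+* A := (algebraMap (integralClosure ℤ_[p] E) A).comp (algebraMap ℤ_[p] _)
  have hf : IsLocalHom f := RingHom.isLocalHom_comp _ _
  have h4 : ((ResidueField.map f).comp (residue ℤ_[p])).Finite :=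
    (RingHom.Finite.of_surjective _ hres).comp
      (RingHom.finite_algebraMap (A := ℤ_[p]) (B := integralClosure ℤ_[p] E) |>.2 h1)
  have h5 := h4.of_comp_finite
  have : Finite (ResidueField ℤ_[p]) := Finite.of_equiv _ PadicInt.residueField.symm.toEquiv
  let _ := (ResidueField.map f).toAlgebra
  have : Module.Finite (ResidueField ℤ_[p]) (ResidueField A) := h5
  exact Module.finite_of_finite (ResidueField ℤ_[p])

end

theorem mainTheorem8
    (p : ℕ) [Fact p.Prime]
    -- the coefficient field `E` and the coefficient ring `A` over its ring of integers
    (E : Type*) [Field E] [Algebra ℚ_[p] E] [FiniteDimensional ℚ_[p] E] [Algebra ℤ_[p] E]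
    [IsScalarTower ℤ_[p] ℚ_[p] E]
    (A : Type*) [CommRing A] [IsLocalRing A] [IsNoetherianRing A]
    [IsAdicComplete (maximalIdeal A) A] [Algebra (integralClosure ℤ_[p] E) A]
    [IsLocalHom (algebraMap (integralClosure ℤ_[p] E) A)]
    (hres : Function.Surjective
      ((residue A).comp (algebraMap (integralClosure ℤ_[p] E) A)))
    [TopologicalSpace A] (hA : IsAdic (maximalIdeal A))
    -- the base field `F` with its `p`-adic topology
    (F : Type*) [NormedField F] [CharZero F] [NormedAlgebra ℚ_[p] F] [FiniteDimensional ℚ_[p] F]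
    -- the group `G`, and opposite parabolic subgroups `P`, `Pm` with common Levi subgroup `L`
    (n : ℕ) (G P Pm L : Subgroup (GL (Fin n) (AlgebraicClosure F)))
    (hG : AlgGrp.IsConnectedReductive F G) (hPL : AlgGrp.IsOppositePair F G P Pm L)
    -- the compact open subgroup `K` of `G(F)`
    (K : Subgroup (AlgGrp.points F G)) (hKo : IsOpen (K : Set (AlgGrp.points F G)))
    (hKc : IsCompact (K : Set (AlgGrp.points F G)))
    (hGK : ∀ g : AlgGrp.points F G,
      ∃ q ∈ AlgGrp.pointsIn F G Pm, ∃ k ∈ K, g = q * k) :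
    -- a family of topological isomorphisms indexed by the representations `σ` of `L(F)`
    ∃ Φ : ∀ σ : OrthContRep.{v} A (AlgGrp.points F L),
        DualIndIso K (hPL.inflate σ.ρ),
      -- the value on pure tensors
      (∀ σ (k : K) (ℓ : Module.Dual A σ.V)
        (f : contInd (hPL.inflate σ.ρ)),
        (Φ σ).e (CompletedTensor.tmul _ _
          (CompletedGroupAlgebra.of A (MonoidAlgebra.single k 1)) ℓ) f =
            ℓ (f.1 (k : AlgGrp.points F G)⁻¹)) ∧
      -- naturality in `σ`
      (∀ (σ σ' : OrthContRep.{v} A (AlgGrp.points F L)) (φ : σ.V →ₗ[A] σ'.V)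
        (hφ : ∀ l v, φ (σ.ρ l v) = σ'.ρ l (φ v)),
        ∃ T : CompletedTensor (completedInclusion A _ K) (Φ σ').α →L[A]
            CompletedTensor (completedInclusion A _ K) (Φ σ).α,
          (∀ μ ℓ, T (CompletedTensor.tmul _ _ μ ℓ) =
            CompletedTensor.tmul _ _ μ (φ.dualMap ℓ)) ∧
          (∀ μ x, T (CompletedTensor.act _ _ μ x) = CompletedTensor.act _ _ μ (T x)) ∧
          ∀ x, (Φ σ).e (T x) =
            (contIndMap (ρ := hPL.inflate σ.ρ) (ρ' := hPL.inflate σ'.ρ) φ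
              (fun _ u => hφ _ u)).dualMap ((Φ σ').e x)) ∧
      -- the dense submodule `A[K] ⊗ σ^∨ ≃ A[G(F)] ⊗ σ^∨` and the action of `G(F)` on it
      ∀ σ : OrthContRep.{v} A (AlgGrp.points F L),
        ∃ (κ : GroupTensor (Subgroup.inclusion inf_le_right)
              (dualResRep K (hPL.inflate σ.ρ)) ≃ₗ[A]
            GroupTensor (AlgGrp.pointsIn F G Pm).subtype
              (hPL.inflate σ.ρ).dual)
          (j : GroupTensor (Subgroup.inclusion inf_le_right)
              (dualResRep K (hPL.inflate σ.ρ)) →ₗ[A]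
            CompletedTensor (completedInclusion A _ K) (Φ σ).α),
          (∀ x ℓ, κ (GroupTensor.tmul _ _ x ℓ) =
            GroupTensor.tmul _ _ (MonoidAlgebra.mapDomainAlgHom A A K.subtype x) ℓ) ∧
          (∀ x ℓ, j (GroupTensor.tmul _ _ x ℓ) =
            CompletedTensor.tmul _ _ (CompletedGroupAlgebra.of A x) ℓ) ∧
          Function.Injective j ∧ DenseRange j ∧
          ∀ (g : AlgGrp.points F G) t,
            (Φ σ).e (j (κ.symm (GroupTensor.act _ _ g (κ t)))) =
              (contIndRep (hPL.inflate σ.ρ)).dual g ((Φ σ).e (j t)) := by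
  have hfact : Fact (IsAdic (maximalIdeal A)) := ⟨hA⟩
  have hfin : Finite (ResidueField A) := finite_residueField_of_surjective p E A hres
  have hproper : ProperSpace F := properSpace_of_finiteDimensional_padic p F
  have htd : TotallyDisconnectedSpace F := totallyDisconnectedSpace_of_finiteDimensional_padic p F
  have hK : CompactSpace K := isCompact_iff_compactSpace.1 hKc
  have hPm : IsClosed (AlgGrp.pointsIn F G Pm : Set (AlgGrp.points F G)) :=
    AlgGrp.isClosed_pointsIn G hPL.parabolic_opp.overBase
  have hPK : CompactSpace ↥(AlgGrp.pointsIn F G Pm ⊓ K) :=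
    isCompact_iff_compactSpace.1 (hKc.inter_left hPm)
  have hfc : FirstCountableTopology (AlgGrp.points F G) :=
    TopologicalSpace.firstCountableTopology_induced _ (GL (Fin n) F) Subtype.val
  have ht2 : T2Space (AlgGrp.points F G) := inferInstance
  have htK : TotallyDisconnectedSpace K :=
    totallyDisconnectedSpace_of_injective (f := fun k : K => k.1.1)
      (continuous_subtype_val.comp continuous_subtype_val)
      (Subtype.val_injective.comp Subtype.val_injective)
  have htPK : TotallyDisconnectedSpace ↥(AlgGrp.pointsIn F G Pm ⊓ K) :=
    totallyDisconnectedSpace_of_injective (continuous_inclusion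
      (inf_le_right : AlgGrp.pointsIn F G Pm ⊓ K ≤ K)) (Subgroup.inclusion_injective inf_le_right)
  have htg : IsTopologicalGroup (AlgGrp.points F G) := inferInstance
  have hretr := @exists_equivariant_retraction (AlgGrp.points F G) _ _ htg ht2 hfc
    (AlgGrp.pointsIn F G Pm) K hK htK hPm hKo hGK
  obtain ⟨r, hr, hrq⟩ := hretr
  have hcomplete : ∀ σ : OrthContRep.{v} A (AlgGrp.points F L), IsAdicComplete (maximalIdeal A) σ.V :=
    fun σ => σ.continuous.1
  let D : ∀ σ : OrthContRep.{v} A (AlgGrp.points F L), InductionDatum K (hPL.inflate σ.ρ) :=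
    fun σ =>
      { isOpen := hKo
        exists_mul := hGK
        orbits := AlgGrp.hasContinuousOrbits_inflate hPL σ.continuous
        retr := r
        continuous_retr := hr
        retr_mul := hrq }
  refine ⟨fun σ => (D σ).dualIndIso, fun σ k ℓ f => (D σ).dualIndIso_tmul_single k ℓ f,
    fun σ σ' φ hφ => ⟨InductionDatum.tensorMap (D σ) (D σ') φ fun _ u => hφ _ u,
      InductionDatum.tensorMap_tmul (D σ) (D σ') φ _, InductionDatum.tensorMap_act (D σ) (D σ') φ _,
      InductionDatum.comparison_tensorMap (D σ) (D σ') φ _⟩,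
    fun σ => ⟨(D σ).groupTensorEquiv hPm, (D σ).ofGroupTensor, fun x ℓ => ?_, fun x ℓ => ?_,
      (D σ).ofGroupTensor_injective hPm, (D σ).denseRange_ofGroupTensor,
      (D σ).dualIndIso_groupTensor_act hPm⟩⟩
  · exact groupTensorMap_tmul _ x ℓ
  · exact (D σ).ofGroupTensor_tmul x ℓ
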